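/- **Theorem.** Let $\mathbb K\in\{\mathbb R,\mathbb C\}$, let $A:X\to Y$ be a continuous linear operator between Banach spaces over $\mathbb K$, let $\xi$ be an ordinal, and let $\mathcal D$ be any neighborhood basis at $0$ for the weak topology of $X$. (i) For every $1<p<\infty$ the following are equivalent: (a) there is an equivalent norm $|\cdot|$ on $Y$ such that $A:X\to(Y,|\cdot|)$ is $\xi$-$p$-asymptotically uniformly smooth; (b) $A$ satisfies $\xi$-$\ell_p$ upper tree estimates; (c) $A$ satisfies $\xi$-$\ell_p$ upper tree estimates on normally weakly null collections over $\mathcal D$. (ii) The following are equivalent: (a) there is an equivalent norm $|\cdot|$ on $Y$ such that $A:X\to(Y,|\cdot|)$ is $\xi$-asymptotically uniformly flat; (b) $A$ satisfies $\xi$-$c_0$ upper tree estimates; (c) $A$ satisfies $\xi$-$c_0$ upper tree estimates on normally weakly null collections over $\mathcal D$. **Trees.** A tree is a set $T$ of nonempty finite sequences closed under nonempty initial segments; $s\le t$ means that $s$ is an initial segment of $t$. $MAX(S)$ is the set of members of $S$ with no proper extension in $S$. Put $T^0=T$, $T^{\zeta+1}=T^\zeta\setminus MAX(T^\zeta)$,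 $T^\zeta=\bigcap_{\eta<\zeta}T^\eta$ for limit $\zeta$; $o(T)$ is the least $\zeta$ with $T^\zeta=\varnothing$. For a (nonempty) directed set $D$ and a set $S$ of sequences, $S.D=\{(\zeta_i,u_i)_{i=1}^n:(\zeta_i)_{i=1}^n\in S,\ u_i\in D\}$. A collection $(x_t)_{t\in T.D}\subset X$ is weakly null if for every $t\in T.D\cup\{\varnothing\}$ and $\zeta$ with $t\smallfrown(\zeta,u)\in T.D$ for all $u\in D$, the net $(x_{t\smallfrown(\zeta,u)})_{u\in D}$ is weakly null. **Modulus.** Let $N$ be a norm on $Y$ equivalent to the given one. For $\sigma>0$ and $A\neq0$, $$\varrho_\xi(\sigma,A:X\to(Y,N))=\sup\ \inf\{N(y+Ax)-1:\ t\in T.D,\ x\in\mathrm{co}(x_s:\varnothing<s\le t)\},$$ the supremum being over all $y$ with $N(y)\le1$, all trees $T$ with $o(T)=\omega^\xi$, all directed sets $D$, and all weakly null $(x_t)_{t\in T.D}\subset\sigma B_X$; for $A=0$ the modulus is $0$. The operator $A:X\to (Y,N)$ is $\xi$-$p$-asymptotically uniformly smooth if $\sup_{\sigma>0}\varrho_\xi(\sigma,A)/\sigma^p<\infty$,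 and $\xi$-asymptotically uniformly flat if $\varrho_\xi(\sigma,A)=0$ for some $\sigma>0$. **The trees $\Gamma$ and weights $\mathbb P$.** For a sequence $t=(\zeta_i)$ of ordinals, $\zeta+t=(\zeta+\zeta_i)$. Let $\Gamma_{0,1}=\{(0)\}$ and $\mathbb P_{0,1}((0))=1$. Given $\Gamma_{\xi,1}$, $\mathbb P_{\xi,1}$, let, for $1\le i\le n$, $\Lambda_{\xi,n,i}$ be the set of sequences $s=(\omega^\xi(n-1)+t_1)\smallfrown\cdots\smallfrown(\omega^\xi(n-i)+t_i)$ with $t_1,\dots,t_{i-1}\in MAX(\Gamma_{\xi,1})$, $t_i\in\Gamma_{\xi,1}$, put $\mathbb P_{\xi,n}(s)=\mathbb P_{\xi,1}(t_i)$ and $\Gamma_{\xi,n}=\bigcup_{i\le n}\Lambda_{\xi,n,i}$. Let $\Gamma_{\xi+1,1}=\bigcup_{n\ge1}\Gamma_{\xi,n}$ with $\mathbb P_{\xi+1,1}=\frac1n\mathbb P_{\xi,n}$ on $\Gamma_{\xi,n}$. For limit $\xi$ let $\Gamma_{\xi,1}=\bigcup_{\zeta<\xi}(\omega^\zeta+\Gamma_{\zeta+1,1})$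 with $\mathbb P_{\xi,1}(\omega^\zeta+t)=\mathbb P_{\zeta+1,1}(t)$. Finally $\Lambda_{\xi,\infty,i}$ is the set of $s=t_1\smallfrown(\omega^\xi+t_2)\smallfrown\cdots\smallfrown(\omega^\xi(i-1)+t_i)$ with $t_1,\dots,t_{i-1}\in MAX(\Gamma_{\xi,1})$, $t_i\in\Gamma_{\xi,1}$; $\mathbb P_{\xi,\infty}(s)=\mathbb P_{\xi,1}(t_i)$; $\Gamma_{\xi,\infty}=\bigcup_i\Lambda_{\xi,\infty,i}$. Weights of sequences of pairs are those of their first coordinates, and $\zeta+t$ for a sequence of pairs shifts the first coordinates. **Cofinal, eventual, big.** Fix $D$. For $\mathcal E\subset MAX(\Gamma_{\xi,n}.D)$ define "$\mathcal E$ is cofinal in $\Gamma_{\xi,n}.D$" recursively: for $\xi=0$, $n=1$, if $\{u:((0,u))\in\mathcal E\}$ is cofinal in $D$; for limit $\xi$ and $n=1$, if for cofinally many $\zeta<\xi$ the set $\{t\in MAX(\Gamma_{\zeta+1,1}.D):\omega^\zeta+t\in\mathcal E\}$ is cofinal in $\Gamma_{\zeta+1,1}.D$; for $\xi+1$ and $n=1$,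 if for infinitely many $m$ the set $\mathcal E\cap\Gamma_{\xi,m}.D$ is cofinal in $\Gamma_{\xi,m}.D$; for $\xi$ and $n+1$, if the set of $t\in MAX(\Gamma_{\xi,1}.D)$ such that $\{s\in MAX(\Gamma_{\xi,n}.D):(\omega^\xi n+t)\smallfrown s\in\mathcal E\}$ is cofinal in $\Gamma_{\xi,n}.D$ is itself cofinal in $\Gamma_{\xi,1}.D$. A set $\mathcal E\subset MAX(\Gamma_{\xi,1}.D)$ is eventual if $MAX(\Gamma_{\xi,1}.D)\setminus\mathcal E$ is not cofinal. A set $B\subset\bigcup_n MAX(\Lambda_{\xi,\infty,n}.D)$ is inevitable if $B\cap MAX(\Lambda_{\xi,\infty,1}.D)$ is eventual and for all $n$ and all $t\in B\cap MAX(\Lambda_{\xi,\infty,n}.D)$ the set $\{r\in MAX(\Gamma_{\xi,1}.D): t\smallfrown(\omega^\xi n+r)\in B\}$ is eventual. A set is big if it contains an inevitable set. **Upper tree estimates.** Let $E$ be $\ell_p$ or $c_0$ with unit vector basis $(e_i)$. For a collection $(x_t)_{t\in\Gamma_{\xi,\infty}.D}$ and $t\in MAX(\Lambda_{\xi,\infty,n}.D)$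 let $z_i^t=\sum_{\Lambda_{\xi,\infty,i}.D\ni s\le t}\mathbb P_{\xi,\infty}(s)x_s$ for $1\le i\le n$. The operator $A$ satisfies $\xi$-$E$ upper tree estimates if there is $C>0$ such that for every directed set $D$ and every weakly null $(x_t)_{t\in\Gamma_{\xi,\infty}.D}\subset B_X$ the set $$\bigcup_{n=1}^\infty\Bigl\{t\in MAX(\Lambda_{\xi,\infty,n}.D):\ \forall (a_i)_{i=1}^n\in\mathbb K^n,\ \Bigl\|A\sum_{i=1}^n a_iz_i^t\Bigr\|\le C\Bigl\|\sum_{i=1}^n a_ie_i\Bigr\|_E\Bigr\}$$ is big. It satisfies them on normally weakly null collections over $\mathcal D$ if the same holds, for some $C>0$, for $D=\mathcal D$ directed by reverse inclusion and all $(x_t)_{t\in\Gamma_{\xi,\infty}.\mathcal D}\subset B_X$ such that $x_t\in U_k$ whenever $t=(\zeta_i,U_i)_{i=1}^k$. -/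

import Mathlib

open Filter Topology

universe u v w

namespace XiSmooth

noncomputable section

/-! ### Trees of finite sequences -/

section Trees

variable {Λ : Type*}

/-- A tree on `Λ`: a set of nonempty finite sequences closed under nonempty initial segments. -/
def IsTree (T : Set (List Λ)) : Prop :=
  ∀ t ∈ T, t ≠ [] ∧ ∀ s, s ≠ [] → s <+: t → s ∈ T

/-- `MAX(S)`: the members of `S` having no proper extension in `S`. -/
def maxSet (S : Set (List Λ)) : Set (List Λ) :=
  {t | t ∈ S ∧ ∀ s ∈ S, t <+: s → s = t}

/-- The transfinite derived trees: `T^0 = T`, `T^(ξ+1) = T^ξ \ MAX(T^ξ)`, and intersections at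
limit ordinals. -/
def derivedTree (T : Set (List Λ)) (ξ : Ordinal.{w}) : Set (List Λ) :=
  Ordinal.limitRecOn (motive := fun _ => Set (List Λ)) ξ T
    (fun _ S => S \ maxSet S)
    (fun ξ _ S => ⋂ (ζ : Ordinal.{w}) (h : ζ < ξ), S ζ h)

/-- `o(T) = α`: the derived tree of order `α` is empty and `α` is the least such ordinal. -/
def HasOrder (T : Set (List Λ)) (α : Ordinal.{w}) : Prop :=
  derivedTree T α = ∅ ∧ ∀ β < α, derivedTree T β ≠ ∅

/-- `T.D`: the sequences of pairs `(ζ_i, u_i)` with `(ζ_i) ∈ T` and `u_i ∈ D`. -/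
def dot (T : Set (List Λ)) (D : Type*) : Set (List (Λ × D)) :=
  {t | t.map Prod.fst ∈ T}

end Trees

/-! ### Weakly null collections -/

section WeaklyNull

variable (𝕜 : Type*) [RCLike 𝕜] {X : Type*} [NormedAddCommGroup X] [NormedSpace 𝕜 X]
  {Λ D : Type*} [Preorder D]

/-- A collection `(x_t)_{t ∈ T.D}` is weakly null if for every `t ∈ T'.D ∪ {∅}` and every `ζ` such
that the sequences `t ⌢ (ζ, u)`, `u ∈ D`, lie in `T.D`, the net `(x_{t ⌢ (ζ, u)})_{u ∈ D}` is weakly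
null. (Values of `x` outside `T.D` play no role.) -/
def IsWeaklyNull (T : Set (List Λ)) (x : List (Λ × D) → X) : Prop :=
  ∀ (t : List (Λ × D)) (ζ : Λ), t.map Prod.fst ++ [ζ] ∈ T →
    ∀ f : StrongDual 𝕜 X, Tendsto (fun u : D => f (x (t ++ [(ζ, u)]))) atTop (𝓝 0)

/-- `co(x_s : ∅ < s ≤ t)`, the set of convex combinations of the vectors along the branch ending
at `t`; the nonempty initial segments of `t` are `t.take (i + 1)`, `i < t.length`. -/
def branchHull (x : List (Λ × D) → X) (t : List (Λ × D)) : Set X :=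
  {z | ∃ c : ℕ → ℝ, (∀ i, 0 ≤ c i) ∧ ∑ i ∈ Finset.range t.length, c i = 1 ∧
    z = ∑ i ∈ Finset.range t.length, (c i : 𝕜) • x (t.take (i + 1))}

end WeaklyNull

/-! ### The modulus and the renorming properties -/

section Modulus

variable {𝕜 : Type*} [RCLike 𝕜]
  {X : Type u} [NormedAddCommGroup X] [NormedSpace 𝕜 X]
  {Y : Type v} [NormedAddCommGroup Y] [NormedSpace 𝕜 Y]

/-- `N` is (the norm function of) an equivalent norm on `Y`. -/
def IsEquivNorm (N : Seminorm 𝕜 Y) : Prop :=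
  ∃ c C : ℝ, 0 < c ∧ 0 < C ∧ ∀ y, c * ‖y‖ ≤ N y ∧ N y ≤ C * ‖y‖

/-- The modulus `ϱ_ξ(σ, A)` of the operator `A : X → (Y, N)`: the supremum, over all `y` in the unit
ball of `(Y, N)`, all trees `T` with `o(T) = ω^ξ`, all directed sets `D` and all weakly null
collections `(x_t)_{t ∈ T.D}` in `σ B_X`, of
`inf {N (y + A z) - 1 : t ∈ T.D, z ∈ co(x_s : ∅ < s ≤ t)}`.
Both the infimum and the supremum are of bounded sets when `N` is an equivalent norm. -/
def modulus (ξ : Ordinal.{w}) (A : X →L[𝕜] Y) (N : Seminorm 𝕜 Y) (σ : ℝ) : ℝ :=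
  open Classical in
  if A = 0 ∨ σ = 0 then 0 else
  sSup {r : ℝ | ∃ (y : Y) (Λ : Type (w + 1)) (T : Set (List Λ))
    (D : Type u) (_ : Preorder D) (_ : Nonempty D) (_ : IsDirectedOrder D)
    (x : List (Λ × D) → X),
    N y ≤ 1 ∧ IsTree T ∧ HasOrder T (Ordinal.omega0.{w} ^ ξ) ∧
    IsWeaklyNull 𝕜 T x ∧ (∀ t ∈ dot T D, ‖x t‖ ≤ σ) ∧
    r = sInf {q : ℝ | ∃ t ∈ dot T D, ∃ z ∈ branchHull 𝕜 x t, q = N (y + A z) - 1}}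

/-- `A : X → (Y, N)` is `ξ`-`p`-asymptotically uniformly smooth:
`sup_{σ > 0} ϱ_ξ(σ, A) / σ^p < ∞`. -/
def IsAUSmooth (ξ : Ordinal.{w}) (p : ℝ) (A : X →L[𝕜] Y) (N : Seminorm 𝕜 Y) : Prop :=
  BddAbove {r : ℝ | ∃ σ : ℝ, 0 < σ ∧ r = modulus ξ A N σ / σ ^ p}

/-- `A : X → (Y, N)` is `ξ`-asymptotically uniformly flat: `ϱ_ξ(σ, A) = 0` for some `σ > 0`. -/
def IsAUFlat (ξ : Ordinal.{w}) (A : X →L[𝕜] Y) (N : Seminorm 𝕜 Y) : Prop :=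
  ∃ σ : ℝ, 0 < σ ∧ modulus ξ A N σ = 0

/-- `A` is `ξ`-`p`-asymptotically uniformly smoothable. -/
def IsAUSmoothable (ξ : Ordinal.{w}) (p : ℝ) (A : X →L[𝕜] Y) : Prop :=
  ∃ N : Seminorm 𝕜 Y, IsEquivNorm N ∧ IsAUSmooth ξ p A N

/-- `A` is `ξ`-asymptotically uniformly flattenable. -/
def IsAUFlattenable (ξ : Ordinal.{w}) (A : X →L[𝕜] Y) : Prop :=
  ∃ N : Seminorm 𝕜 Y, IsEquivNorm N ∧ IsAUFlat ξ A N

end Modulus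

/-! ### The trees `Γ_{ξ,n}` and `Γ_{ξ,∞}` -/

/-- `ζ + (ζ_1, …, ζ_n) = (ζ + ζ_1, …, ζ + ζ_n)`. -/
def shift (ζ : Ordinal.{w}) (t : List Ordinal.{w}) : List Ordinal.{w} :=
  t.map (fun a => ζ + a)

/-- The concatenations `(c_0 + t_1) ⌢ … ⌢ (c_{i-1} + t_i)` with `t_1, …, t_i ∈ MAX(G)`. -/
def fullBlocks (G : Set (List Ordinal.{w})) (c : ℕ → Ordinal.{w}) : ℕ → Set (List Ordinal.{w})
  | 0 => {[]}
  | i + 1 => {s | ∃ t ∈ fullBlocks G c i, ∃ r ∈ maxSet G, s = t ++ shift (c i) r}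

/-- The concatenations `(c_0 + t_1) ⌢ … ⌢ (c_i + t_{i+1})` with `t_1, …, t_i ∈ MAX(G)` and
`t_{i+1} ∈ G`. -/
def blockLevel (G : Set (List Ordinal.{w})) (c : ℕ → Ordinal.{w}) (i : ℕ) :
    Set (List Ordinal.{w}) :=
  {s | ∃ t ∈ fullBlocks G c i, ∃ r ∈ G, s = t ++ shift (c i) r}

/-- `Γ_{ξ,n}` obtained from `G = Γ_{ξ,1}`: the union of the levels
`Λ_{ξ,n,i+1} = {(ω^ξ (n-1) + t_1) ⌢ … ⌢ (ω^ξ (n-1-i) + t_{i+1})}` for `i < n`. -/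
def unionLevels (ξ : Ordinal.{w}) (G : Set (List Ordinal.{w})) (n : ℕ) : Set (List Ordinal.{w}) :=
  ⋃ (i : ℕ) (_ : i < n),
    blockLevel G (fun j => Ordinal.omega0 ^ ξ * ((n - 1 - j : ℕ) : Ordinal.{w})) i

/-- `Γ_{ξ,1}`: `Γ_{0,1} = {(0)}`, `Γ_{ξ+1,1} = ⋃_{n ≥ 1} Γ_{ξ,n}`, and
`Γ_{ξ,1} = ⋃_{ζ < ξ} (ω^ζ + Γ_{ζ+1,1})` for limit `ξ`. -/
def Gam (ξ : Ordinal.{w}) : Set (List Ordinal.{w}) :=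
  Ordinal.limitRecOn (motive := fun _ => Set (List Ordinal.{w})) ξ {[0]}
    (fun ξ G => ⋃ (n : ℕ) (_ : 1 ≤ n), unionLevels ξ G n)
    (fun ξ hξ G => ⋃ (ζ : Ordinal.{w}) (h : ζ < ξ),
      shift (Ordinal.omega0 ^ ζ) '' G (ζ + 1) (hξ.add_one_lt h))

/-- `Γ_{ξ,n}`. -/
def GamFin (ξ : Ordinal.{w}) (n : ℕ) : Set (List Ordinal.{w}) :=
  unionLevels ξ (Gam ξ) n

/-- `Λ_{ξ,∞,i+1}`, the level of `Γ_{ξ,∞}` with index `i + 1`: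
the concatenations `t_1 ⌢ (ω^ξ + t_2) ⌢ … ⌢ (ω^ξ i + t_{i+1})`. -/
def LamInf (ξ : Ordinal.{w}) (i : ℕ) : Set (List Ordinal.{w}) :=
  blockLevel (Gam ξ) (fun j => Ordinal.omega0 ^ ξ * (j : Ordinal.{w})) i

/-- `Γ_{ξ,∞}`. -/
def GamInf (ξ : Ordinal.{w}) : Set (List Ordinal.{w}) :=
  ⋃ i : ℕ, LamInf ξ i

/-! ### The convex weights `ℙ_{ξ,n}` -/

/-- The last block of a sequence `(ω^ξ k_1 + t_1) ⌢ … ⌢ (ω^ξ k_i + t_i)` with distinct `k_j` and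
with entries of the `t_j` below `ω^ξ`, shifted back: this is `t_i`. -/
def lastBlock (ξ : Ordinal.{w}) (s : List Ordinal.{w}) : List Ordinal.{w} :=
  open Classical in
  (s.filter (fun a => a / Ordinal.omega0 ^ ξ = s.getLastD 0 / Ordinal.omega0 ^ ξ)).map
    (fun a => a % Ordinal.omega0 ^ ξ)

/-- For `s ∈ Γ_{ξ+1,1}`, the unique `n` with `s ∈ Γ_{ξ,n}`; that is, the `n` for which the first
member of `s` lies in `[ω^ξ (n-1), ω^ξ n)`. -/
def finIndex (ξ : Ordinal.{w}) (s : List Ordinal.{w}) : ℕ :=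
  sInf {n : ℕ | s.headD 0 < Ordinal.omega0 ^ ξ * (n : Ordinal.{w})}

/-- The weights `ℙ_{ξ,1}` on `Γ_{ξ,1}`: `ℙ_{0,1}((0)) = 1`;
`ℙ_{ξ+1,1}(s) = ℙ_{ξ,n}(s) / n` for `s ∈ Γ_{ξ,n}`, where
`ℙ_{ξ,n}((ω^ξ (n-1) + t_1) ⌢ … ⌢ (ω^ξ (n-i) + t_i)) = ℙ_{ξ,1}(t_i)`;
and `ℙ_{ξ,1}(ω^ζ + t) = ℙ_{ζ+1,1}(t)` for limit `ξ`, `ζ < ξ` and `t ∈ Γ_{ζ+1,1}`. Here `ζ` is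
recovered from `ω^ζ + t` as the `ζ` such that the first member lies in `[ω^ζ, ω^(ζ+1))`. -/
def weight (ξ : Ordinal.{w}) : List Ordinal.{w} → ℝ :=
  open Classical in
  Ordinal.limitRecOn (motive := fun _ => List Ordinal.{w} → ℝ) ξ (fun _ => 1)
    (fun ξ P s => P (lastBlock ξ s) / (finIndex ξ s : ℝ))
    (fun ξ _ P s =>
      if h : Ordinal.log Ordinal.omega0 (s.headD 0) + 1 < ξ then
        P (Ordinal.log Ordinal.omega0 (s.headD 0) + 1) h
          (s.map (fun a => a - Ordinal.omega0 ^ Ordinal.log Ordinal.omega0 (s.headD 0)))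
      else 0)

/-- The weights `ℙ_{ξ,∞}` on `Γ_{ξ,∞}`:
`ℙ_{ξ,∞}(t_1 ⌢ (ω^ξ + t_2) ⌢ … ⌢ (ω^ξ (i-1) + t_i)) = ℙ_{ξ,1}(t_i)`. -/
def weightInf (ξ : Ordinal.{w}) (s : List Ordinal.{w}) : ℝ :=
  weight ξ (lastBlock ξ s)

/-! ### Cofinal, eventual, inevitable and big sets -/

section Big

variable {D : Type*} [Preorder D]

/-- `ζ + t` for a sequence `t` of pairs (only the ordinals are shifted). -/
def shiftD (ζ : Ordinal.{w}) (t : List (Ordinal.{w} × D)) : List (Ordinal.{w} × D) :=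
  t.map (fun q => (ζ + q.1, q.2))

/-- For `Ω = Ω_{ξ,1}` this is `Ω_{ξ,n+1}`: a set `E ⊆ MAX(Γ_{ξ,n+2}.D)` is in `Ω_{ξ,n+2}` if the
set of those `t ∈ MAX(Γ_{ξ,1}.D)`, for which the part of `E` above `ω^ξ (n+1) + t` is in
`Ω_{ξ,n+1}` (after removing that initial segment), is in `Ω_{ξ,1}`. -/
def cofinalFin (ξ : Ordinal.{w}) (Ω : Set (List (Ordinal.{w} × D)) → Prop) :
    ℕ → Set (List (Ordinal.{w} × D)) → Prop
  | 0, E => Ω E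
  | n + 1, E => Ω {t | t ∈ maxSet (dot (Gam ξ) D) ∧
      cofinalFin ξ Ω n {s | s ∈ maxSet (dot (GamFin ξ (n + 1)) D) ∧
        shiftD (Ordinal.omega0 ^ ξ * ((n + 1 : ℕ) : Ordinal.{w})) t ++ s ∈ E}}

/-- `E ∈ Ω_{ξ,1}`, i.e. the subset `E` of `MAX(Γ_{ξ,1}.D)` is cofinal in `Γ_{ξ,1}.D`. -/
def IsCofinalMax (ξ : Ordinal.{w}) : Set (List (Ordinal.{w} × D)) → Prop :=
  Ordinal.limitRecOn (motive := fun _ => Set (List (Ordinal.{w} × D)) → Prop) ξ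
    (fun E => ∀ u : D, ∃ u' : D, u ≤ u' ∧ [((0 : Ordinal.{w}), u')] ∈ E)
    (fun ξ Ω E => ∀ m : ℕ, ∃ n : ℕ, m ≤ n ∧
      cofinalFin ξ Ω n (E ∩ dot (GamFin ξ (n + 1)) D))
    (fun ξ hξ Ω E => ∀ η < ξ, ∃ (ζ : Ordinal.{w}) (h : ζ < ξ), η ≤ ζ ∧
      Ω (ζ + 1) (hξ.add_one_lt h)
        {t | t ∈ maxSet (dot (Gam (ζ + 1)) D) ∧ shiftD (Ordinal.omega0 ^ ζ) t ∈ E})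

/-- A subset `E` of `MAX(Γ_{ξ,1}.D)` is eventual if its complement in `MAX(Γ_{ξ,1}.D)` fails to be
cofinal. -/
def IsEventual (ξ : Ordinal.{w}) (E : Set (List (Ordinal.{w} × D))) : Prop :=
  ¬ IsCofinalMax ξ (maxSet (dot (Gam ξ) D) \ E)

/-- A subset `B` of `⋃_n MAX(Λ_{ξ,∞,n}.D)` is inevitable if `B ∩ MAX(Λ_{ξ,∞,1}.D)` is eventual and,
for all `n` and `t ∈ B ∩ MAX(Λ_{ξ,∞,n}.D)`, the set of those members of `B ∩ MAX(Λ_{ξ,∞,n+1}.D)`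
that extend `t` is eventual, under the identification `r ↦ t ⌢ (ω^ξ n + r)` of `Γ_{ξ,1}.D`
with the unit above `t`. -/
def IsInevitable (ξ : Ordinal.{w}) (B : Set (List (Ordinal.{w} × D))) : Prop :=
  B ⊆ ⋃ n : ℕ, maxSet (dot (LamInf ξ n) D) ∧
  IsEventual ξ (B ∩ maxSet (dot (LamInf ξ 0) D)) ∧
  ∀ n : ℕ, ∀ t ∈ B ∩ maxSet (dot (LamInf ξ n) D),
    IsEventual ξ {r | r ∈ maxSet (dot (Gam ξ) D) ∧
      t ++ shiftD (Ordinal.omega0 ^ ξ * ((n + 1 : ℕ) : Ordinal.{w})) r ∈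
        B ∩ maxSet (dot (LamInf ξ (n + 1)) D)}

/-- A set is big if it contains an inevitable set. -/
def IsBig (ξ : Ordinal.{w}) (S : Set (List (Ordinal.{w} × D))) : Prop :=
  ∃ B ⊆ S, IsInevitable ξ B

end Big

/-! ### Upper tree estimates -/

section Estimates

variable {𝕜 : Type*} [RCLike 𝕜]
  {X : Type u} [NormedAddCommGroup X] [NormedSpace 𝕜 X]
  {Y : Type v} [NormedAddCommGroup Y] [NormedSpace 𝕜 Y]

/-- The vector `z^t_{i+1} = ∑ ℙ_{ξ,∞}(s) x_s`, the sum being over all `s ≤ t` in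
`Λ_{ξ,∞,i+1}.D`. -/
def blockVec (𝕜 : Type*) [RCLike 𝕜] {X : Type u} [NormedAddCommGroup X] [NormedSpace 𝕜 X]
    {D : Type*} (ξ : Ordinal.{w}) (x : List (Ordinal.{w} × D) → X)
    (t : List (Ordinal.{w} × D)) (i : ℕ) : X :=
  open Classical in
  ∑ k ∈ (Finset.range t.length).filter (fun k => t.take (k + 1) ∈ dot (LamInf ξ i) D),
    (weightInf ξ ((t.take (k + 1)).map Prod.fst) : 𝕜) • x (t.take (k + 1))

/-- `⋃_n {t ∈ MAX(Λ_{ξ,∞,n}.D) : ‖A ∑_{i ≤ n} a_i z^t_i‖ ≤ C ‖∑_{i ≤ n} a_i e_i‖_E for all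
scalars a_1, …, a_n}`, where `E n a` stands for `‖∑_{i ≤ n} a_i e_i‖_E`. -/
def goodSet {D : Type*} (E : (n : ℕ) → (Fin n → 𝕜) → ℝ) (C : ℝ) (ξ : Ordinal.{w})
    (A : X →L[𝕜] Y) (x : List (Ordinal.{w} × D) → X) : Set (List (Ordinal.{w} × D)) :=
  {t | ∃ n : ℕ, t ∈ maxSet (dot (LamInf ξ n) D) ∧
    ∀ a : Fin (n + 1) → 𝕜,
      ‖A (∑ i : Fin (n + 1), a i • blockVec 𝕜 ξ x t i)‖ ≤ C * E (n + 1) a}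

/-- `A` satisfies `ξ`-`E` upper tree estimates: for some `C > 0`, the good set is big for every
directed set `D` and every weakly null collection `(x_t)_{t ∈ Γ_{ξ,∞}.D}` in `B_X`. -/
def UpperTreeEstimates (E : (n : ℕ) → (Fin n → 𝕜) → ℝ) (ξ : Ordinal.{w}) (A : X →L[𝕜] Y) : Prop :=
  ∃ C : ℝ, 0 < C ∧ ∀ (D : Type u) [Preorder D] [Nonempty D] [IsDirectedOrder D]
    (x : List (Ordinal.{w} × D) → X),
    IsWeaklyNull 𝕜 (GamInf ξ) x → (∀ t ∈ dot (GamInf ξ) D, ‖x t‖ ≤ 1) →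
    IsBig ξ (goodSet E C ξ A x)

/-- `𝓓` is a neighborhood basis at `0` for the weak topology of `X`. -/
def IsWeakNhdsBasis (𝕜 : Type*) [RCLike 𝕜] {X : Type u} [NormedAddCommGroup X] [NormedSpace 𝕜 X]
    (𝓓 : Set (Set X)) : Prop :=
  (comap (toWeakSpace 𝕜 X) (𝓝 0)).HasBasis (fun U : Set X => U ∈ 𝓓) id

/-- `ξ`-`E` upper tree estimates tested only on normally weakly null collections: here `D` is the
given weak neighborhood basis `𝓓` at `0`, directed by reverse inclusion, and the collections
`(x_t)_{t ∈ Γ_{ξ,∞}.D}` in `B_X` are those with `x_t ∈ U_n` for `t = (ζ_i, U_i)_{i ≤ n}`. -/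
def NormalUpperTreeEstimates (𝓓 : Set (Set X)) (E : (n : ℕ) → (Fin n → 𝕜) → ℝ)
    (ξ : Ordinal.{w}) (A : X →L[𝕜] Y) : Prop :=
  ∃ C : ℝ, 0 < C ∧ ∀ x : List (Ordinal.{w} × (↥𝓓)ᵒᵈ) → X,
    (∀ (t : List (Ordinal.{w} × (↥𝓓)ᵒᵈ)) (ζ : Ordinal.{w}) (U : ↥𝓓),
      t ++ [(ζ, OrderDual.toDual U)] ∈ dot (GamInf ξ) (↥𝓓)ᵒᵈ →
        x (t ++ [(ζ, OrderDual.toDual U)]) ∈ (U : Set X)) →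
    (∀ t ∈ dot (GamInf ξ) (↥𝓓)ᵒᵈ, ‖x t‖ ≤ 1) →
    IsBig ξ (goodSet E C ξ A x)

/-- The norm of `∑_{i ≤ n} a_i e_i` in `ℓ_p`. -/
def ellpNorm (𝕜 : Type*) [RCLike 𝕜] (p : ℝ) (n : ℕ) (a : Fin n → 𝕜) : ℝ :=
  (∑ i, ‖a i‖ ^ p) ^ (1 / p)

/-- The norm of `∑_{i ≤ n} a_i e_i` in `c_0` (the sup norm on `𝕜^n`). -/
def c0Norm (𝕜 : Type*) [RCLike 𝕜] (n : ℕ) (a : Fin n → 𝕜) : ℝ := ‖a‖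

end Estimates

end

end XiSmooth

/-! For fixed $D$, the notions of cofinal and eventual set are the "frequently" and "eventually" of
one filter, `evFilter D ξ`, built by iterated `Filter.bind` along the recursion for $\Gamma_{\xi,1}$
and concentrated on maximal branches of total weight one (`isCofinalMax_iff`,
`eventually_evFilter`). In particular, if a union of two sets is cofinal, then one of them is.

Arbitrary trees of order $\omega^\xi$ are compared with $\Gamma_{\xi,1}$ through a rank. A set
$\mathcal T$ of finite sequences of vectors has rank $\alpha$ at the empty sequence if for every
$\beta<\alpha$ one can append a vector, in any prescribed weak neighborhood of $0$, and keep rank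
$\beta$. The branches of a weakly null collection over a tree of order $\alpha$ have rank $\alpha$
(`hasRank_branches`), and rank $\alpha$ unfolds to a normal collection over the decreasing sequences
below $\alpha$ (`HasRank.exists_collection`), among which lie the members of $\Gamma_{\xi,1}$ when
$\alpha=\omega^\xi$. The combinatorial core is `hasRank_of_frequently`: if $\mathcal T$ is
hereditary and cofinally many branches contain a part of weight at least $\varepsilon$ lying in
$\mathcal T$, then $\mathcal T$ has the full rank $\omega^\xi$. With Hahn–Banach this shows that
$N(y+\sigma Az)$, for the weighted averages $z$, is eventually at most
$1+\varrho_\xi(\sigma,A)+\delta$ (`eventually_le_modulus`); `modulus_le` is the converse.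

Both sequence norms arise by iterating a binary operation $op$, namely $(r^p+s^p)^{1/p}$ or $\max$.
Smoothness or flatness gives one-step estimates $N(y+aAz)\le op(r,C|a|)$ for $N(y)<r$. Compactness
of the sphere of scalars makes them uniform, and iteration with slightly growing constants gives the
tree estimates (`StepEstimate.upperTreeEstimates`).

For the return from normal collections, consider a game in which one player picks normal collections
and scalars, trying to lift the norm, starting at $y$, above a level that starts at $r$ and is
raised by $op$ at each move (`Win`). A winning strategy glues to one normal collection, so the tree
estimates force $r\le2\|y\|$. The supremum of the winning levels at $y$ is then an equivalent norm:
the triangle inequality holds because a win at a convex combination is a win at one of the two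
points (`Win.or_of_combination`), and the one-step estimate holds because a violating move would
itself be winning. -/

namespace XiSmooth

noncomputable section

open scoped Ordinal

/-! ### Shifts and prefixes -/

theorem shift_append (ζ : Ordinal.{w}) (s t : List Ordinal.{w}) :
    shift ζ (s ++ t) = shift ζ s ++ shift ζ t := List.map_append

theorem prefix_of_map_prefix_map {α β : Type*} {f : α → β} (hf : Function.Injective f)
    {s t : List α} (h : s.map f <+: t.map f) : s <+: t := by
  have h1 : s = t.take s.length := by
    apply List.map_injective_iff.2 hf
    rw [List.map_take]
    simpa using List.prefix_iff_eq_take.1 h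
  rw [h1]
  exact List.take_prefix _ _

theorem shift_prefix_iff {ζ : Ordinal.{w}} {s t : List Ordinal.{w}} :
    shift ζ s <+: shift ζ t ↔ s <+: t :=
  ⟨prefix_of_map_prefix_map fun _ _ h => add_left_cancel h, fun h => h.map _⟩

theorem exists_of_prefix_shift {ζ : Ordinal.{w}} {p t : List Ordinal.{w}} (h : p <+: shift ζ t) :
    ∃ s, s <+: t ∧ p = shift ζ s := by
  refine ⟨t.take p.length, List.take_prefix _ _, ?_⟩
  rw [shift, List.map_take]
  exact List.prefix_iff_eq_take.1 h

theorem prefix_append_cases {α : Type*} {p s t : List α} (h : p <+: s ++ t) :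
    p <+: s ∨ ∃ r, r ≠ [] ∧ r <+: t ∧ p = s ++ r := by
  rcases List.prefix_or_prefix_of_prefix h (List.prefix_append s t) with h1 | ⟨r, rfl⟩
  · exact Or.inl h1
  · rcases eq_or_ne r [] with rfl | hr
    · left; simp
    · exact Or.inr ⟨r, hr, (List.prefix_append_right_inj s).1 h, rfl⟩

theorem mem_shift {ζ a : Ordinal.{w}} {t : List Ordinal.{w}} :
    a ∈ shift ζ t ↔ ∃ b ∈ t, ζ + b = a := List.mem_map

theorem shift_ne_nil {ζ : Ordinal.{w}} {t : List Ordinal.{w}} : shift ζ t ≠ [] ↔ t ≠ [] := by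
  simp [shift]

theorem pairwise_shift {ζ : Ordinal.{w}} {t : List Ordinal.{w}} (h : t.Pairwise (· > ·)) :
    (shift ζ t).Pairwise (· > ·) :=
  List.Pairwise.map _ (fun _ _ hab => (add_lt_add_iff_left ζ).2 hab) h

theorem add_lt_omega_mul_succ {ξ b : Ordinal.{w}} (n : ℕ) (hb : b < ω ^ ξ) :
    ω ^ ξ * (n : Ordinal.{w}) + b < ω ^ ξ * ((n + 1 : ℕ) : Ordinal.{w}) := by
  rw [Nat.cast_add, Nat.cast_one, mul_add, mul_one]
  exact (add_lt_add_iff_left _).2 hb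

theorem omega_mul_mono {ξ : Ordinal.{w}} {m n : ℕ} (h : m ≤ n) :
    ω ^ ξ * (m : Ordinal.{w}) ≤ ω ^ ξ * (n : Ordinal.{w}) := by
  gcongr

theorem omega_mul_lt {ξ : Ordinal.{w}} (n : ℕ) :
    ω ^ ξ * (n : Ordinal.{w}) < ω ^ (ξ + 1) := by
  rw [Ordinal.opow_add, Ordinal.opow_one]
  exact (mul_lt_mul_iff_right₀ (Ordinal.opow_pos _ Ordinal.omega0_pos)).2
    (Ordinal.natCast_lt_omega0 n)

/-! ### The strictly decreasing sequences below an ordinal -/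

/-- The set of strictly decreasing sequences of ordinals below `α`. -/
def decreasing (α : Ordinal.{w}) : Set (List Ordinal.{w}) :=
  {t | t.Pairwise (· > ·) ∧ ∀ a ∈ t, a < α}

/-- The properties of `Γ_{ξ,1}` and `Γ_{ξ,n}` used throughout: a tree of strictly decreasing
sequences below `α`. -/
def IsDecTree (α : Ordinal.{w}) (G : Set (List Ordinal.{w})) : Prop :=
  IsTree G ∧ G ⊆ decreasing α

theorem IsDecTree.ne_nil {α : Ordinal.{w}} {G : Set (List Ordinal.{w})} (h : IsDecTree α G)
    {t : List Ordinal.{w}} (ht : t ∈ G) : t ≠ [] := (h.1 t ht).1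

theorem IsDecTree.lt {α : Ordinal.{w}} {G : Set (List Ordinal.{w})} (h : IsDecTree α G)
    {t : List Ordinal.{w}} (ht : t ∈ G) {a : Ordinal.{w}} (ha : a ∈ t) : a < α :=
  (h.2 ht).2 a ha

/-! ### Concatenations of blocks -/

theorem fullBlocks_cons (G : Set (List Ordinal.{w})) (c : ℕ → Ordinal.{w}) (i : ℕ) :
    fullBlocks G c (i + 1) = {s | ∃ t ∈ maxSet G, ∃ r ∈ fullBlocks G (fun j => c (j + 1)) i,
      s = shift (c 0) t ++ r} := by
  induction i with
  | zero => ext s; simp [fullBlocks]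
  | succ i ih =>
    ext s
    rw [fullBlocks, ih]
    constructor
    · rintro ⟨_, ⟨t, ht, r, hr, rfl⟩, r', hr', rfl⟩
      exact ⟨t, ht, _, ⟨r, hr, r', hr', rfl⟩, by simp⟩
    · rintro ⟨t, ht, _, ⟨r, hr, r', hr', rfl⟩, rfl⟩
      exact ⟨_, ⟨t, ht, r, hr, rfl⟩, r', hr', by simp⟩

theorem blockLevel_zero (G : Set (List Ordinal.{w})) (c : ℕ → Ordinal.{w}) :
    blockLevel G c 0 = shift (c 0) '' G := by
  ext s; simp [blockLevel, fullBlocks, eq_comm]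

theorem blockLevel_succ (G : Set (List Ordinal.{w})) (c : ℕ → Ordinal.{w}) (i : ℕ) :
    blockLevel G c (i + 1) = {s | ∃ t ∈ maxSet G, ∃ r ∈ blockLevel G (fun j => c (j + 1)) i,
      s = shift (c 0) t ++ r} := by
  ext s
  simp only [blockLevel, fullBlocks_cons]
  constructor
  · rintro ⟨_, ⟨t, ht, r, hr, rfl⟩, r', hr', rfl⟩
    exact ⟨t, ht, _, ⟨r, hr, r', hr', rfl⟩, by simp⟩
  · rintro ⟨t, ht, _, ⟨r, hr, r', hr', rfl⟩, rfl⟩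
    exact ⟨_, ⟨t, ht, r, hr, rfl⟩, r', hr', by simp⟩

theorem unionLevels_zero (ξ : Ordinal.{w}) (G : Set (List Ordinal.{w})) :
    unionLevels ξ G 0 = ∅ := by
  simp [unionLevels]

/-- The first block carries the largest shift, so deleting it leaves a member of the tree with one
block fewer and unchanged shifts. Inductions on the number of blocks peel from the front in this
way, as does the recursion defining cofinality. -/
theorem mem_unionLevels_succ {ξ : Ordinal.{w}} {G : Set (List Ordinal.{w})} {n : ℕ}
    {s : List Ordinal.{w}} :
    s ∈ unionLevels ξ G (n + 1) ↔ (∃ t ∈ G, s = shift (ω ^ ξ * (n : Ordinal.{w})) t) ∨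
      ∃ t ∈ maxSet G, ∃ r ∈ unionLevels ξ G n, s = shift (ω ^ ξ * (n : Ordinal.{w})) t ++ r := by
  have hc : ∀ j : ℕ, n + 1 - 1 - (j + 1) = n - 1 - j := fun j => by omega
  simp only [unionLevels, Set.mem_iUnion, exists_prop]
  constructor
  · rintro ⟨i, hi, hs⟩
    cases i with
    | zero =>
      rw [blockLevel_zero] at hs
      obtain ⟨t, ht, rfl⟩ := hs
      exact Or.inl ⟨t, ht, by simp⟩
    | succ i =>
      rw [blockLevel_succ] at hs
      obtain ⟨t, ht, r, hr, rfl⟩ := hs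
      simp only [hc] at hr
      exact Or.inr ⟨t, ht, r, ⟨i, by omega, hr⟩, by simp⟩
  · rintro (⟨t, ht, rfl⟩ | ⟨t, ht, r, ⟨i, hi, hr⟩, rfl⟩)
    · exact ⟨0, by omega, by rw [blockLevel_zero]; exact ⟨t, ht, by simp⟩⟩
    · refine ⟨i + 1, by omega, ?_⟩
      rw [blockLevel_succ]
      simp only [hc]
      exact ⟨t, ht, r, hr, by simp⟩

theorem isDecTree_unionLevels {ξ : Ordinal.{w}} {G : Set (List Ordinal.{w})}
    (hG : IsDecTree (ω ^ ξ) G) (n : ℕ) :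
    IsDecTree (ω ^ ξ * (n : Ordinal.{w})) (unionLevels ξ G n) := by
  induction n with
  | zero => rw [unionLevels_zero]; exact ⟨fun t ht => ht.elim, fun t ht => ht.elim⟩
  | succ n ih =>
    have h1 : ∀ t ∈ G, ∀ a ∈ shift (ω ^ ξ * (n : Ordinal.{w})) t,
        ω ^ ξ * (n : Ordinal.{w}) ≤ a ∧ a < ω ^ ξ * ((n + 1 : ℕ) : Ordinal.{w}) := by
      intro t ht a ha
      obtain ⟨b, hb, rfl⟩ := mem_shift.1 ha
      exact ⟨le_self_add, add_lt_omega_mul_succ n (hG.lt ht hb)⟩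
    refine ⟨fun s hs => ⟨?_, fun p hp hps => ?_⟩, fun s hs => ⟨?_, fun a ha => ?_⟩⟩
    · rcases mem_unionLevels_succ.1 hs with ⟨t, ht, rfl⟩ | ⟨t, ht, r, hr, rfl⟩
      · exact shift_ne_nil.2 (hG.ne_nil ht)
      · exact List.append_ne_nil_of_right_ne_nil _ (ih.ne_nil hr)
    · rcases mem_unionLevels_succ.1 hs with ⟨t, ht, rfl⟩ | ⟨t, ht, r, hr, rfl⟩
      · obtain ⟨q, hq, rfl⟩ := exists_of_prefix_shift hps
        exact mem_unionLevels_succ.2 (Or.inl ⟨q, (hG.1 t ht).2 q (shift_ne_nil.1 hp) hq, rfl⟩)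
      · rcases prefix_append_cases hps with h | ⟨q, hq, hqr, rfl⟩
        · obtain ⟨q, hq, rfl⟩ := exists_of_prefix_shift h
          exact mem_unionLevels_succ.2
            (Or.inl ⟨q, (hG.1 t ht.1).2 q (shift_ne_nil.1 hp) hq, rfl⟩)
        · exact mem_unionLevels_succ.2 (Or.inr ⟨t, ht, q, (ih.1 r hr).2 q hq hqr, rfl⟩)
    · rcases mem_unionLevels_succ.1 hs with ⟨t, ht, rfl⟩ | ⟨t, ht, r, hr, rfl⟩
      · exact pairwise_shift (hG.2 ht).1
      · refine List.pairwise_append.2 ⟨pairwise_shift (hG.2 ht.1).1, (ih.2 hr).1,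
          fun a ha b hb => ?_⟩
        exact (ih.lt hr hb).trans_le (h1 t ht.1 a ha).1
    · rcases mem_unionLevels_succ.1 hs with ⟨t, ht, rfl⟩ | ⟨t, ht, r, hr, rfl⟩
      · exact (h1 t ht a ha).2
      · rcases List.mem_append.1 ha with ha | ha
        · exact (h1 t ht.1 a ha).2
        · exact (ih.lt hr ha).trans_le (omega_mul_mono (Nat.le_succ n))

/-- The first entry alone reveals the number of blocks. Hence the union forming the successor tree
is disjoint, comparable sequences belong to the same piece, and `finIndex` reads off the right
index. -/
theorem head_unionLevels {ξ : Ordinal.{w}} {G : Set (List Ordinal.{w})}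
    (hG : IsDecTree (ω ^ ξ) G) {n : ℕ} {s : List Ordinal.{w}} (hs : s ∈ unionLevels ξ G (n + 1)) :
    ω ^ ξ * (n : Ordinal.{w}) ≤ s.headD 0 ∧
      s.headD 0 < ω ^ ξ * ((n + 1 : ℕ) : Ordinal.{w}) := by
  have key : ∀ t ∈ G, ∀ r, ω ^ ξ * (n : Ordinal.{w}) ≤
      (shift (ω ^ ξ * (n : Ordinal.{w})) t ++ r).headD 0 ∧
      (shift (ω ^ ξ * (n : Ordinal.{w})) t ++ r).headD 0 < ω ^ ξ * ((n + 1 : ℕ) : Ordinal.{w}) := by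
    intro t ht r
    obtain ⟨a, t', rfl⟩ := List.exists_cons_of_ne_nil (hG.ne_nil ht)
    exact ⟨le_self_add, add_lt_omega_mul_succ n (hG.lt ht (by simp))⟩
  rcases mem_unionLevels_succ.1 hs with ⟨t, ht, rfl⟩ | ⟨t, ht, r, hr, rfl⟩
  · simpa using key t ht []
  · exact key t ht.1 r

theorem headD_eq_of_prefix {α : Type*} {s t : List α} (h : s <+: t) (hs : s ≠ []) (d : α) :
    s.headD d = t.headD d := by
  obtain ⟨r, rfl⟩ := h
  obtain ⟨a, s', rfl⟩ := List.exists_cons_of_ne_nil hs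
  rfl

theorem eq_of_mem_omega_block {ξ a : Ordinal.{w}} {m n : ℕ}
    (hm : ω ^ ξ * (m : Ordinal.{w}) ≤ a) (hm' : a < ω ^ ξ * ((m + 1 : ℕ) : Ordinal.{w}))
    (hn : ω ^ ξ * (n : Ordinal.{w}) ≤ a) (hn' : a < ω ^ ξ * ((n + 1 : ℕ) : Ordinal.{w})) :
    m = n := by
  by_contra hne
  rcases lt_or_gt_of_ne hne with h | h
  · exact absurd (hm'.trans_le (omega_mul_mono h)) (not_lt.2 hn)
  · exact absurd (hn'.trans_le (omega_mul_mono h)) (not_lt.2 hm)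

/-- An extension cannot consist of a single block, since the entries of `r` lie below the shift of
the first block. Its first block must then be `t`, because maximal members are pairwise
incomparable. -/
theorem append_mem_maxSet_unionLevels {ξ : Ordinal.{w}} {G : Set (List Ordinal.{w})}
    (hG : IsDecTree (ω ^ ξ) G) {n : ℕ} {t r : List Ordinal.{w}} (ht : t ∈ maxSet G)
    (hr : r ∈ maxSet (unionLevels ξ G n)) :
    shift (ω ^ ξ * (n : Ordinal.{w})) t ++ r ∈ maxSet (unionLevels ξ G (n + 1)) := by
  refine ⟨mem_unionLevels_succ.2 (Or.inr ⟨t, ht, r, hr.1, rfl⟩), fun s hs hps => ?_⟩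
  have hU := isDecTree_unionLevels hG n
  rcases mem_unionLevels_succ.1 hs with ⟨t', ht', rfl⟩ | ⟨t', ht', r', hr', rfl⟩
  · obtain ⟨a, r', rfl⟩ := List.exists_cons_of_ne_nil (hU.ne_nil hr.1)
    have h1 : a ∈ shift (ω ^ ξ * (n : Ordinal.{w})) t' := hps.subset (by simp)
    obtain ⟨b, _, hb⟩ := mem_shift.1 h1
    have h2 : a < ω ^ ξ * (n : Ordinal.{w}) := hU.lt hr.1 (by simp)
    exact absurd h2 (not_lt.2 (hb ▸ le_self_add))
  · have h1 := (List.prefix_append _ _).trans hps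
    have h2 : t = t' := by
      rcases List.prefix_or_prefix_of_prefix h1 (List.prefix_append _ _) with h | h
      · exact (ht.2 t' ht'.1 (shift_prefix_iff.1 h)).symm
      · exact ht'.2 t ht.1 (shift_prefix_iff.1 h)
    subst h2
    rw [hr.2 r' hr' ((List.prefix_append_right_inj _).1 hps)]

/-! ### The trees `Γ_{ξ,n}` -/

theorem Gam_zero : Gam (0 : Ordinal.{w}) = {[0]} := Ordinal.limitRecOn_zero _ _ _

theorem Gam_succ (ξ : Ordinal.{w}) : Gam (ξ + 1) = ⋃ n : ℕ, GamFin ξ (n + 1) := by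
  have h : Gam (ξ + 1) = ⋃ (n : ℕ) (_ : 1 ≤ n), unionLevels ξ (Gam ξ) n :=
    Ordinal.limitRecOn_add_one _ _ _ _
  rw [h]
  ext s
  simp only [Set.mem_iUnion, GamFin]
  constructor
  · rintro ⟨n, hn, hs⟩
    exact ⟨n - 1, by rwa [Nat.sub_add_cancel hn]⟩
  · rintro ⟨n, hs⟩
    exact ⟨n + 1, by omega, hs⟩

theorem Gam_limit {ξ : Ordinal.{w}} (hξ : Order.IsSuccLimit ξ) :
    Gam ξ = ⋃ (ζ : Ordinal.{w}) (_ : ζ < ξ), shift (ω ^ ζ) '' Gam (ζ + 1) :=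
  Ordinal.limitRecOn_limit _ _ _ _ hξ

theorem GamFin_one (ξ : Ordinal.{w}) : GamFin ξ 1 = Gam ξ := by
  have h0 : ∀ t : List Ordinal.{w}, shift 0 t = t := fun t => by simp [shift]
  ext s
  have := mem_unionLevels_succ (ξ := ξ) (G := Gam ξ) (n := 0) (s := s)
  simp only [zero_add, unionLevels_zero, Set.mem_empty_iff_false, false_and, exists_false,
    and_false, or_false, Nat.cast_zero, mul_zero, h0] at this
  rw [GamFin, this]
  exact ⟨fun ⟨t, ht, h⟩ => h ▸ ht, fun h => ⟨s, h, rfl⟩⟩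

theorem isDecTree_Gam (ξ : Ordinal.{w}) : IsDecTree (ω ^ ξ) (Gam ξ) := by
  induction ξ using Ordinal.limitRecOn with
  | zero =>
    rw [Gam_zero]
    refine ⟨fun t ht => ?_, fun t ht => ?_⟩
    · rw [Set.mem_singleton_iff] at ht
      subst ht
      refine ⟨by simp, fun s hs hp => ?_⟩
      rw [Set.mem_singleton_iff]
      refine hp.eq_of_length ?_
      have h1 := hp.length_le
      have h2 := List.length_pos_iff.2 hs
      simp at h1 ⊢
      omega
    · rw [Set.mem_singleton_iff] at ht
      subst ht
      simp [decreasing]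
  | add_one ξ ih =>
    rw [Gam_succ]
    have h := fun n : ℕ => isDecTree_unionLevels ih n
    refine ⟨fun t ht => ?_, fun t ht => ?_⟩
    · obtain ⟨n, hn⟩ := Set.mem_iUnion.1 ht
      refine ⟨(h _).ne_nil hn, fun s hs hp => Set.mem_iUnion.2 ⟨n, ((h _).1 t hn).2 s hs hp⟩⟩
    · obtain ⟨n, hn⟩ := Set.mem_iUnion.1 ht
      exact ⟨((h _).2 hn).1, fun a ha => ((h _).lt hn ha).trans (omega_mul_lt _)⟩
  | limit ξ hξ ih =>
    rw [Gam_limit hξ]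
    refine ⟨fun t ht => ?_, fun t ht => ?_⟩
    · simp only [Set.mem_iUnion] at ht
      obtain ⟨ζ, hζ, t, ht, rfl⟩ := ht
      have h := ih (ζ + 1) (hξ.add_one_lt hζ)
      refine ⟨shift_ne_nil.2 (h.ne_nil ht), fun p hp hps => ?_⟩
      obtain ⟨q, hq, rfl⟩ := exists_of_prefix_shift hps
      simp only [Set.mem_iUnion]
      exact ⟨ζ, hζ, q, (h.1 t ht).2 q (shift_ne_nil.1 hp) hq, rfl⟩
    · simp only [Set.mem_iUnion] at ht
      obtain ⟨ζ, hζ, t, ht, rfl⟩ := ht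
      have h := ih (ζ + 1) (hξ.add_one_lt hζ)
      refine ⟨pairwise_shift (h.2 ht).1, fun a ha => ?_⟩
      obtain ⟨b, hb, rfl⟩ := mem_shift.1 ha
      have h2 : ω ^ (ζ + 1) < ω ^ ξ :=
        (Ordinal.opow_lt_opow_iff_right Ordinal.one_lt_omega0).2 (hξ.add_one_lt hζ)
      refine lt_trans ?_ h2
      exact Ordinal.isPrincipal_add_omega0_opow _
        ((Ordinal.opow_lt_opow_iff_right Ordinal.one_lt_omega0).2 (lt_add_one ζ)) (h.lt ht hb)

theorem isDecTree_GamFin (ξ : Ordinal.{w}) (n : ℕ) :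
    IsDecTree (ω ^ ξ * (n : Ordinal.{w})) (GamFin ξ n) :=
  isDecTree_unionLevels (isDecTree_Gam ξ) n

theorem mem_GamFin_succ {ξ : Ordinal.{w}} {n : ℕ} {s : List Ordinal.{w}} :
    s ∈ GamFin ξ (n + 1) ↔ (∃ t ∈ Gam ξ, s = shift (ω ^ ξ * (n : Ordinal.{w})) t) ∨
      ∃ t ∈ maxSet (Gam ξ), ∃ r ∈ GamFin ξ n, s = shift (ω ^ ξ * (n : Ordinal.{w})) t ++ r :=
  mem_unionLevels_succ

theorem head_GamFin {ξ : Ordinal.{w}} {n : ℕ} {s : List Ordinal.{w}} (hs : s ∈ GamFin ξ (n + 1)) :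
    ω ^ ξ * (n : Ordinal.{w}) ≤ s.headD 0 ∧
      s.headD 0 < ω ^ ξ * ((n + 1 : ℕ) : Ordinal.{w}) :=
  head_unionLevels (isDecTree_Gam ξ) hs

theorem maxSet_GamFin_subset (ξ : Ordinal.{w}) (n : ℕ) :
    maxSet (GamFin ξ (n + 1)) ⊆ maxSet (Gam (ξ + 1)) := by
  intro t ht
  rw [Gam_succ]
  refine ⟨Set.mem_iUnion.2 ⟨n, ht.1⟩, fun s hs hp => ?_⟩
  obtain ⟨m, hm⟩ := Set.mem_iUnion.1 hs
  have h1 := head_GamFin ht.1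
  have h2 := head_GamFin hm
  rw [headD_eq_of_prefix hp ((isDecTree_GamFin ξ _).ne_nil ht.1)] at h1
  obtain rfl := eq_of_mem_omega_block h1.1 h1.2 h2.1 h2.2
  exact ht.2 s hm hp

theorem log_headD_shift {ζ : Ordinal.{w}} {t : List Ordinal.{w}} (ht : t ∈ Gam (ζ + 1)) :
    Ordinal.log ω ((shift (ω ^ ζ) t).headD 0) = ζ := by
  have h := isDecTree_Gam (ζ + 1)
  obtain ⟨a, t', rfl⟩ := List.exists_cons_of_ne_nil (h.ne_nil ht)
  have h1 : (shift (ω ^ ζ) (a :: t')).headD 0 = ω ^ ζ + a := rfl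
  have hpos := Ordinal.opow_pos ζ Ordinal.omega0_pos
  rw [h1, Ordinal.log_eq_iff Ordinal.one_lt_omega0 (hpos.trans_le le_self_add).ne']
  exact ⟨le_self_add, Ordinal.isPrincipal_add_omega0_opow _
    ((Ordinal.opow_lt_opow_iff_right Ordinal.one_lt_omega0).2 (lt_add_one ζ)) (h.lt ht (by simp))⟩

theorem shift_mem_maxSet_Gam_limit {ξ ζ : Ordinal.{w}} (hξ : Order.IsSuccLimit ξ) (hζ : ζ < ξ)
    {t : List Ordinal.{w}} (ht : t ∈ maxSet (Gam (ζ + 1))) :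
    shift (ω ^ ζ) t ∈ maxSet (Gam ξ) := by
  rw [Gam_limit hξ]
  refine ⟨by simp only [Set.mem_iUnion]; exact ⟨ζ, hζ, t, ht.1, rfl⟩, fun s hs hp => ?_⟩
  simp only [Set.mem_iUnion] at hs
  obtain ⟨η, hη, s, hs, rfl⟩ := hs
  have h1 := log_headD_shift ht.1
  rw [headD_eq_of_prefix hp (shift_ne_nil.2 ((isDecTree_Gam _).ne_nil ht.1)),
    log_headD_shift hs] at h1
  subst h1
  rw [ht.2 s hs (shift_prefix_iff.1 hp)]

/-! ### The tree `Γ_{ξ,∞}` -/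

/-- The concatenations of `n` maximal members of `Γ_{ξ,1}`, the `i`-th shifted by `ω^ξ i`. -/
def fullInf (ξ : Ordinal.{w}) (n : ℕ) : Set (List Ordinal.{w}) :=
  fullBlocks (Gam ξ) (fun j => ω ^ ξ * (j : Ordinal.{w})) n

theorem fullInf_zero (ξ : Ordinal.{w}) : fullInf ξ 0 = {[]} := rfl

theorem mem_fullInf_succ {ξ : Ordinal.{w}} {n : ℕ} {s : List Ordinal.{w}} :
    s ∈ fullInf ξ (n + 1) ↔ ∃ t ∈ fullInf ξ n, ∃ r ∈ maxSet (Gam ξ),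
      s = t ++ shift (ω ^ ξ * (n : Ordinal.{w})) r := Iff.rfl

theorem mem_LamInf {ξ : Ordinal.{w}} {n : ℕ} {s : List Ordinal.{w}} :
    s ∈ LamInf ξ n ↔ ∃ t ∈ fullInf ξ n, ∃ r ∈ Gam ξ,
      s = t ++ shift (ω ^ ξ * (n : Ordinal.{w})) r := Iff.rfl

theorem fullInf_lt {ξ : Ordinal.{w}} {n : ℕ} {s : List Ordinal.{w}} (hs : s ∈ fullInf ξ n)
    {a : Ordinal.{w}} (ha : a ∈ s) : a < ω ^ ξ * (n : Ordinal.{w}) := by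
  induction n generalizing s with
  | zero =>
    rw [fullInf_zero, Set.mem_singleton_iff] at hs
    subst hs
    simp at ha
  | succ n ih =>
    obtain ⟨t, ht, r, hr, rfl⟩ := mem_fullInf_succ.1 hs
    rcases List.mem_append.1 ha with ha | ha
    · exact (ih ht ha).trans_le (omega_mul_mono n.le_succ)
    · obtain ⟨b, hb, rfl⟩ := mem_shift.1 ha
      exact add_lt_omega_mul_succ n ((isDecTree_Gam ξ).lt hr.1 hb)

theorem LamInf_lt {ξ : Ordinal.{w}} {n : ℕ} {s : List Ordinal.{w}} (hs : s ∈ LamInf ξ n)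
    {a : Ordinal.{w}} (ha : a ∈ s) : a < ω ^ ξ * ((n + 1 : ℕ) : Ordinal.{w}) := by
  obtain ⟨t, ht, r, hr, rfl⟩ := mem_LamInf.1 hs
  rcases List.mem_append.1 ha with ha | ha
  · exact (fullInf_lt ht ha).trans_le (omega_mul_mono n.le_succ)
  · obtain ⟨b, hb, rfl⟩ := mem_shift.1 ha
    exact add_lt_omega_mul_succ n ((isDecTree_Gam ξ).lt hr hb)

theorem LamInf_exists_ge {ξ : Ordinal.{w}} {n : ℕ} {s : List Ordinal.{w}} (hs : s ∈ LamInf ξ n) :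
    ∃ a ∈ s, ω ^ ξ * (n : Ordinal.{w}) ≤ a := by
  obtain ⟨t, ht, r, hr, rfl⟩ := mem_LamInf.1 hs
  obtain ⟨a, r', rfl⟩ := List.exists_cons_of_ne_nil ((isDecTree_Gam ξ).ne_nil hr)
  exact ⟨ω ^ ξ * (n : Ordinal.{w}) + a, by simp [shift], le_self_add⟩

/-- In $\Gamma_{\xi,\infty}$ the shifts increase, so the level is determined by the interval
$[\omega^\xi n,\omega^\xi(n+1))$ containing the largest entries. -/
theorem LamInf_index_unique {ξ : Ordinal.{w}} {m n : ℕ} {s : List Ordinal.{w}}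
    (hm : s ∈ LamInf ξ m) (hn : s ∈ LamInf ξ n) : m = n := by
  obtain ⟨a, ha, h1⟩ := LamInf_exists_ge hm
  obtain ⟨b, hb, h2⟩ := LamInf_exists_ge hn
  have h3 := LamInf_lt hn ha
  have h4 := LamInf_lt hm hb
  by_contra hne
  rcases lt_or_gt_of_ne hne with h | h
  · exact absurd (h4.trans_le (omega_mul_mono h)) (not_lt.2 h2)
  · exact absurd (h3.trans_le (omega_mul_mono h)) (not_lt.2 h1)

theorem fullInf_antichain {ξ : Ordinal.{w}} {n : ℕ} {s t : List Ordinal.{w}}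
    (hs : s ∈ fullInf ξ n) (ht : t ∈ fullInf ξ n) (h : s <+: t) : s = t := by
  induction n generalizing s t with
  | zero =>
    rw [fullInf_zero, Set.mem_singleton_iff] at hs ht
    rw [hs, ht]
  | succ n ih =>
    obtain ⟨s, hs', r, hr, rfl⟩ := mem_fullInf_succ.1 hs
    obtain ⟨t, ht', q, hq, rfl⟩ := mem_fullInf_succ.1 ht
    have h1 := (List.prefix_append _ _).trans h
    have h2 : s = t := by
      rcases List.prefix_or_prefix_of_prefix h1 (List.prefix_append _ _) with h | h
      · exact ih hs' ht' h
      · exact (ih ht' hs' h).symm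
    subst h2
    rw [hr.2 q hq.1 (shift_prefix_iff.1 ((List.prefix_append_right_inj _).1 h))]

theorem fullInf_succ_subset (ξ : Ordinal.{w}) (n : ℕ) :
    fullInf ξ (n + 1) ⊆ maxSet (LamInf ξ n) := by
  intro s hs
  obtain ⟨s, hs', r, hr, rfl⟩ := mem_fullInf_succ.1 hs
  refine ⟨⟨s, hs', r, hr.1, rfl⟩, fun t ht h => ?_⟩
  obtain ⟨t, ht', q, hq, rfl⟩ := mem_LamInf.1 ht
  have h1 := (List.prefix_append _ _).trans h
  have h2 : s = t := by
    rcases List.prefix_or_prefix_of_prefix h1 (List.prefix_append _ _) with h | h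
    · exact fullInf_antichain hs' ht' h
    · exact (fullInf_antichain ht' hs' h).symm
  subst h2
  rw [hr.2 q hq (shift_prefix_iff.1 ((List.prefix_append_right_inj _).1 h))]

theorem append_mem_LamInf {ξ : Ordinal.{w}} {n : ℕ} {t r : List Ordinal.{w}}
    (ht : t ∈ fullInf ξ n) (hr : r ∈ Gam ξ) :
    t ++ shift (ω ^ ξ * (n : Ordinal.{w})) r ∈ LamInf ξ n := ⟨t, ht, r, hr, rfl⟩

theorem not_mem_LamInf_of_fullInf_append {ξ : Ordinal.{w}} {i n : ℕ} (hi : i < n)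
    {t r : List Ordinal.{w}} (ht : t ∈ fullInf ξ n) (hr : r ≠ []) : t ++ r ∉ LamInf ξ i := by
  intro h
  cases n with
  | zero => omega
  | succ n =>
    have hm := fullInf_succ_subset ξ n ht
    rcases (Nat.lt_succ_iff.1 hi).eq_or_lt with rfl | hlt
    · have := hm.2 _ h (List.prefix_append _ _)
      exact hr (List.append_right_eq_self.1 this)
    · obtain ⟨a, ha, h1⟩ := LamInf_exists_ge hm.1
      have h2 := LamInf_lt h (List.mem_append_left _ ha)
      exact absurd (h2.trans_le (omega_mul_mono hlt)) (not_lt.2 h1)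

theorem not_mem_LamInf_of_prefix_fullInf {ξ : Ordinal.{w}} {i n : ℕ} (hi : n ≤ i)
    {t s : List Ordinal.{w}} (ht : t ∈ fullInf ξ n) (hs : s <+: t) : s ∉ LamInf ξ i := by
  intro h
  obtain ⟨a, ha, h1⟩ := LamInf_exists_ge h
  exact absurd ((fullInf_lt ht (hs.subset ha)).trans_le (omega_mul_mono hi)) (not_lt.2 h1)


/-! ### Nonempty initial segments -/

/-- The nonempty initial segments of a list, by increasing length. -/
def nodes {α : Type*} : List α → List (List α)
  | [] => []
  | a :: t => [a] :: (nodes t).map (a :: ·)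

theorem nodes_append {α : Type*} (s t : List α) :
    nodes (s ++ t) = nodes s ++ (nodes t).map (s ++ ·) := by
  induction s with
  | nil => simp [nodes]
  | cons a s ih => simp [nodes, ih, Function.comp_def]

theorem nodes_concat {α : Type*} (t : List α) (a : α) :
    nodes (t ++ [a]) = nodes t ++ [t ++ [a]] := by
  rw [nodes_append]; simp [nodes]

theorem nodes_map {α β : Type*} (f : α → β) (t : List α) :
    nodes (t.map f) = (nodes t).map (List.map f) := by
  induction t with
  | nil => rfl
  | cons a t ih => simp [nodes, ih, Function.comp_def]

theorem nodes_eq_map_range {α : Type*} (t : List α) :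
    nodes t = (List.range t.length).map (fun k => t.take (k + 1)) := by
  induction t with
  | nil => rfl
  | cons a t ih => simp [nodes, ih, List.range_succ_eq_map, Function.comp_def]

theorem mem_nodes {α : Type*} {s t : List α} : s ∈ nodes t ↔ s ≠ [] ∧ s <+: t := by
  rw [nodes_eq_map_range]
  simp only [List.mem_map, List.mem_range]
  constructor
  · rintro ⟨k, hk, rfl⟩
    refine ⟨?_, List.take_prefix _ _⟩
    rw [← List.length_pos_iff, List.length_take]
    omega
  · rintro ⟨hs, hp⟩
    have h1 := List.length_pos_iff.2 hs
    have h2 := hp.length_le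
    refine ⟨s.length - 1, by omega, ?_⟩
    rw [Nat.sub_add_cancel h1]
    exact (List.prefix_iff_eq_take.1 hp).symm

theorem nodes_shiftD {D : Type*} (ζ : Ordinal.{w}) (t : List (Ordinal.{w} × D)) :
    nodes (shiftD ζ t) = (nodes t).map (shiftD ζ) := nodes_map _ _

theorem map_fst_shiftD {D : Type*} (ζ : Ordinal.{w}) (t : List (Ordinal.{w} × D)) :
    (shiftD ζ t).map Prod.fst = shift ζ (t.map Prod.fst) := by
  simp [shiftD, shift, Function.comp_def]

theorem shiftD_append {D : Type*} (ζ : Ordinal.{w}) (s t : List (Ordinal.{w} × D)) :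
    shiftD ζ (s ++ t) = shiftD ζ s ++ shiftD ζ t := List.map_append

theorem shiftD_injective {D : Type*} (ζ : Ordinal.{w}) :
    Function.Injective (shiftD (D := D) ζ) :=
  List.map_injective_iff.2 fun a b h => by
    simp only [Prod.mk.injEq, add_right_inj] at h
    exact Prod.ext h.1 h.2

theorem mem_maxSet_dot {Λ D : Type*} {T : Set (List Λ)} {t : List (Λ × D)}
    (h : t.map Prod.fst ∈ maxSet T) : t ∈ maxSet (dot T D) := by
  refine ⟨h.1, fun s hs hp => (hp.eq_of_length ?_).symm⟩
  have := h.2 _ hs (hp.map Prod.fst)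
  simpa using (congrArg List.length this).symm

/-! ### The weights -/

theorem weight_zero (s : List Ordinal.{w}) : weight 0 s = 1 := by
  rw [weight, Ordinal.limitRecOn_zero]

theorem weight_succ (ξ : Ordinal.{w}) (s : List Ordinal.{w}) :
    weight (ξ + 1) s = weightInf ξ s / (finIndex ξ s : ℝ) := by
  rw [weight, Ordinal.limitRecOn_add_one]
  rfl

theorem weight_limit {ξ ζ : Ordinal.{w}} (hξ : Order.IsSuccLimit ξ) (hζ : ζ < ξ)
    {t : List Ordinal.{w}} (ht : t ∈ Gam (ζ + 1)) :
    weight ξ (shift (ω ^ ζ) t) = weight (ζ + 1) t := by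
  rw [weight, Ordinal.limitRecOn_limit _ _ _ _ hξ]
  simp only [log_headD_shift ht]
  rw [dif_pos (hξ.add_one_lt hζ)]
  change weight (ζ + 1) _ = _
  congr 1
  simp [shift, Function.comp_def, Ordinal.add_sub_cancel]

theorem weight_nonneg (ξ : Ordinal.{w}) : ∀ s : List Ordinal.{w}, 0 ≤ weight ξ s := by
  induction ξ using Ordinal.limitRecOn with
  | zero => intro s; rw [weight_zero]; norm_num
  | add_one ξ ih =>
    intro s
    rw [weight_succ]
    exact div_nonneg (ih _) (Nat.cast_nonneg _)
  | limit ξ hξ ih =>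
    intro s
    rw [weight, Ordinal.limitRecOn_limit _ _ _ _ hξ]
    simp only
    split_ifs with h
    · exact ih _ h _
    · exact le_rfl

theorem finIndex_eq {ξ : Ordinal.{w}} {n : ℕ} {s : List Ordinal.{w}}
    (hs : s ∈ GamFin ξ (n + 1)) : finIndex ξ s = n + 1 := by
  obtain ⟨h1, h2⟩ := head_GamFin hs
  refine le_antisymm (Nat.sInf_le h2) (le_csInf ⟨_, h2⟩ fun m hm => ?_)
  by_contra hlt
  exact absurd (lt_of_lt_of_le hm (omega_mul_mono (Nat.lt_succ_iff.1 (not_le.1 hlt)))) (not_lt.2 h1)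

/-! ### Separating blocks by ordinal division by $\omega^\xi$ -/

theorem omega_mul_add_div {ξ b : Ordinal.{w}} (n : ℕ) (hb : b < ω ^ ξ) :
    (ω ^ ξ * (n : Ordinal.{w}) + b) / ω ^ ξ = n := by
  rw [Ordinal.mul_add_div _ (Ordinal.opow_pos _ Ordinal.omega0_pos).ne',
    Ordinal.div_eq_zero_of_lt hb, add_zero]

theorem getLastD_append_of_ne_nil {α : Type*} (s : List α) {t : List α} (ht : t ≠ []) (d : α) :
    (s ++ t).getLastD d = t.getLastD d := by
  rw [List.getLastD_eq_getLast?, List.getLastD_eq_getLast?, List.getLast?_append_of_ne_nil _ ht]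

theorem getLastD_mem {α : Type*} {t : List α} (ht : t ≠ []) (d : α) : t.getLastD d ∈ t := by
  rw [List.getLastD_eq_getLast?, List.getLast?_eq_some_getLast ht]
  exact List.getLast_mem ht

theorem lastBlock_append {ξ : Ordinal.{w}} {s t : List Ordinal.{w}} (ht : t ≠ [])
    (h : ∀ a ∈ s, a / ω ^ ξ ≠ t.getLastD 0 / ω ^ ξ) : lastBlock ξ (s ++ t) = lastBlock ξ t := by
  classical
  unfold lastBlock
  rw [getLastD_append_of_ne_nil s ht, List.filter_append, List.filter_eq_nil_iff.2, List.nil_append]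
  intro a ha
  simpa using h a ha

theorem lastBlock_shift {ξ : Ordinal.{w}} (n : ℕ) {t : List Ordinal.{w}} (ht : t ≠ [])
    (h : ∀ a ∈ t, a < ω ^ ξ) : lastBlock ξ (shift (ω ^ ξ * (n : Ordinal.{w})) t) = t := by
  classical
  have hq : ∀ a ∈ shift (ω ^ ξ * (n : Ordinal.{w})) t, a / ω ^ ξ = n := by
    intro a ha
    obtain ⟨b, hb, rfl⟩ := mem_shift.1 ha
    exact omega_mul_add_div n (h b hb)
  unfold lastBlock
  rw [hq _ (getLastD_mem (shift_ne_nil.2 ht) 0), List.filter_eq_self.2]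
  · rw [shift, List.map_map]
    conv_rhs => rw [← List.map_id t]
    refine List.map_congr_left fun a ha => ?_
    simp only [Function.comp_apply, id]
    rw [Ordinal.mul_add_mod_self, Ordinal.mod_eq_of_lt (h a ha)]
  · intro a ha
    simpa using hq a ha

/-- Entries of the last block have quotient `n` by $\omega^\xi$ and all earlier entries a smaller
one, so `lastBlock` isolates exactly `t`. -/
theorem weightInf_append_shift {ξ : Ordinal.{w}} (n : ℕ) {s t : List Ordinal.{w}} (ht : t ∈ Gam ξ)
    (hs : ∀ a ∈ s, a < ω ^ ξ * (n : Ordinal.{w})) :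
    weightInf ξ (s ++ shift (ω ^ ξ * (n : Ordinal.{w})) t) = weight ξ t := by
  have hG := isDecTree_Gam ξ
  have h1 := hG.ne_nil ht
  rw [weightInf, lastBlock_append (shift_ne_nil.2 h1), lastBlock_shift n h1 fun a ha => hG.lt ht ha]
  intro a ha hq
  obtain ⟨b, hb, hb'⟩ := mem_shift.1 (getLastD_mem (shift_ne_nil (ζ := ω ^ ξ * (n : Ordinal.{w})).2 h1) 0)
  rw [← hb', omega_mul_add_div n (hG.lt ht hb)] at hq
  have h2 := (Ordinal.lt_mul_iff_div_lt (Ordinal.opow_pos _ Ordinal.omega0_pos).ne').1 (hs a ha)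
  exact h2.ne hq

theorem weightInf_shift {ξ : Ordinal.{w}} (n : ℕ) {t : List Ordinal.{w}} (ht : t ∈ Gam ξ) :
    weightInf ξ (shift (ω ^ ξ * (n : Ordinal.{w})) t) = weight ξ t := by
  simpa using weightInf_append_shift (s := []) n ht (by simp)

theorem weightInf_shift_append {ξ : Ordinal.{w}} (n : ℕ) {s t : List Ordinal.{w}} (ht : t ∈ Gam ξ)
    (hs : s ≠ []) (hs' : ∀ a ∈ s, a < ω ^ ξ * (n : Ordinal.{w})) :
    weightInf ξ (shift (ω ^ ξ * (n : Ordinal.{w})) t ++ s) = weightInf ξ s := by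
  rw [weightInf, lastBlock_append hs, weightInf]
  intro a ha hq
  obtain ⟨b, hb, rfl⟩ := mem_shift.1 ha
  rw [omega_mul_add_div n ((isDecTree_Gam ξ).lt ht hb)] at hq
  exact ((Ordinal.lt_mul_iff_div_lt (Ordinal.opow_pos _ Ordinal.omega0_pos).ne').1
    (hs' _ (getLastD_mem hs 0))).ne' hq

/-- The total weight along a branch of `Γ_{ξ,1}`. -/
def totalWeight (ξ : Ordinal.{w}) (t : List Ordinal.{w}) : ℝ := ((nodes t).map (weight ξ)).sum

/-- The total weight along a branch of `Γ_{ξ,n}`. -/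
def totalWeightInf (ξ : Ordinal.{w}) (t : List Ordinal.{w}) : ℝ :=
  ((nodes t).map (weightInf ξ)).sum

theorem map_weightInf_nodes_shift {ξ : Ordinal.{w}} (n : ℕ) {t : List Ordinal.{w}}
    (ht : t ∈ Gam ξ) :
    (nodes (shift (ω ^ ξ * (n : Ordinal.{w})) t)).map (weightInf ξ) =
      (nodes t).map (weight ξ) := by
  rw [shift, nodes_map, List.map_map]
  refine List.map_congr_left fun s hs => ?_
  obtain ⟨h1, h2⟩ := mem_nodes.1 hs
  exact weightInf_shift n (((isDecTree_Gam ξ).1 t ht).2 s h1 h2)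

theorem totalWeightInf_shift_append {ξ : Ordinal.{w}} (n : ℕ) {s t : List Ordinal.{w}}
    (ht : t ∈ Gam ξ) (hs : ∀ a ∈ s, a < ω ^ ξ * (n : Ordinal.{w})) :
    totalWeightInf ξ (shift (ω ^ ξ * (n : Ordinal.{w})) t ++ s) =
      totalWeight ξ t + totalWeightInf ξ s := by
  rw [totalWeightInf, nodes_append, List.map_append, List.sum_append,
    map_weightInf_nodes_shift n ht, totalWeight, totalWeightInf, List.map_map]
  congr 2
  refine List.map_congr_left fun r hr => ?_
  obtain ⟨h1, h2⟩ := mem_nodes.1 hr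
  exact weightInf_shift_append n ht h1 fun a ha => hs a (h2.subset ha)

/-! ### The filters of eventual sets -/

section FilterDefs

variable {D : Type*} [Preorder D]

/-- The filter on `MAX(Γ_{ξ,n+1}.D)` built from the filter `F` on `MAX(Γ_{ξ,1}.D)`. -/
def finFilter (ξ : Ordinal.{w}) (F : Filter (List (Ordinal.{w} × D))) :
    ℕ → Filter (List (Ordinal.{w} × D))
  | 0 => F
  | n + 1 => F.bind fun t =>
      (finFilter ξ F n).map (shiftD (ω ^ ξ * ((n + 1 : ℕ) : Ordinal.{w})) t ++ ·)

variable (D) in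
/-- The filter of eventual subsets of `MAX(Γ_{ξ,1}.D)`. -/
def evFilter (ξ : Ordinal.{w}) : Filter (List (Ordinal.{w} × D)) :=
  Ordinal.limitRecOn (motive := fun _ => Filter (List (Ordinal.{w} × D))) ξ
    (map (fun u : D => [((0 : Ordinal.{w}), u)]) atTop)
    (fun ξ F => (atTop : Filter ℕ).bind (finFilter ξ F))
    (fun ξ hξ F => (atTop : Filter (Set.Iio ξ)).bind fun ζ =>
      (F (ζ.1 + 1) (hξ.add_one_lt ζ.2)).map (shiftD (ω ^ ζ.1)))

theorem evFilter_zero : evFilter D (0 : Ordinal.{w}) =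
    map (fun u : D => [((0 : Ordinal.{w}), u)]) atTop := Ordinal.limitRecOn_zero _ _ _

theorem evFilter_succ (ξ : Ordinal.{w}) : evFilter D (ξ + 1) =
    (atTop : Filter ℕ).bind (finFilter ξ (evFilter D ξ)) := Ordinal.limitRecOn_add_one _ _ _ _

theorem evFilter_limit {ξ : Ordinal.{w}} (hξ : Order.IsSuccLimit ξ) : evFilter D ξ =
    (atTop : Filter (Set.Iio ξ)).bind fun ζ => (evFilter D (ζ.1 + 1)).map (shiftD (ω ^ ζ.1)) :=
  Ordinal.limitRecOn_limit _ _ _ _ hξ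

end FilterDefs

/-! ### Supports of the filters and their agreement with cofinality -/

theorem neBot_bind {α β : Type*} {f : Filter α} [f.NeBot] {g : α → Filter β}
    (h : ∀ a, (g a).NeBot) : (f.bind g).NeBot := by
  refine neBot_iff.2 fun hb => ?_
  have h1 : ∀ᶠ _ in f.bind g, False := by rw [hb]; exact eventually_bot
  rw [eventually_bind] at h1
  obtain ⟨a, ha⟩ := h1.exists
  exact (h a).ne (eventually_false_iff_eq_bot.1 ha)

theorem neBot_finFilter {D : Type*} {ξ : Ordinal.{w}} {F : Filter (List (Ordinal.{w} × D))} [F.NeBot] (n : ℕ) :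
    (finFilter ξ F n).NeBot := by
  induction n with
  | zero => assumption
  | succ n ih => exact neBot_bind fun t => ih.map _

section EvFilter

variable {D : Type*} [Preorder D]

theorem eventually_finFilter {ξ : Ordinal.{w}}
    (h : ∀ᶠ t in evFilter D ξ, t.map Prod.fst ∈ maxSet (Gam ξ) ∧
      totalWeight ξ (t.map Prod.fst) = 1) (n : ℕ) :
    ∀ᶠ t in finFilter ξ (evFilter D ξ) n, t.map Prod.fst ∈ maxSet (GamFin ξ (n + 1)) ∧
      totalWeightInf ξ (t.map Prod.fst) = n + 1 := by
  induction n with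
  | zero =>
    filter_upwards [h] with t ht
    refine ⟨by rw [GamFin_one]; exact ht.1, ?_⟩
    rw [← ht.2, Nat.cast_zero, zero_add, ht.2]
    have h1 := totalWeightInf_shift_append (s := []) 0 ht.1.1 (by simp)
    have h0 : shift (ω ^ ξ * ((0 : ℕ) : Ordinal.{w})) (t.map Prod.fst) = t.map Prod.fst := by
      simp [shift]
    rw [List.append_nil, h0, ht.2] at h1
    rw [h1]
    simp [totalWeightInf, nodes]
  | succ n ih =>
    rw [finFilter, eventually_bind]
    filter_upwards [h] with t ht
    rw [eventually_map]
    filter_upwards [ih] with s hs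
    rw [List.map_append, map_fst_shiftD]
    refine ⟨append_mem_maxSet_unionLevels (isDecTree_Gam ξ) ht.1 hs.1, ?_⟩
    rw [totalWeightInf_shift_append _ ht.1.1 fun a ha => (isDecTree_GamFin ξ _).lt hs.1.1 ha,
      ht.2, hs.2]
    push_cast
    ring

-- Since the filter lives on maximal branches, the side conditions of membership in `maxSet` in the
-- recursive definitions can be ignored under "frequently". Total weight one makes the weighted sum
-- along such a branch a convex combination.
variable (D) in
theorem eventually_evFilter (ξ : Ordinal.{w}) :
    ∀ᶠ t in evFilter D ξ, t.map Prod.fst ∈ maxSet (Gam ξ) ∧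
      totalWeight ξ (t.map Prod.fst) = 1 := by
  induction ξ using Ordinal.limitRecOn with
  | zero =>
    rw [evFilter_zero, eventually_map]
    refine Eventually.of_forall fun u => ⟨?_, ?_⟩
    · rw [Gam_zero]
      refine ⟨rfl, fun s hs _ => hs⟩
    · simp [totalWeight, nodes, weight_zero]
  | add_one ξ ih =>
    rw [evFilter_succ, eventually_bind]
    refine Eventually.of_forall fun n => ?_
    filter_upwards [eventually_finFilter ih n] with t ht
    refine ⟨maxSet_GamFin_subset ξ n ht.1, ?_⟩
    have h1 : ∀ s ∈ nodes (t.map Prod.fst), weight (ξ + 1) s = weightInf ξ s * (n + 1 : ℝ)⁻¹ := by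
      intro s hs
      obtain ⟨h1, h2⟩ := mem_nodes.1 hs
      rw [weight_succ, finIndex_eq (((isDecTree_GamFin ξ _).1 _ ht.1.1).2 s h1 h2), div_eq_mul_inv]
      push_cast
      rfl
    have hn : (n + 1 : ℝ) ≠ 0 := by positivity
    rw [totalWeight, List.map_congr_left h1, List.sum_map_mul_right]
    change totalWeightInf ξ _ * _ = 1
    rw [ht.2, mul_inv_cancel₀ hn]
  | limit ξ hξ ih =>
    rw [evFilter_limit hξ, eventually_bind]
    refine Eventually.of_forall fun ζ => ?_
    rw [eventually_map]
    filter_upwards [ih _ (hξ.add_one_lt ζ.2)] with t ht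
    rw [map_fst_shiftD]
    refine ⟨shift_mem_maxSet_Gam_limit hξ ζ.2 ht.1, ?_⟩
    rw [← ht.2, totalWeight, totalWeight, shift, nodes_map, List.map_map]
    congr 1
    refine List.map_congr_left fun s hs => ?_
    obtain ⟨h1, h2⟩ := mem_nodes.1 hs
    exact weight_limit hξ ζ.2 (((isDecTree_Gam _).1 _ ht.1.1).2 s h1 h2)

theorem cofinalFin_iff {ξ : Ordinal.{w}} {Ω : Set (List (Ordinal.{w} × D)) → Prop}
    (hΩ : ∀ E, Ω E ↔ ∃ᶠ t in evFilter D ξ, t ∈ E) (n : ℕ) (E : Set (List (Ordinal.{w} × D))) :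
    cofinalFin ξ Ω n E ↔ ∃ᶠ t in finFilter ξ (evFilter D ξ) n, t ∈ E := by
  induction n generalizing E with
  | zero => exact hΩ E
  | succ n ih =>
    have h1 := eventually_evFilter D ξ
    have h2 := eventually_finFilter h1 n
    rw [cofinalFin, hΩ, finFilter, frequently_bind]
    refine frequently_congr ?_
    filter_upwards [h1] with t ht
    rw [frequently_map]
    simp only [Set.mem_ofPred_eq, mem_maxSet_dot ht.1, true_and, ih]
    refine frequently_congr ?_
    filter_upwards [h2] with s hs
    simp [mem_maxSet_dot hs.1]

/-- Each clause of the recursion for cofinality is the unfolding of "frequently" for a `bind`: over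
$D$, over the number of blocks, or over the ordinals below a limit. The index $n$ in the successor
clause stands for $\Gamma_{\xi,n+1}$ on both sides. -/
theorem isCofinalMax_iff [Nonempty D] [IsDirectedOrder D] (ξ : Ordinal.{w})
    (E : Set (List (Ordinal.{w} × D))) :
    IsCofinalMax ξ E ↔ ∃ᶠ t in evFilter D ξ, t ∈ E := by
  induction ξ using Ordinal.limitRecOn generalizing E with
  | zero =>
    rw [IsCofinalMax, Ordinal.limitRecOn_zero, evFilter_zero, frequently_map, frequently_atTop]
  | add_one ξ ih =>
    rw [IsCofinalMax, Ordinal.limitRecOn_add_one, evFilter_succ, frequently_bind, frequently_atTop]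
    change (∀ m : ℕ, ∃ n : ℕ, m ≤ n ∧
      cofinalFin ξ (IsCofinalMax ξ) n (E ∩ dot (GamFin ξ (n + 1)) D)) ↔ _
    refine forall_congr' fun m => exists_congr fun n => and_congr_right fun _ => ?_
    rw [cofinalFin_iff ih]
    refine frequently_congr ?_
    filter_upwards [eventually_finFilter (eventually_evFilter D ξ) n] with t ht
    exact and_iff_left ht.1.1
  | limit ξ hξ ih =>
    have : Nonempty (Set.Iio ξ) := ⟨⟨0, hξ.bot_lt⟩⟩
    rw [IsCofinalMax, Ordinal.limitRecOn_limit _ _ _ _ hξ, evFilter_limit hξ, frequently_bind,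
      frequently_atTop, Subtype.forall]
    refine forall_congr' fun η => forall_congr' fun hη => ?_
    have key : ∀ ζ : Ordinal.{w}, ζ < ξ → (IsCofinalMax (ζ + 1)
        {t | t ∈ maxSet (dot (Gam (ζ + 1)) D) ∧ shiftD (ω ^ ζ) t ∈ E} ↔
        ∃ᶠ y in map (shiftD (ω ^ ζ)) (evFilter D (ζ + 1)), y ∈ E) := by
      intro ζ hζ
      rw [ih _ (hξ.add_one_lt hζ), frequently_map]
      refine frequently_congr ?_
      filter_upwards [eventually_evFilter D (ζ + 1)] with t ht
      exact and_iff_right (mem_maxSet_dot ht.1)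
    constructor
    · rintro ⟨ζ, hζ, hηζ, h⟩
      exact ⟨⟨ζ, hζ⟩, hηζ, (key ζ hζ).1 h⟩
    · rintro ⟨⟨ζ, hζ⟩, hηζ, h⟩
      exact ⟨ζ, hζ, hηζ, (key ζ hζ).2 h⟩

theorem isEventual_iff [Nonempty D] [IsDirectedOrder D] (ξ : Ordinal.{w})
    (E : Set (List (Ordinal.{w} × D))) :
    IsEventual ξ E ↔ ∀ᶠ t in evFilter D ξ, t ∈ E := by
  rw [IsEventual, isCofinalMax_iff, not_frequently]
  refine eventually_congr ?_
  filter_upwards [eventually_evFilter D ξ] with t ht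
  simp [mem_maxSet_dot ht.1]

instance evFilter_neBot [Nonempty D] [IsDirectedOrder D] (ξ : Ordinal.{w}) :
    (evFilter D ξ).NeBot := by
  induction ξ using Ordinal.limitRecOn with
  | zero => rw [evFilter_zero]; infer_instance
  | add_one ξ ih => rw [evFilter_succ]; exact neBot_bind fun n => neBot_finFilter n
  | limit ξ hξ ih =>
    have : Nonempty (Set.Iio ξ) := ⟨⟨0, hξ.bot_lt⟩⟩
    rw [evFilter_limit hξ]
    exact neBot_bind fun ζ => (ih _ (hξ.add_one_lt ζ.2)).map _

end EvFilter


/-! ### Ranks of sets of finite sequences with respect to a filter -/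

section Rank

variable {X : Type*}

/-- `c` has rank at least `α` in `𝒯`: `c ∈ 𝒯` and for every `β < α` it has one-term extensions of
rank at least `β`, with the last term in any prescribed member of the filter `W`. -/
def HasRank (W : Filter X) (𝒯 : Set (List X)) (α : Ordinal.{w}) (c : List X) : Prop :=
  c ∈ 𝒯 ∧ ∀ β, β < α → ∀ U ∈ W, ∃ x ∈ U, HasRank W 𝒯 β (c ++ [x])
termination_by α

theorem hasRank_iff {W : Filter X} {𝒯 : Set (List X)} {α : Ordinal.{w}} {c : List X} :
    HasRank W 𝒯 α c ↔
      c ∈ 𝒯 ∧ ∀ β < α, ∀ U ∈ W, ∃ x ∈ U, HasRank W 𝒯 β (c ++ [x]) := by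
  rw [HasRank]

theorem HasRank.mem {W : Filter X} {𝒯 : Set (List X)} {α : Ordinal.{w}} {c : List X}
    (h : HasRank W 𝒯 α c) : c ∈ 𝒯 := (hasRank_iff.1 h).1

theorem hasRank_zero {W : Filter X} {𝒯 : Set (List X)} {c : List X} :
    HasRank W 𝒯 (0 : Ordinal.{w}) c ↔ c ∈ 𝒯 := by
  rw [hasRank_iff]
  exact and_iff_left fun β hβ => absurd hβ (not_lt.2 zero_le)

theorem HasRank.of_limit {W : Filter X} {𝒯 : Set (List X)} {α : Ordinal.{w}} {c : List X}
    (hc : c ∈ 𝒯) (h : ∀ β < α, ∃ γ > β, HasRank W 𝒯 γ c) : HasRank W 𝒯 α c := by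
  refine hasRank_iff.2 ⟨hc, fun β hβ => ?_⟩
  obtain ⟨γ, hγ, h⟩ := h β hβ
  exact (hasRank_iff.1 h).2 β hγ

/-- A set of sequences closed under passing to subsequences. -/
def IsHereditary (𝒯 : Set (List X)) : Prop := ∀ c ∈ 𝒯, ∀ d : List X, d.Sublist c → d ∈ 𝒯

theorem HasRank.sublist {W : Filter X} {𝒯 : Set (List X)} (h𝒯 : IsHereditary 𝒯) {α : Ordinal.{w}}
    {c d : List X} (h : HasRank W 𝒯 α c) (hd : d.Sublist c) : HasRank W 𝒯 α d := by
  induction α using WellFoundedLT.induction generalizing c d with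
  | ind α ih =>
    rw [hasRank_iff] at h ⊢
    refine ⟨h𝒯 c h.1 d hd, fun β hβ U hU => ?_⟩
    obtain ⟨x, hx, h⟩ := h.2 β hβ U hU
    exact ⟨x, hx, ih β hβ h (hd.append (List.Sublist.refl _))⟩

/-- Appending vectors first uses up $\alpha$ inside the set of sequences of rank $\beta$, and then
the remaining $\beta$. This explains the order of the summands: the later part of a sequence
accounts for the left one. -/
theorem HasRank.add {W : Filter X} {𝒯 : Set (List X)} {α β : Ordinal.{w}} {c : List X}
    (h : HasRank W {d | HasRank W 𝒯 β d} α c) : HasRank W 𝒯 (β + α) c := by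
  induction α using WellFoundedLT.induction generalizing c with
  | ind α ih =>
    rw [hasRank_iff] at h
    obtain ⟨h1, h2⟩ := hasRank_iff.1 (show HasRank W 𝒯 β c from h.1)
    refine hasRank_iff.2 ⟨h1, fun γ hγ U hU => ?_⟩
    rcases lt_or_ge γ β with hγβ | hγβ
    · exact h2 γ hγβ U hU
    · have hγ' : γ - β < α := by
        rw [← Ordinal.add_sub_cancel_of_le hγβ] at hγ
        exact (add_lt_add_iff_left β).1 hγ
      obtain ⟨x, hx, hr⟩ := h.2 _ hγ' U hU
      have := ih _ hγ' hr
      rw [Ordinal.add_sub_cancel_of_le hγβ] at this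
      exact ⟨x, hx, this⟩

theorem HasRank.append {W : Filter X} {𝒯 : Set (List X)} {α : Ordinal.{w}} {c d : List X}
    (h : HasRank W {d | c ++ d ∈ 𝒯} α d) : HasRank W 𝒯 α (c ++ d) := by
  induction α using WellFoundedLT.induction generalizing d with
  | ind α ih =>
    rw [hasRank_iff] at h ⊢
    refine ⟨h.1, fun β hβ U hU => ?_⟩
    obtain ⟨x, hx, hr⟩ := h.2 β hβ U hU
    exact ⟨x, hx, by rw [List.append_assoc]; exact ih β hβ hr⟩

/-- A sequence of rank `α` unfolds to a collection indexed by decreasing sequences below `α`. -/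
theorem HasRank.exists_collection {W : Filter X} {𝒯 : Set (List X)} {α : Ordinal.{w}}
    (h : HasRank W 𝒯 α []) {D : Type*} (nb : D → Set X) (hnb : ∀ u, nb u ∈ W) (z : X)
    (hz : ∀ u, z ∈ nb u) :
    ∃ x : List (Ordinal.{w} × D) → X, (∀ t ζ u, x (t ++ [(ζ, u)]) ∈ nb u) ∧
      (∀ t, x t = z ∨ ∃ c ∈ 𝒯, x t ∈ c) ∧
      ∀ s : List (Ordinal.{w} × D), s.map Prod.fst ∈ decreasing α → (nodes s).map x ∈ 𝒯 := by
  classical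
  -- The next vector realizes the rank prescribed by the ordinal `q.1`. Where this is impossible the
  -- default `z`, which lies in every `nb u`, keeps the neighborhood condition valid for all
  -- indices.
  let next : List X → Ordinal.{w} × D → X := fun c q =>
    if h : ∃ y ∈ nb q.2, HasRank W 𝒯 q.1 (c ++ [y]) then h.choose else z
  have next_mem : ∀ c q, next c q ∈ nb q.2 := by
    intro c q
    by_cases h : ∃ y ∈ nb q.2, HasRank W 𝒯 q.1 (c ++ [y])
    · simp only [next, dif_pos h]; exact h.choose_spec.1
    · simp only [next, dif_neg h]; exact hz _
  let V : List (Ordinal.{w} × D) → List X := fun s => s.foldl (fun c q => c ++ [next c q]) []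
  have V_concat : ∀ s q, V (s ++ [q]) = V s ++ [next (V s) q] := fun s q => by simp [V]
  let x : List (Ordinal.{w} × D) → X := fun s => (V s).getLastD z
  have x_concat : ∀ s q, x (s ++ [q]) = next (V s) q := fun s q => by
    simp [x, V_concat]
  have nodes_x : ∀ s, (nodes s).map x = V s := by
    intro s
    induction s using List.reverseRecOn with
    | nil => rfl
    | append_singleton s q ih => rw [nodes_concat, List.map_append, ih, V_concat]; simp [x_concat]
  -- Invariant: the last ordinal used is the rank still available, and for the empty sequence it is
  -- `α`. Strict decrease is what permits the next choice.
  have rank : ∀ s : List (Ordinal.{w} × D), s.map Prod.fst ∈ decreasing α →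
      HasRank W 𝒯 ((s.map Prod.fst).getLastD α) (V s) := by
    intro s
    induction s using List.reverseRecOn with
    | nil => exact fun _ => h
    | append_singleton s q ih =>
      intro hs
      rw [List.map_append] at hs ⊢
      have hs' := List.pairwise_append.1 hs.1
      have hlt : q.1 < (s.map Prod.fst).getLastD α := by
        rcases eq_or_ne (s.map Prod.fst) [] with h0 | h0
        · rw [h0]; exact hs.2 _ (by simp)
        · exact hs'.2.2 _ (getLastD_mem h0 α) _ (by simp)
      have h1 := (hasRank_iff.1 (ih ⟨hs'.1, fun a ha => hs.2 a (List.mem_append_left _ ha)⟩)).2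
        q.1 hlt _ (hnb q.2)
      rw [getLastD_append_of_ne_nil _ (by simp), V_concat]
      simp only [next, dif_pos h1]
      exact h1.choose_spec.2
  refine ⟨x, fun t ζ u => ?_, fun t => ?_, fun s hs => ?_⟩
  · rw [x_concat]; exact next_mem _ (ζ, u)
  · induction t using List.reverseRecOn with
    | nil => exact Or.inl rfl
    | append_singleton s q _ =>
      rw [x_concat]
      by_cases h : ∃ y ∈ nb q.2, HasRank W 𝒯 q.1 (V s ++ [y])
      · simp only [next, dif_pos h]
        exact Or.inr ⟨_, h.choose_spec.2.mem, by simp⟩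
      · simp only [next, dif_neg h]; exact Or.inl trivial
  · rw [nodes_x]; exact (rank s hs).mem

end Rank

/-! ### Cofinally many branches of large weight produce a large rank -/

section Weighted

variable {D : Type*} {X : Type*}

/-- The weight of a list of members of `Γ_{ξ,1}.D`. -/
def listWeight (ξ : Ordinal.{w}) (l : List (List (Ordinal.{w} × D))) : ℝ :=
  (l.map fun s => weight ξ (s.map Prod.fst)).sum

/-- The weight of a list of members of `Γ_{ξ,n}.D`. -/
def listWeightInf (ξ : Ordinal.{w}) (l : List (List (Ordinal.{w} × D))) : ℝ :=
  (l.map fun s => weightInf ξ (s.map Prod.fst)).sum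

theorem sum_map_le_of_sublist {α : Type*} {f : α → ℝ} (hf : ∀ a, 0 ≤ f a) {l m : List α}
    (h : l.Sublist m) : (l.map f).sum ≤ (m.map f).sum := by
  induction h with
  | slnil => exact le_rfl
  | cons a _ ih => simpa using ih.trans (le_add_of_nonneg_left (hf a))
  | cons_cons a _ ih => simpa using ih

theorem listWeight_nodes (ξ : Ordinal.{w}) (t : List (Ordinal.{w} × D)) :
    listWeight ξ (nodes t) = totalWeight ξ (t.map Prod.fst) := by
  rw [listWeight, totalWeight, nodes_map, List.map_map]
  rfl

theorem listWeightInf_nodes (ξ : Ordinal.{w}) (t : List (Ordinal.{w} × D)) :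
    listWeightInf ξ (nodes t) = totalWeightInf ξ (t.map Prod.fst) := by
  rw [listWeightInf, totalWeightInf, nodes_map, List.map_map]
  rfl

theorem map_fst_mem_of_mem_nodes {Λ : Type*} {T : Set (List Λ)} (hT : IsTree T)
    {s t : List (Λ × D)} (ht : t.map Prod.fst ∈ T) (hs : s ∈ nodes t) : s.map Prod.fst ∈ T := by
  obtain ⟨h1, h2⟩ := mem_nodes.1 hs
  exact (hT _ ht).2 _ (by simpa using h1) (h2.map _)

theorem exists_frequently_of_mem_list {α β : Type*} {F : Filter α} (L : List β)
    {P : β → α → Prop} (h : ∃ᶠ a in F, ∃ b ∈ L, P b a) : ∃ b ∈ L, ∃ᶠ a in F, P b a := by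
  by_contra! hc
  refine h ?_
  have := (eventually_all_finite (List.finite_toSet L)).2 hc
  filter_upwards [this] with a ha
  rintro ⟨b, hb, hP⟩
  exact ha b hb hP

variable [Preorder D]

/-- Each of the $n+1$ blocks has weight at most $1$, so total weight $k+(n+1)\varepsilon$ forces at
least $k$ blocks of weight at least $\varepsilon$, each contributing $\omega^\xi$ to the rank. The
induction peels the first block: if light it is discarded and $k$ kept; if heavy it supplies one
$\omega^\xi$ through `hR`, and $k$ drops by one. -/
theorem hasRank_of_frequently_finFilter {W : Filter X} {ξ : Ordinal.{w}}
    (hR : ∀ (x : List (Ordinal.{w} × D) → X) (𝒯 : Set (List X)) (ε : ℝ),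
      (∀ t ζ, t.map Prod.fst ++ [ζ] ∈ Gam ξ → Tendsto (fun u => x (t ++ [(ζ, u)])) atTop W) →
      IsHereditary 𝒯 → 0 < ε →
      (∃ᶠ t in evFilter D ξ, ∃ l : List (List (Ordinal.{w} × D)), l.Sublist (nodes t) ∧
        ε ≤ listWeight ξ l ∧ l.map x ∈ 𝒯) → HasRank W 𝒯 (ω ^ ξ) [])
    {ε : ℝ} (hε : 0 < ε) (n : ℕ) :
    ∀ (x : List (Ordinal.{w} × D) → X) (𝒯 : Set (List X)) (k : ℕ),
      (∀ t ζ, t.map Prod.fst ++ [ζ] ∈ GamFin ξ (n + 1) →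
        Tendsto (fun u => x (t ++ [(ζ, u)])) atTop W) →
      IsHereditary 𝒯 →
      (∃ᶠ t in finFilter ξ (evFilter D ξ) n, ∃ l : List (List (Ordinal.{w} × D)),
        l.Sublist (nodes t) ∧ k + (n + 1) * ε ≤ listWeightInf ξ l ∧ l.map x ∈ 𝒯) →
      HasRank W 𝒯 (ω ^ ξ * (k : Ordinal.{w})) [] := by
  have hev := eventually_evFilter D ξ
  have hevn := fun n => eventually_finFilter hev n
  have hG := isDecTree_Gam ξ
  induction n with
  | zero =>
    intro x 𝒯 k hx h𝒯 h
    obtain ⟨t, ⟨l, hl, hw, hm⟩, ht⟩ := (h.and_eventually (hevn 0)).exists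
    have h1 : listWeightInf ξ l ≤ listWeightInf ξ (nodes t) :=
      sum_map_le_of_sublist (fun _ => weight_nonneg _ _) hl
    rw [listWeightInf_nodes, ht.2] at h1
    -- With a single block the total weight is $1$, which leaves no room for $k\ge1$ in addition to
    -- $\varepsilon$.
    have hk : k = 0 := by
      by_contra hk
      have : (1 : ℝ) ≤ k := by exact_mod_cast Nat.one_le_iff_ne_zero.2 hk
      push_cast at h1 hw
      linarith
    subst hk
    rw [Nat.cast_zero, mul_zero, hasRank_zero]
    exact h𝒯 _ hm _ (List.nil_sublist _)
  | succ n ih =>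
    intro x 𝒯 k hx h𝒯 h
    cases k with
    | zero =>
      obtain ⟨t, l, hl, hw, hm⟩ := h.exists
      rw [Nat.cast_zero, mul_zero, hasRank_zero]
      exact h𝒯 _ hm _ (List.nil_sublist _)
    | succ k =>
    set σ := shiftD (D := D) (ω ^ ξ * ((n + 1 : ℕ) : Ordinal.{w})) with hσ
    rw [finFilter, frequently_bind] at h
    have h1 : ∃ᶠ t in evFilter D ξ, ∃ l : List (List (Ordinal.{w} × D)), l.Sublist (nodes t) ∧
        t.map Prod.fst ∈ maxSet (Gam ξ) ∧ listWeight ξ l ≤ 1 ∧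
        ∃ᶠ s in finFilter ξ (evFilter D ξ) n, ∃ m : List (List (Ordinal.{w} × D)),
          m.Sublist (nodes s) ∧
          (k + 1) + (n + 2) * ε ≤ listWeight ξ l + listWeightInf ξ m ∧
          l.map (fun r => x (σ r)) ++ m.map (fun r => x (σ t ++ r)) ∈ 𝒯 := by
      refine (h.and_eventually hev).mono fun t ⟨h, ht⟩ => ?_
      rw [frequently_map] at h
      have h2 : ∃ᶠ s in finFilter ξ (evFilter D ξ) n, ∃ l ∈ (nodes t).sublists,
          ∃ m : List (List (Ordinal.{w} × D)), m.Sublist (nodes s) ∧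
          (k + 1) + (n + 2) * ε ≤ listWeight ξ l + listWeightInf ξ m ∧
          l.map (fun r => x (σ r)) ++ m.map (fun r => x (σ t ++ r)) ∈ 𝒯 := by
        refine (h.and_eventually (hevn n)).mono fun s ⟨⟨l, hl, hw, hm⟩, hs⟩ => ?_
        rw [nodes_append, nodes_shiftD, List.sublist_append_iff] at hl
        obtain ⟨_, _, rfl, hl1', hl2'⟩ := hl
        obtain ⟨l1, hl1, rfl⟩ := List.sublist_map_iff.1 hl1'
        obtain ⟨l2, hl2, rfl⟩ := List.sublist_map_iff.1 hl2'
        refine ⟨l1, List.mem_sublists.2 hl1, l2, hl2, ?_, ?_⟩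
        · have e1 : listWeightInf ξ (l1.map σ) = listWeight ξ l1 := by
            rw [listWeightInf, listWeight, List.map_map]
            congr 1
            refine List.map_congr_left fun r hr => ?_
            rw [Function.comp_apply, hσ, map_fst_shiftD]
            exact weightInf_shift _ (map_fst_mem_of_mem_nodes hG.1 ht.1.1 (hl1.subset hr))
          have e2 : listWeightInf ξ (l2.map (σ t ++ ·)) = listWeightInf ξ l2 := by
            rw [listWeightInf, listWeightInf, List.map_map]
            congr 1
            refine List.map_congr_left fun r hr => ?_
            rw [Function.comp_apply, hσ, List.map_append, map_fst_shiftD]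
            have hr' := map_fst_mem_of_mem_nodes (isDecTree_GamFin ξ (n + 1)).1 hs.1.1
              (hl2.subset hr)
            exact weightInf_shift_append _ ht.1.1 ((isDecTree_GamFin ξ (n + 1)).ne_nil hr')
              fun a ha => (isDecTree_GamFin ξ (n + 1)).lt hr' ha
          rw [← hσ, listWeightInf, List.map_append, List.sum_append] at hw
          change _ ≤ listWeightInf ξ (l1.map σ) + listWeightInf ξ (l2.map (σ t ++ ·)) at hw
          rw [e1, e2] at hw
          push_cast at hw
          linarith
        · rw [List.map_append, List.map_map, List.map_map] at hm
          exact hm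
      -- The selected part of the first block depends on the tail `s`, but it is one of finitely
      -- many sublists, so a single one serves frequently many tails.
      obtain ⟨l, hl, hf⟩ := exists_frequently_of_mem_list _ h2
      rw [List.mem_sublists] at hl
      refine ⟨l, hl, ht.1, ?_, hf⟩
      rw [← ht.2, ← listWeight_nodes]
      exact sum_map_le_of_sublist (fun _ => weight_nonneg _ _) hl
    have htail : ∀ t : List (Ordinal.{w} × D), t.map Prod.fst ∈ maxSet (Gam ξ) →
        ∀ s ζ, s.map Prod.fst ++ [ζ] ∈ GamFin ξ (n + 1) →
        Tendsto (fun u => x (σ t ++ (s ++ [(ζ, u)]))) atTop W := by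
      intro t ht s ζ hs
      simp only [← List.append_assoc]
      refine hx _ _ ?_
      rw [List.map_append, hσ, map_fst_shiftD, List.append_assoc]
      exact mem_GamFin_succ.2 (Or.inr ⟨_, ht, _, hs, rfl⟩)
    -- Light or heavy first block. The first alternative does not mention `t` and is already the
    -- conclusion.
    have hor : ∃ᶠ t in evFilter D ξ,
        HasRank W 𝒯 (ω ^ ξ * ((k + 1 : ℕ) : Ordinal.{w})) [] ∨
        ∃ l : List (List (Ordinal.{w} × D)), l.Sublist (nodes t) ∧ ε ≤ listWeight ξ l ∧
          l.map (fun r => x (σ r)) ∈ {c | HasRank W 𝒯 (ω ^ ξ * (k : Ordinal.{w})) c} := by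
      refine h1.mono fun t ⟨l, hl, ht, hl1, hf⟩ => ?_
      rcases lt_or_ge (listWeight ξ l) ε with hlt | hge
      · left
        refine ih (fun s => x (σ t ++ s)) 𝒯 (k + 1) (htail t ht) h𝒯 (hf.mono fun s ⟨m, hm, hw, h⟩ =>
          ⟨m, hm, ?_, h𝒯 _ h _ (List.sublist_append_right _ _)⟩)
        push_cast
        linarith
      · refine Or.inr ⟨l, hl, hge, ?_⟩
        have := ih (fun s => x (σ t ++ s)) {d | l.map (fun r => x (σ r)) ++ d ∈ 𝒯} k (htail t ht)
          (fun c hc d hd => h𝒯 _ hc _ ((List.Sublist.refl _).append hd))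
          (hf.mono fun s ⟨m, hm, hw, h⟩ => ⟨m, hm, by linarith, h⟩)
        simpa using this.append
    rcases frequently_or_distrib.1 hor with h | h
    · exact h.exists.choose_spec
    · rw [Nat.cast_add, Nat.cast_one, mul_add, mul_one]
      refine HasRank.add (hR (fun r => x (σ r)) _ ε (fun t ζ ht => ?_)
        (fun c hc d hd => HasRank.sublist h𝒯 hc hd) hε h)
      have : ∀ u, σ (t ++ [(ζ, u)]) = σ t ++ [(ω ^ ξ * ((n + 1 : ℕ) : Ordinal.{w}) + ζ, u)] :=
        fun u => by simp [hσ, shiftD]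
      simp only [this]
      refine hx _ _ (mem_GamFin_succ.2 (Or.inl ⟨_, ht, ?_⟩))
      rw [hσ, map_fst_shiftD, shift_append]
      rfl

/-- If cofinally many branches of `Γ_{ξ,1}.D` have a part of weight at least `ε` along which the
vectors form a sequence in `𝒯`, then the empty sequence has rank at least `ω^ξ` in `𝒯`. -/
theorem hasRank_of_frequently {W : Filter X} {ξ : Ordinal.{w}} :
    ∀ (x : List (Ordinal.{w} × D) → X) (𝒯 : Set (List X)) (ε : ℝ),
      (∀ t ζ, t.map Prod.fst ++ [ζ] ∈ Gam ξ → Tendsto (fun u => x (t ++ [(ζ, u)])) atTop W) →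
      IsHereditary 𝒯 → 0 < ε →
      (∃ᶠ t in evFilter D ξ, ∃ l : List (List (Ordinal.{w} × D)), l.Sublist (nodes t) ∧
        ε ≤ listWeight ξ l ∧ l.map x ∈ 𝒯) → HasRank W 𝒯 (ω ^ ξ) [] := by
  induction ξ using Ordinal.limitRecOn with
  | zero =>
    intro x 𝒯 ε hx h𝒯 hε h
    rw [evFilter_zero, frequently_map] at h
    have h1 : ∃ᶠ u : D in atTop, [x [(0, u)]] ∈ 𝒯 := by
      refine h.mono fun u ⟨l, hl, hw, hm⟩ => ?_
      simp only [nodes, List.map_nil] at hl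
      rcases List.sublist_singleton.1 hl with rfl | rfl
      · simp [listWeight] at hw; linarith
      · simpa using hm
    have h2 : Tendsto (fun u => x [(0, u)]) atTop W := hx [] 0 (by simp [Gam_zero])
    rw [Ordinal.opow_zero, hasRank_iff]
    obtain ⟨u, hu⟩ := h1.exists
    refine ⟨h𝒯 _ hu _ (List.nil_sublist _), fun β hβ U hU => ?_⟩
    obtain ⟨u, hu, hu'⟩ := (h1.and_eventually (h2 hU)).exists
    rw [Order.lt_one_iff.1 hβ]
    exact ⟨_, hu', hasRank_zero.2 hu⟩
  | add_one ξ ih =>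
    intro x 𝒯 ε hx h𝒯 hε h
    rw [evFilter_succ, frequently_bind] at h
    have h0 : [] ∈ 𝒯 := by
      obtain ⟨n, hn⟩ := h.exists
      obtain ⟨t, l, -, -, hl⟩ := hn.exists
      exact h𝒯 _ hl _ (List.nil_sublist _)
    have key : ∀ k : ℕ, HasRank W 𝒯 (ω ^ ξ * (k : Ordinal.{w})) [] := by
      intro k
      -- On $\Gamma_{\xi,n+1}$ the weights are those of the blocks divided by $n+1$, so the selected
      -- part has undivided weight at least $(n+1)\varepsilon$. For $n\ge N$ this exceeds
      -- $k+(n+1)\varepsilon/2$, and the preceding lemma applies with $\varepsilon/2$.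
      obtain ⟨N, hN⟩ := exists_nat_gt (k / (ε / 2))
      obtain ⟨n, hn, hNn⟩ := (h.and_eventually (eventually_ge_atTop N)).exists
      refine hasRank_of_frequently_finFilter ih (half_pos hε) n x 𝒯 k (fun t ζ ht => hx t ζ ?_) h𝒯
        ((hn.and_eventually (eventually_finFilter (eventually_evFilter D ξ) n)).mono
          fun t ⟨⟨l, hl, hw, hm⟩, ht⟩ => ⟨l, hl, ?_, hm⟩)
      · rw [Gam_succ]
        exact Set.mem_iUnion.2 ⟨n, ht⟩
      · have h1 : listWeight (ξ + 1) l = listWeightInf ξ l * (n + 1 : ℝ)⁻¹ := by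
          rw [listWeight, listWeightInf, ← List.sum_map_mul_right]
          congr 1
          refine List.map_congr_left fun s hs => ?_
          rw [weight_succ, finIndex_eq (map_fst_mem_of_mem_nodes (isDecTree_GamFin ξ _).1 ht.1.1
            (hl.subset hs)), div_eq_mul_inv]
          push_cast
          rfl
        have hn0 : (0 : ℝ) < n + 1 := by positivity
        rw [h1, ← div_eq_mul_inv, le_div_iff₀ hn0] at hw
        have h3 : (k : ℝ) < N * (ε / 2) := (div_lt_iff₀ (half_pos hε)).1 hN
        have h4 : (N : ℝ) * (ε / 2) ≤ n * (ε / 2) := by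
          have : (N : ℝ) ≤ n := by exact_mod_cast hNn
          gcongr
        nlinarith
    -- The multiples $\omega^\xi k$ are cofinal in $\omega^{\xi+1}$.
    refine HasRank.of_limit h0 fun β hβ => ?_
    rw [Ordinal.opow_add, Ordinal.opow_one] at hβ
    obtain ⟨c, hc, hβc⟩ := (Ordinal.lt_mul_iff_of_isSuccLimit Ordinal.isSuccLimit_omega0).1 hβ
    obtain ⟨k, rfl⟩ := Ordinal.lt_omega0.1 hc
    exact ⟨_, hβc, key k⟩
  | limit ξ hξ ih =>
    intro x 𝒯 ε hx h𝒯 hε h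
    rw [evFilter_limit hξ, frequently_bind] at h
    have h0 : [] ∈ 𝒯 := by
      obtain ⟨n, hn⟩ := h.exists
      obtain ⟨t, l, -, -, hl⟩ := hn.exists
      exact h𝒯 _ hl _ (List.nil_sublist _)
    refine HasRank.of_limit h0 fun β hβ => ?_
    obtain ⟨η, hη, hβη⟩ := (Ordinal.lt_opow_of_isSuccLimit Ordinal.omega0_ne_zero hξ).1 hβ
    obtain ⟨⟨ζ, hζ⟩, hf, hηζ⟩ := (h.and_eventually (eventually_ge_atTop ⟨η, hη⟩)).exists
    have hηζ : η ≤ ζ := hηζ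
    refine ⟨ω ^ (ζ + 1), hβη.trans_le (Ordinal.opow_le_opow_right Ordinal.omega0_pos
      (hηζ.trans (le_add_of_nonneg_right zero_le_one))), ?_⟩
    rw [frequently_map] at hf
    refine ih _ (hξ.add_one_lt hζ) (fun t => x (shiftD (ω ^ ζ) t)) 𝒯 ε (fun t η ht => ?_) h𝒯 hε
      ((hf.and_eventually (eventually_evFilter D (ζ + 1))).mono
        fun t ⟨⟨l, hl, hw, hm⟩, ht⟩ => ?_)
    · simp only [shiftD_append]
      refine hx _ (ω ^ ζ + η) ?_
      rw [Gam_limit hξ]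
      simp only [Set.mem_iUnion]
      refine ⟨ζ, hζ, _, ht, ?_⟩
      rw [map_fst_shiftD, shift_append]
      rfl
    · rw [nodes_shiftD] at hl
      obtain ⟨l, hl', rfl⟩ := List.sublist_map_iff.1 hl
      refine ⟨l, hl', hw.trans_eq ?_, by rwa [List.map_map] at hm⟩
      rw [listWeight, listWeight, List.map_map]
      congr 1
      refine List.map_congr_left fun s hs => ?_
      rw [Function.comp_apply, map_fst_shiftD]
      exact weight_limit hξ hζ
        (map_fst_mem_of_mem_nodes (isDecTree_Gam _).1 ht.1.1 (hl'.subset hs))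

end Weighted


/-! ### Derived trees -/

section Derived

variable {Λ : Type*}

theorem derivedTree_zero (T : Set (List Λ)) : derivedTree T (0 : Ordinal.{w}) = T :=
  Ordinal.limitRecOn_zero _ _ _

theorem derivedTree_succ (T : Set (List Λ)) (ξ : Ordinal.{w}) :
    derivedTree T (ξ + 1) = derivedTree T ξ \ maxSet (derivedTree T ξ) :=
  Ordinal.limitRecOn_add_one _ _ _ _

theorem derivedTree_limit (T : Set (List Λ)) {ξ : Ordinal.{w}} (hξ : Order.IsSuccLimit ξ) :
    derivedTree T ξ = ⋂ (ζ : Ordinal.{w}) (_ : ζ < ξ), derivedTree T ζ :=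
  Ordinal.limitRecOn_limit _ _ _ _ hξ

theorem derivedTree_antitone (T : Set (List Λ)) : Antitone (derivedTree.{w} T) := by
  have key : ∀ β α : Ordinal.{w}, α ≤ β → derivedTree T β ⊆ derivedTree T α := by
    intro β
    induction β using Ordinal.limitRecOn with
    | zero => intro α h; rw [nonpos_iff_eq_zero.1 h]
    | add_one β ih =>
      intro α h
      rcases h.eq_or_lt with rfl | h
      · exact le_rfl
      · rw [derivedTree_succ]
        exact Set.sdiff_subset.trans (ih α (Order.lt_add_one_iff.1 h))
    | limit β hβ ih =>
      intro α h
      rcases h.eq_or_lt with rfl | h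
      · exact le_rfl
      · rw [derivedTree_limit T hβ]
        exact Set.iInter₂_subset α h
  exact fun α β h => key β α h

theorem isTree_derivedTree {T : Set (List Λ)} (hT : IsTree T) (ξ : Ordinal.{w}) :
    IsTree (derivedTree T ξ) := by
  induction ξ using Ordinal.limitRecOn with
  | zero => rwa [derivedTree_zero]
  | add_one ξ ih =>
    rw [derivedTree_succ]
    refine fun t ht => ⟨(ih t ht.1).1, fun s hs hp => ⟨(ih t ht.1).2 s hs hp, fun hm => ?_⟩⟩
    have := hm.2 t ht.1 hp
    exact ht.2 (this ▸ hm)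
  | limit ξ hξ ih =>
    rw [derivedTree_limit T hξ]
    refine fun t ht => ⟨?_, fun s hs hp => ?_⟩
    · exact (ih 0 hξ.bot_lt t (Set.mem_iInter₂.1 ht 0 hξ.bot_lt)).1
    · exact Set.mem_iInter₂.2 fun ζ hζ => (ih ζ hζ t (Set.mem_iInter₂.1 ht ζ hζ)).2 s hs hp

theorem exists_concat_mem_derivedTree {T : Set (List Λ)} (hT : IsTree T) {ξ : Ordinal.{w}}
    {t : List Λ} (ht : t ∈ derivedTree T (ξ + 1)) : ∃ a, t ++ [a] ∈ derivedTree T ξ := by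
  rw [derivedTree_succ] at ht
  obtain ⟨ht, hn⟩ := ht
  simp only [maxSet, Set.mem_ofPred_eq, not_and, not_forall, exists_prop] at hn
  obtain ⟨_, hs, ⟨r, rfl⟩, hne⟩ := hn ht
  cases r with
  | nil => simp at hne
  | cons a r =>
    exact ⟨a, (isTree_derivedTree hT ξ _ hs).2 _ (by simp) ⟨r, by simp⟩⟩

theorem exists_singleton_mem_derivedTree {T : Set (List Λ)} (hT : IsTree T) {ξ : Ordinal.{w}}
    (h : derivedTree T ξ ≠ ∅) : ∃ a, [a] ∈ derivedTree T ξ := by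
  obtain ⟨t, ht⟩ := Set.nonempty_iff_ne_empty.2 h
  obtain ⟨a, t, rfl⟩ := List.exists_cons_of_ne_nil (isTree_derivedTree hT ξ t ht).1
  exact ⟨a, (isTree_derivedTree hT ξ _ ht).2 _ (by simp) ⟨t, rfl⟩⟩

/-- The branches of a collection indexed by a tree of order `α` have rank at least `α`. -/
theorem hasRank_branches {X D : Type*} [Preorder D] [Nonempty D] [IsDirectedOrder D]
    {W : Filter X} {T : Set (List Λ)} (hT : IsTree T) {α : Ordinal.{w}} (hα : HasOrder T α)
    (x : List (Λ × D) → X)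
    (hx : ∀ t ζ, t.map Prod.fst ++ [ζ] ∈ T → Tendsto (fun u => x (t ++ [(ζ, u)])) atTop W) :
    HasRank W {c | ∃ t, (t = [] ∨ t ∈ dot T D) ∧ c = (nodes t).map x} α [] := by
  have step : ∀ (t : List (Λ × D)) (β : Ordinal.{w}) (ζ : Λ),
      t.map Prod.fst ++ [ζ] ∈ derivedTree T β → ∀ U ∈ W, ∃ u : D, x (t ++ [(ζ, u)]) ∈ U := by
    intro t β ζ h U hU
    have h1 := derivedTree_antitone T (zero_le (a := β)) h
    rw [derivedTree_zero] at h1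
    exact ((hx t ζ h1).eventually_mem hU).exists
  have key : ∀ (β : Ordinal.{w}) (t : List (Λ × D)), t.map Prod.fst ∈ derivedTree T β →
      HasRank W {c | ∃ t, (t = [] ∨ t ∈ dot T D) ∧ c = (nodes t).map x} β ((nodes t).map x) := by
    intro β
    induction β using WellFoundedLT.induction with
    | ind β ih =>
      intro t ht
      refine hasRank_iff.2 ⟨⟨t, Or.inr ?_, rfl⟩, fun γ hγ U hU => ?_⟩
      · have h1 := derivedTree_antitone T (zero_le (a := β)) ht
        rwa [derivedTree_zero] at h1
      · obtain ⟨ζ, hζ⟩ := exists_concat_mem_derivedTree hT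
          (derivedTree_antitone T (Order.add_one_le_iff.2 hγ) ht)
        obtain ⟨u, hu⟩ := step t γ ζ hζ U hU
        have := ih γ hγ (t ++ [(ζ, u)]) (by simpa using hζ)
        rw [nodes_concat, List.map_append] at this
        exact ⟨_, hu, this⟩
  refine hasRank_iff.2 ⟨⟨[], Or.inl rfl, rfl⟩, fun β hβ U hU => ?_⟩
  obtain ⟨ζ, hζ⟩ := exists_singleton_mem_derivedTree hT (hα.2 β hβ)
  obtain ⟨u, hu⟩ := step [] β ζ hζ U hU
  exact ⟨_, hu, key β [(ζ, u)] hζ⟩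

/-- The tree of nonempty strictly decreasing sequences of ordinals below `α`. -/
def decTree (α : Ordinal.{w}) : Set (List Ordinal.{w}) := {t | t ≠ [] ∧ t ∈ decreasing α}

theorem isTree_decTree (α : Ordinal.{w}) : IsTree (decTree α) := by
  refine fun t ht => ⟨ht.1, fun s hs hp => ⟨hs, ?_, fun a ha => ht.2.2 a (hp.subset ha)⟩⟩
  exact List.Pairwise.sublist hp.sublist ht.2.1

/-- A decreasing sequence with entries at least $\beta$ has a proper extension of the same kind
exactly when all its entries exceed $\beta$; one may then append $\beta$ itself. -/
theorem derivedTree_decTree (α β : Ordinal.{w}) :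
    derivedTree (decTree α) β = {t | t ∈ decTree α ∧ ∀ a ∈ t, β ≤ a} := by
  induction β using Ordinal.limitRecOn with
  | zero =>
    rw [derivedTree_zero]
    ext t
    exact ⟨fun h => ⟨h, fun a _ => zero_le⟩, fun h => h.1⟩
  | add_one β ih =>
    rw [derivedTree_succ, ih]
    ext t
    constructor
    · rintro ⟨⟨h1, h2⟩, hn⟩
      refine ⟨h1, fun a ha => ?_⟩
      simp only [maxSet, Set.mem_ofPred_eq, not_and, not_forall, exists_prop] at hn
      obtain ⟨_, hs, ⟨r, rfl⟩, hne⟩ := hn ⟨h1, h2⟩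
      cases r with
      | nil => simp at hne
      | cons b r =>
        have hb := hs.2 b (by simp)
        exact Order.add_one_le_of_lt
          (hb.trans_lt ((List.pairwise_append.1 hs.1.2.1).2.2 a ha b (by simp)))
    · rintro ⟨h1, h2⟩
      have h3 : ∀ a ∈ t, β < a := fun a ha => Order.add_one_le_iff.1 (h2 a ha)
      refine ⟨⟨h1, fun a ha => (h3 a ha).le⟩, fun hm => ?_⟩
      obtain ⟨a, ha⟩ := List.exists_mem_of_ne_nil t h1.1
      have := hm.2 (t ++ [β]) ⟨⟨by simp, ?_, ?_⟩, ?_⟩ (List.prefix_append _ _)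
      · simp at this
      · refine List.pairwise_append.2 ⟨h1.2.1, by simp, fun a ha b hb => ?_⟩
        rw [List.mem_singleton.1 hb]
        exact h3 a ha
      · intro b hb
        rcases List.mem_append.1 hb with hb | hb
        · exact h1.2.2 b hb
        · rw [List.mem_singleton.1 hb]
          exact (h3 a ha).trans (h1.2.2 a ha)
      · intro b hb
        rcases List.mem_append.1 hb with hb | hb
        · exact (h3 b hb).le
        · rw [List.mem_singleton.1 hb]
  | limit β hβ ih =>
    rw [derivedTree_limit _ hβ]
    ext t
    simp only [Set.mem_iInter]
    constructor
    · intro h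
      have h1 := fun ζ hζ => (ih ζ hζ) ▸ h ζ hζ
      refine ⟨(h1 0 hβ.bot_lt).1, fun a ha => le_of_forall_lt fun ζ hζ => ?_⟩
      exact Order.add_one_le_iff.1 ((h1 _ (hβ.add_one_lt hζ)).2 a ha)
    · intro h ζ hζ
      rw [ih ζ hζ]
      exact ⟨h.1, fun a ha => hζ.le.trans (h.2 a ha)⟩

theorem hasOrder_decTree (α : Ordinal.{w}) : HasOrder (decTree α) α := by
  refine ⟨?_, fun β hβ => ?_⟩
  · rw [derivedTree_decTree, Set.eq_empty_iff_forall_notMem]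
    rintro t ⟨ht, h⟩
    obtain ⟨a, ha⟩ := List.exists_mem_of_ne_nil t ht.1
    exact absurd (ht.2.2 a ha) (not_lt.2 (h a ha))
  · rw [derivedTree_decTree, ← Set.nonempty_iff_ne_empty]
    exact ⟨[β], ⟨by simp, by simp [decreasing, hβ]⟩, by simp⟩

end Derived

/-! ### The weak topology -/

section Weak

variable (𝕜 : Type*) [RCLike 𝕜] (X : Type u) [NormedAddCommGroup X] [NormedSpace 𝕜 X]

/-- The neighborhood filter of `0` for the weak topology. -/
def weakNhds : Filter X := comap (toWeakSpace 𝕜 X) (𝓝 0)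

variable {𝕜 X}

theorem tendsto_weakNhds {α : Type*} {l : Filter α} {x : α → X} :
    Tendsto x l (weakNhds 𝕜 X) ↔
      ∀ f : StrongDual 𝕜 X, Tendsto (fun a => f (x a)) l (𝓝 0) := by
  have h : weakNhds 𝕜 X = comap (fun (z : X) (f : StrongDual 𝕜 X) => f z) (𝓝 0) := by
    have h0 : (𝓝 (0 : WeakSpace 𝕜 X)) = comap (fun (z : WeakSpace 𝕜 X) (f : StrongDual 𝕜 X) =>
        f ((toWeakSpace 𝕜 X).symm z)) (𝓝 (fun f => f ((toWeakSpace 𝕜 X).symm 0))) :=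
      nhds_induced _ _
    rw [weakNhds, h0, comap_comap]
    congr 2
    ext f
    simp
  rw [h, tendsto_comap_iff, tendsto_pi_nhds]
  rfl

/-- Collections over `𝓓` whose vectors lie in the unit ball and in the last neighborhood of their
index. -/
def IsNormal (𝓓 : Set (Set X)) (x : List (Ordinal.{w} × (↥𝓓)ᵒᵈ) → X) : Prop :=
  (∀ t ζ (U : (↥𝓓)ᵒᵈ), x (t ++ [(ζ, U)]) ∈ ((OrderDual.ofDual U : ↥𝓓) : Set X)) ∧ ∀ t, ‖x t‖ ≤ 1

variable {𝓓 : Set (Set X)}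

theorem IsWeakNhdsBasis.mem (h : IsWeakNhdsBasis 𝕜 𝓓) (U : (↥𝓓)ᵒᵈ) :
    ((OrderDual.ofDual U : ↥𝓓) : Set X) ∈ weakNhds 𝕜 X := h.mem_of_mem (OrderDual.ofDual U).2

theorem IsWeakNhdsBasis.zero_mem (h : IsWeakNhdsBasis 𝕜 𝓓) (U : (↥𝓓)ᵒᵈ) :
    (0 : X) ∈ ((OrderDual.ofDual U : ↥𝓓) : Set X) := by
  obtain ⟨V, hV, hVU⟩ := mem_comap.1 (h.mem U)
  exact hVU (by simpa using mem_of_mem_nhds hV)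

theorem IsWeakNhdsBasis.nonempty (h : IsWeakNhdsBasis 𝕜 𝓓) : Nonempty (↥𝓓)ᵒᵈ := by
  obtain ⟨U, hU, -⟩ := h.mem_iff.1 univ_mem
  exact ⟨OrderDual.toDual ⟨U, hU⟩⟩

theorem IsWeakNhdsBasis.isDirectedOrder (h : IsWeakNhdsBasis 𝕜 𝓓) :
    IsDirectedOrder (↥𝓓)ᵒᵈ := by
  refine ⟨fun U V => ?_⟩
  obtain ⟨Z, hZ, hsub⟩ := h.mem_iff.1 (inter_mem (h.mem U) (h.mem V))
  exact ⟨OrderDual.toDual ⟨Z, hZ⟩, fun a ha => (hsub ha).1, fun a ha => (hsub ha).2⟩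

theorem IsWeakNhdsBasis.tendsto (h : IsWeakNhdsBasis 𝕜 𝓓) {x : (↥𝓓)ᵒᵈ → X}
    (hx : ∀ U, x U ∈ ((OrderDual.ofDual U : ↥𝓓) : Set X)) : Tendsto x atTop (weakNhds 𝕜 X) := by
  intro V hV
  obtain ⟨Z, hZ, hsub⟩ := h.mem_iff.1 hV
  rw [mem_map]
  filter_upwards [eventually_ge_atTop (OrderDual.toDual (⟨Z, hZ⟩ : ↥𝓓))] with U hU
  exact hsub (hU (hx U))

end Weak

/-! ### Averages along branches -/

section Avg

theorem sum_map_list_range {M : Type*} [AddCommMonoid M] (f : ℕ → M) (n : ℕ) :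
    ((List.range n).map f).sum = ∑ i ∈ Finset.range n, f i := by
  induction n with
  | zero => simp
  | succ n ih => rw [List.range_succ, List.map_append, List.sum_append, ih,
      Finset.sum_range_succ]; simp

variable (𝕜 : Type*) [RCLike 𝕜] {X : Type u} [NormedAddCommGroup X] [NormedSpace 𝕜 X]
  {D : Type*}

/-- The average `∑ ℙ_{ξ,1}(s) x_s` over `s ≤ t`. -/
def avg (ξ : Ordinal.{w}) (x : List (Ordinal.{w} × D) → X) (t : List (Ordinal.{w} × D)) : X :=
  ((nodes t).map fun s => (weight ξ (s.map Prod.fst) : 𝕜) • x s).sum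

theorem avg_smul (ξ : Ordinal.{w}) (a : 𝕜) (x : List (Ordinal.{w} × D) → X)
    (t : List (Ordinal.{w} × D)) : avg 𝕜 ξ (fun s => a • x s) t = a • avg 𝕜 ξ x t := by
  rw [avg, avg, List.smul_sum, List.map_map]
  congr 1
  refine List.map_congr_left fun s _ => ?_
  exact smul_comm _ _ _

variable {𝕜} in
theorem norm_sum_smul_le {α : Type*} {w : α → ℝ} (hw : ∀ a, 0 ≤ w a) {x : α → X} {l : List α}
    (hx : ∀ a ∈ l, ‖x a‖ ≤ 1) : ‖(l.map fun a => (w a : 𝕜) • x a).sum‖ ≤ (l.map w).sum := by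
  induction l with
  | nil => simp
  | cons a l ih =>
    simp only [List.map_cons, List.sum_cons]
    refine (norm_add_le _ _).trans (add_le_add ?_ (ih fun b hb => hx b (by simp [hb])))
    rw [norm_smul, RCLike.norm_ofReal, abs_of_nonneg (hw a)]
    exact mul_le_of_le_one_right (hw a) (hx a (by simp))

theorem norm_avg_le {ξ : Ordinal.{w}} {x : List (Ordinal.{w} × D) → X}
    {t : List (Ordinal.{w} × D)} (ht : totalWeight ξ (t.map Prod.fst) = 1)
    (hx : ∀ s ∈ nodes t, ‖x s‖ ≤ 1) : ‖avg 𝕜 ξ x t‖ ≤ 1 := by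
  rw [← ht, ← listWeight_nodes]
  exact norm_sum_smul_le (fun s => weight_nonneg _ _) hx

/-- Transfers averages over $\Gamma_{\xi,1}$ to any tree: the weights along `s` serve as convex
coefficients on the branch `t`, which carries the same vectors. -/
theorem avg_mem_branchHull {Λ D' : Type*} {ξ : Ordinal.{w}} {x : List (Ordinal.{w} × D) → X}
    {y : List (Λ × D') → X} {s : List (Ordinal.{w} × D)} {t : List (Λ × D')}
    (hs : totalWeight ξ (s.map Prod.fst) = 1) (h : (nodes s).map x = (nodes t).map y) :
    avg 𝕜 ξ x s ∈ branchHull 𝕜 y t := by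
  have hlen : s.length = t.length := by
    have := congrArg List.length h
    simpa [nodes_eq_map_range] using this
  refine ⟨fun i => weight ξ ((s.take (i + 1)).map Prod.fst), fun i => weight_nonneg _ _, ?_, ?_⟩
  · rw [← hlen, ← sum_map_list_range, ← hs, ← listWeight_nodes, listWeight, nodes_eq_map_range,
      List.map_map]
    rfl
  · rw [← hlen, ← sum_map_list_range, avg]
    simp only [nodes_eq_map_range, List.map_map, ← hlen] at h ⊢
    congr 1
    refine List.map_congr_left fun i hi => ?_
    have := List.map_inj_left.1 h i hi
    simp only [Function.comp_apply] at this ⊢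
    rw [this]

end Avg


/-! ### Norming functionals for seminorms -/

section Functional

variable {𝕜 : Type*} [RCLike 𝕜] {Y : Type v} [NormedAddCommGroup Y] [NormedSpace 𝕜 Y]

/-- Real-linear functionals dominated by the seminorm `N`. -/
def IsDominated (N : Seminorm 𝕜 Y) (g : Y →+ ℝ) : Prop :=
  (∀ (r : ℝ) (y : Y), g ((r : 𝕜) • y) = r * g y) ∧ ∀ y, g y ≤ N y

theorem seminorm_real_smul (N : Seminorm 𝕜 Y) {r : ℝ} (hr : 0 ≤ r) (y : Y) :
    N ((r : 𝕜) • y) = r * N y := by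
  rw [map_smul_eq_mul, RCLike.norm_ofReal, abs_of_nonneg hr]

/-- Hahn–Banach over the reals, with $Y$ viewed as a real space through $\mathbb R\to\mathbb K$;
real functionals suffice since only real convex combinations are tested. -/
theorem exists_isDominated (N : Seminorm 𝕜 Y) (v : Y) :
    ∃ g : Y →+ ℝ, IsDominated N g ∧ g v = N v := by
  let _ : Module ℝ Y := Module.compHom Y (algebraMap ℝ 𝕜)
  have hsmul : ∀ (r : ℝ) (y : Y), r • y = (r : 𝕜) • y := fun r y => rfl
  have hpos : ∀ (c : ℝ), 0 < c → ∀ y : Y, N (c • y) = c * N y := fun c hc y => by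
    rw [hsmul, seminorm_real_smul N hc.le]
  rcases eq_or_ne (N v) 0 with h0 | h0
  · refine ⟨0, ⟨fun r y => by simp, fun y => apply_nonneg N y⟩, by simp [h0]⟩
  have hv : v ≠ 0 := fun h => h0 (by rw [h, map_zero])
  obtain ⟨g, hg, hgN⟩ := exists_extension_of_le_sublinear
    (LinearPMap.mkSpanSingleton (K := ℝ) v (N v) hv) N hpos (map_add_le_add N) (by
      rintro ⟨y, hy⟩
      obtain ⟨r, rfl⟩ := Submodule.mem_span_singleton.1 hy
      refine (LinearPMap.mkSpanSingleton'_apply v (N v) _ r hy).trans_le ?_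
      rw [smul_eq_mul]
      change _ ≤ N (r • v)
      rw [hsmul, map_smul_eq_mul, RCLike.norm_ofReal]
      exact mul_le_mul_of_nonneg_right (le_abs_self r) (apply_nonneg N v))
  refine ⟨g.toAddMonoidHom, ⟨fun r y => ?_, hgN⟩, ?_⟩
  · exact (g.map_smul r y)
  · have := hg ⟨v, Submodule.mem_span_singleton_self v⟩
    rw [LinearPMap.mkSpanSingleton_apply] at this
    exact this

theorem IsDominated.map_sum_smul {N : Seminorm 𝕜 Y} {g : Y →+ ℝ} (hg : IsDominated N g) {α : Type*}
    (w : α → ℝ) (z : α → Y) (l : List α) :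
    g (l.map fun a => (w a : 𝕜) • z a).sum = (l.map fun a => w a * g (z a)).sum := by
  rw [map_list_sum, List.map_map]
  congr 1
  refine List.map_congr_left fun a _ => ?_
  exact hg.1 _ _

end Functional

/-! ### The modulus -/

section ModulusEstimates

variable {𝕜 : Type*} [RCLike 𝕜]
  {X : Type u} [NormedAddCommGroup X] [NormedSpace 𝕜 X]
  {Y : Type v} [NormedAddCommGroup Y] [NormedSpace 𝕜 Y]

theorem IsEquivNorm.exists_bound {N : Seminorm 𝕜 Y} (hN : IsEquivNorm N) (A : X →L[𝕜] Y) :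
    ∃ M : ℝ, 0 < M ∧ ∀ x, N (A x) ≤ M * ‖x‖ := by
  obtain ⟨c, C, hc, hC, h⟩ := hN
  refine ⟨C * ‖A‖ + 1, by positivity, fun x => ((h _).2.trans
    (mul_le_mul_of_nonneg_left (A.le_opNorm x) hC.le)).trans ?_⟩
  nlinarith [norm_nonneg x]

theorem take_one_mem_branchHull {Λ D : Type*} (x : List (Λ × D) → X) {t : List (Λ × D)}
    (ht : t ≠ []) : x (t.take 1) ∈ branchHull 𝕜 x t := by
  have h0 : 0 ∈ Finset.range t.length := Finset.mem_range.2 (List.length_pos_iff.2 ht)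
  refine ⟨fun i => if i = 0 then 1 else 0, fun i => by dsimp only; split_ifs <;> norm_num, ?_, ?_⟩
  · rw [Finset.sum_ite_eq' _ 0, if_pos h0]
  · rw [Finset.sum_eq_single_of_mem 0 h0]
    · simp
    · intro i _ hi
      simp [hi]

theorem HasOrder.nonempty {Λ : Type*} {T : Set (List Λ)} {ξ : Ordinal.{w}}
    (h : HasOrder T (ω ^ ξ)) : T.Nonempty := by
  have := h.2 0 (Ordinal.opow_pos _ Ordinal.omega0_pos)
  rw [derivedTree_zero] at this
  exact Set.nonempty_iff_ne_empty.2 this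

theorem exists_mem_dot {Λ D : Type*} [Nonempty D] {T : Set (List Λ)} (hT : T.Nonempty) :
    (dot T D).Nonempty := by
  obtain ⟨t, ht⟩ := hT
  obtain ⟨d⟩ := ‹Nonempty D›
  exact ⟨t.map fun a => (a, d), by simpa [dot, Function.comp_def] using ht⟩

theorem ne_nil_of_mem_dot {Λ D : Type*} {T : Set (List Λ)} (hT : IsTree T) {t : List (Λ × D)}
    (ht : t ∈ dot T D) : t ≠ [] := by
  rintro rfl
  exact (hT _ ht).1 rfl

theorem bddBelow_values {Λ D : Type*} (N : Seminorm 𝕜 Y) (A : X →L[𝕜] Y) (y : Y)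
    (x : List (Λ × D) → X) (S : Set (List (Λ × D))) :
    BddBelow {q : ℝ | ∃ t ∈ S, ∃ z ∈ branchHull 𝕜 x t, q = N (y + A z) - 1} := by
  refine ⟨-1, ?_⟩
  rintro _ ⟨t, -, z, -, rfl⟩
  linarith [apply_nonneg N (y + A z)]

theorem take_mem_dot {Λ D : Type*} {T : Set (List Λ)} (hT : IsTree T) {t : List (Λ × D)}
    (ht : t ∈ dot T D) (i : ℕ) : t.take (i + 1) ∈ dot T D := by
  refine (hT _ ht).2 _ ?_ ((List.take_prefix _ _).map _)
  have := ne_nil_of_mem_dot hT ht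
  simp [this]

/-- Any member of the set defining the modulus is at most the modulus. -/
theorem le_modulus {ξ : Ordinal.{w}} {A : X →L[𝕜] Y} {N : Seminorm 𝕜 Y} (hN : IsEquivNorm N)
    (hA : A ≠ 0) {σ : ℝ} (hσ : 0 < σ) {y : Y} (hy : N y ≤ 1) {Λ : Type (w + 1)}
    {T : Set (List Λ)} {D : Type u} [Preorder D] [Nonempty D] [IsDirectedOrder D]
    {x : List (Λ × D) → X} (hT : IsTree T) (hTo : HasOrder T (ω ^ ξ)) (hx : IsWeaklyNull 𝕜 T x)
    (hxσ : ∀ t ∈ dot T D, ‖x t‖ ≤ σ) :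
    sInf {q : ℝ | ∃ t ∈ dot T D, ∃ z ∈ branchHull 𝕜 x t, q = N (y + A z) - 1} ≤
      modulus ξ A N σ := by
  rw [modulus, if_neg (by simp [hA, hσ.ne'])]
  obtain ⟨M, hM, hAM⟩ := hN.exists_bound A
  refine le_csSup ⟨M * σ, ?_⟩ ⟨y, Λ, T, D, _, ‹_›, ‹_›, x, hy, hT, hTo, hx, hxσ, rfl⟩
  rintro _ ⟨y, Λ, T, D, _, _, _, x, hy, hT, hTo, -, hxσ, rfl⟩
  obtain ⟨t, ht⟩ := exists_mem_dot (D := D) hTo.nonempty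
  refine (csInf_le (bddBelow_values N A y x _) ⟨t, ht, _,
    take_one_mem_branchHull x (ne_nil_of_mem_dot hT ht), rfl⟩).trans ?_
  have h1 := map_add_le_add N y (A (x (t.take 1)))
  have h2 := (hAM (x (t.take 1))).trans
    (mul_le_mul_of_nonneg_left (hxσ _ (take_mem_dot hT ht 0)) hM.le)
  linarith

/-- A Chebyshev-type bound: if the average of $\varphi$ exceeds $b$ while $\varphi\le M$, then
$\{\varphi>b\}$ carries a definite weight. The factor $M+|b|$ is a crude majorant of $M-b$. -/
theorem sum_map_weight_le_of_filter {α : Type*} {w φ : α → ℝ} (hw : ∀ a, 0 ≤ w a) {M b : ℝ}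
    {l : List α} (hM : ∀ a ∈ l, φ a ≤ M) :
    (l.map fun a => w a * φ a).sum ≤
      (M + |b|) * ((l.filter fun a => b < φ a).map w).sum + b * (l.map w).sum := by
  induction l with
  | nil => simp
  | cons a l ih =>
    have ih := ih fun c hc => hM c (by simp [hc])
    have ha := hM a (by simp)
    rw [List.map_cons, List.sum_cons, List.filter_cons, List.map_cons, List.sum_cons]
    split_ifs with h
    · rw [List.map_cons, List.sum_cons]
      nlinarith [hw a, neg_abs_le b, mul_le_mul_of_nonneg_left ha (hw a),
        mul_nonneg (hw a) (by linarith [neg_abs_le b] : 0 ≤ |b| + b)]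
    · simp only [decide_eq_true_eq, not_lt] at h
      nlinarith [mul_le_mul_of_nonneg_left h (hw a)]

/-- Along eventually all branches of a weakly null collection, the average is controlled by the
modulus. -/
theorem eventually_le_modulus {𝓓 : Set (Set X)} (h𝓓 : IsWeakNhdsBasis 𝕜 𝓓) {ξ : Ordinal.{w}}
    {A : X →L[𝕜] Y} {N : Seminorm 𝕜 Y} (hN : IsEquivNorm N) (hA : A ≠ 0) {σ δ : ℝ} (hσ : 0 < σ)
    (hδ : 0 < δ) {y : Y} (hy : N y ≤ 1) {D : Type*} [Preorder D] {x : List (Ordinal.{w} × D) → X}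
    (hx : IsWeaklyNull 𝕜 (Gam ξ) x) (hx1 : ∀ t ∈ dot (Gam ξ) D, ‖x t‖ ≤ 1) :
    ∀ᶠ t in evFilter D ξ, N (y + (σ : 𝕜) • A (avg 𝕜 ξ x t)) ≤ 1 + modulus ξ A N σ + δ := by
  classical
  by_contra hcon
  rw [not_eventually] at hcon
  obtain ⟨M, hM, hAM⟩ := hN.exists_bound A
  set b := 1 + modulus ξ A N σ + δ / 2 with hb
  -- A single functional must exceed `b` at all vectors of the sequence. This passes to
  -- subsequences, and it bounds $N$ from below on the whole convex hull.
  let 𝒯 : Set (List X) := {c | (∀ u ∈ c, ‖u‖ ≤ 1) ∧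
    ∃ g : Y →+ ℝ, IsDominated N g ∧ ∀ u ∈ c, b < g (y + (σ : 𝕜) • A u)}
  have h𝒯 : IsHereditary 𝒯 := fun c ⟨h1, g, hg, h2⟩ d hd =>
    ⟨fun u hu => h1 u (hd.subset hu), g, hg, fun u hu => h2 u (hd.subset hu)⟩
  have hM' : 0 < 1 + M * σ + |b| := by positivity
  have hrank : HasRank (weakNhds 𝕜 X) 𝒯 (ω ^ ξ) [] := by
    -- On a bad branch the norming functional averages to more than $b+\delta/2$, while its values
    -- are at most $1+M\sigma$. The Chebyshev-type bound therefore gives the part where it exceeds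
    -- `b` at least this weight.
    refine hasRank_of_frequently x 𝒯 (δ / 2 / (1 + M * σ + |b|))
      (fun t ζ ht => tendsto_weakNhds.2 (hx t ζ ht)) h𝒯 (by positivity)
      ((hcon.and_eventually (eventually_evFilter D ξ)).mono fun t ⟨hlt, ht⟩ => ?_)
    rw [not_le] at hlt
    obtain ⟨g, hg, hgv⟩ := exists_isDominated N (y + (σ : 𝕜) • A (avg 𝕜 ξ x t))
    have hnode : ∀ s ∈ nodes t, ‖x s‖ ≤ 1 := fun s hs =>
      hx1 s (map_fst_mem_of_mem_nodes (isDecTree_Gam ξ).1 ht.1.1 hs)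
    set φ : List (Ordinal.{w} × D) → ℝ := fun s => g (y + (σ : 𝕜) • A (x s)) with hφ
    have hφM : ∀ s ∈ nodes t, φ s ≤ 1 + M * σ := by
      intro s hs
      refine (hg.2 _).trans ((map_add_le_add N _ _).trans (add_le_add hy ?_))
      rw [seminorm_real_smul N hσ.le, mul_comm]
      refine mul_le_mul_of_nonneg_right ((hAM _).trans ?_) hσ.le
      nlinarith [hnode s hs]
    have hsum : g (y + (σ : 𝕜) • A (avg 𝕜 ξ x t)) =
        ((nodes t).map fun s => weight ξ (s.map Prod.fst) * φ s).sum := by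
      have h1 : (σ : 𝕜) • A (avg 𝕜 ξ x t) = ((nodes t).map fun s =>
          (weight ξ (s.map Prod.fst) : 𝕜) • ((σ : 𝕜) • A (x s))).sum := by
        rw [avg, map_list_sum, List.smul_sum, List.map_map, List.map_map]
        congr 1
        refine List.map_congr_left fun s _ => ?_
        simp only [Function.comp_apply, map_smul]
        exact smul_comm _ _ _
      have h2 : ((nodes t).map fun s => weight ξ (s.map Prod.fst)).sum = 1 := by
        rw [← ht.2, ← listWeight_nodes]; rfl
      rw [map_add, h1, hg.map_sum_smul]
      simp only [hφ, map_add, mul_add]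
      rw [List.sum_map_add, List.sum_map_mul_right, h2, one_mul]
    have hle := sum_map_weight_le_of_filter (w := fun s => weight ξ (s.map Prod.fst)) (φ := φ)
      (b := b) (fun s => weight_nonneg _ _) hφM
    rw [← hsum, hgv] at hle
    have h2 : ((nodes t).map fun s => weight ξ (s.map Prod.fst)).sum = 1 := by
      rw [← ht.2, ← listWeight_nodes]; rfl
    rw [h2] at hle
    refine ⟨(nodes t).filter fun s => b < φ s, List.filter_sublist, ?_, ?_, g, hg, ?_⟩
    · rw [div_le_iff₀ hM', mul_comm]
      change _ ≤ _ * (List.map (fun s : List (Ordinal.{w} × D) => weight ξ (s.map Prod.fst)) _).sum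
      linarith
    · intro u hu
      obtain ⟨s, hs, rfl⟩ := List.mem_map.1 hu
      exact hnode s (List.mem_of_mem_filter hs)
    · intro u hu
      obtain ⟨s, hs, rfl⟩ := List.mem_map.1 hu
      have := List.of_mem_filter hs
      exact of_decide_eq_true this
  have := h𝓓.nonempty
  have := h𝓓.isDirectedOrder
  -- The full rank is turned into a collection over `𝓓` and all decreasing sequences below
  -- $\omega^\xi$. It is a competitor in the modulus, whatever `D` was, and its value is at least
  -- $b-1$.
  obtain ⟨x', hx', hx'1, hx'𝒯⟩ := hrank.exists_collection
    (fun U : (↥𝓓)ᵒᵈ => ((OrderDual.ofDual U : ↥𝓓) : Set X)) h𝓓.mem 0 h𝓓.zero_mem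
  have hnull : IsWeaklyNull 𝕜 (decTree (ω ^ ξ)) fun t => (σ : 𝕜) • x' t := by
    intro t ζ _ f
    have h1 := tendsto_weakNhds.1 (h𝓓.tendsto (x := fun U => x' (t ++ [(ζ, U)])) (hx' t ζ)) f
    simpa using h1.const_mul (σ : 𝕜)
  have hx'le : ∀ t, ‖x' t‖ ≤ 1 := by
    intro t
    rcases hx'1 t with h | ⟨c, hc, h⟩
    · rw [h]; simp
    · exact hc.1 _ h
  have hle := le_modulus hN hA hσ hy (isTree_decTree (ω ^ ξ)) (hasOrder_decTree (ω ^ ξ)) hnull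
    (fun t _ => by
      rw [norm_smul, RCLike.norm_ofReal, abs_of_pos hσ]
      exact mul_le_of_le_one_right hσ.le (hx'le t))
  have hne : {q : ℝ | ∃ t ∈ dot (decTree (ω ^ ξ)) (↥𝓓)ᵒᵈ,
      ∃ z ∈ branchHull 𝕜 (fun t => (σ : 𝕜) • x' t) t, q = N (y + A z) - 1}.Nonempty := by
    obtain ⟨t, ht⟩ := exists_mem_dot (D := (↥𝓓)ᵒᵈ) (hasOrder_decTree (ω ^ ξ)).nonempty
    exact ⟨_, t, ht, _, take_one_mem_branchHull _ (ne_nil_of_mem_dot (isTree_decTree _) ht), rfl⟩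
  have hge : b - 1 ≤ sInf {q : ℝ | ∃ t ∈ dot (decTree (ω ^ ξ)) (↥𝓓)ᵒᵈ,
      ∃ z ∈ branchHull 𝕜 (fun t => (σ : 𝕜) • x' t) t, q = N (y + A z) - 1} := by
    refine le_csInf hne ?_
    rintro _ ⟨t, ht, z, ⟨c, hc0, hc1, rfl⟩, rfl⟩
    obtain ⟨-, g, hg, hgb⟩ := hx'𝒯 t ht.2
    have hgb' : ∀ i ∈ Finset.range t.length,
        b ≤ g (y + (σ : 𝕜) • A (x' (t.take (i + 1)))) := by
      intro i hi
      refine (hgb _ (List.mem_map.2 ⟨_, ?_, rfl⟩)).le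
      rw [nodes_eq_map_range]
      exact List.mem_map.2 ⟨i, List.mem_range.2 (Finset.mem_range.1 hi), rfl⟩
    have h3 : g (y + A (∑ i ∈ Finset.range t.length, (c i : 𝕜) • (σ : 𝕜) • x' (t.take (i + 1)))) =
        ∑ i ∈ Finset.range t.length, c i * g (y + (σ : 𝕜) • A (x' (t.take (i + 1)))) := by
      simp only [map_sum, map_add, map_smul, hg.1, mul_add, Finset.sum_add_distrib,
        ← Finset.sum_mul, hc1, one_mul]
    have h4 : b ≤ ∑ i ∈ Finset.range t.length, c i * g (y + (σ : 𝕜) • A (x' (t.take (i + 1)))) := by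
      calc b = ∑ i ∈ Finset.range t.length, c i * b := by rw [← Finset.sum_mul, hc1, one_mul]
        _ ≤ _ := Finset.sum_le_sum fun i hi => mul_le_mul_of_nonneg_left (hgb' i hi) (hc0 i)
    have h5 := hg.2 (y + A (∑ i ∈ Finset.range t.length,
      (c i : 𝕜) • (σ : 𝕜) • x' (t.take (i + 1))))
    linarith
  linarith

/-- If normal collections have branches along which the averages are well behaved, then the
modulus is small. -/
theorem modulus_le {𝓓 : Set (Set X)} (h𝓓 : IsWeakNhdsBasis 𝕜 𝓓) {ξ : Ordinal.{w}}
    {A : X →L[𝕜] Y} {N : Seminorm 𝕜 Y} {σ b : ℝ} (hσ : 0 < σ) (hb : 0 ≤ b)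
    (h : ∀ y, N y ≤ 1 → ∀ x : List (Ordinal.{w} × (↥𝓓)ᵒᵈ) → X, IsNormal 𝓓 x → ∀ b' > b,
      ∃ᶠ t in evFilter (↥𝓓)ᵒᵈ ξ, N (y + (σ : 𝕜) • A (avg 𝕜 ξ x t)) ≤ 1 + b') :
    modulus ξ A N σ ≤ b := by
  rw [modulus]
  split_ifs with h0
  · exact hb
  refine Real.sSup_le ?_ hb
  rintro _ ⟨y, Λ, T, D, _, _, _, x, hy, hT, hTo, hx, hxσ, rfl⟩
  refine le_of_forall_gt fun b' hb' => ?_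
  obtain ⟨b'', hb1, hb2⟩ := exists_between hb'
  refine lt_of_le_of_lt ?_ hb2
  -- Rescaled into the unit ball, as normal collections require; the factor `σ` is restored in
  -- `hmem'`.
  set x1 : List (Λ × D) → X := fun t => ((σ⁻¹ : ℝ) : 𝕜) • x t with hx1
  have hx1lim : ∀ t ζ, t.map Prod.fst ++ [ζ] ∈ T →
      Tendsto (fun u => x1 (t ++ [(ζ, u)])) atTop (weakNhds 𝕜 X) := by
    refine fun t ζ ht => tendsto_weakNhds.2 fun f => ?_
    simpa [hx1] using (hx t ζ ht f).const_mul ((σ⁻¹ : ℝ) : 𝕜)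
  have hx1le : ∀ t ∈ dot T D, ‖x1 t‖ ≤ 1 := by
    intro t ht
    rw [hx1, norm_smul, RCLike.norm_ofReal, abs_of_pos (inv_pos.2 hσ)]
    exact (inv_mul_le_one₀ hσ).2 (hxσ t ht)
  obtain ⟨x', hx', hx'1, hx'T⟩ := (hasRank_branches hT hTo x1 hx1lim).exists_collection
    (fun U : (↥𝓓)ᵒᵈ => ((OrderDual.ofDual U : ↥𝓓) : Set X)) h𝓓.mem 0 h𝓓.zero_mem
  have hnorm : IsNormal 𝓓 x' := by
    refine ⟨hx', fun t => ?_⟩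
    rcases hx'1 t with h | ⟨_, ⟨s, hs, rfl⟩, hc⟩
    · rw [h]; simp
    · obtain ⟨r, hr, hrt⟩ := List.mem_map.1 hc
      rw [← hrt]
      rcases hs with rfl | hs
      · simp [nodes] at hr
      · exact hx1le _ (map_fst_mem_of_mem_nodes hT hs hr)
  obtain ⟨s, hs, hs'⟩ := ((h y hy x' hnorm b'' hb1).and_eventually
    (eventually_evFilter _ ξ)).exists
  -- A member of $\Gamma_{\xi,1}$ is a decreasing sequence below $\omega^\xi$, so the vectors along
  -- `s` are those along some branch `t` of the original tree.
  obtain ⟨t, ht, hst⟩ := hx'T s ((isDecTree_Gam ξ).2 hs'.1.1)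
  have hsne : s ≠ [] := by
    rintro rfl
    exact (isDecTree_Gam ξ).ne_nil hs'.1.1 rfl
  have htT : t ∈ dot T D := by
    refine ht.resolve_left ?_
    rintro rfl
    have := congrArg List.length hst
    simp [nodes_eq_map_range] at this
    exact hsne this
  have hmem := avg_mem_branchHull 𝕜 hs'.2 hst
  have hmem' : (σ : 𝕜) • avg 𝕜 ξ x' s ∈ branchHull 𝕜 x t := by
    obtain ⟨c, hc0, hc1, hc⟩ := hmem
    refine ⟨c, hc0, hc1, ?_⟩
    have hσ' : (σ : 𝕜) ≠ 0 := RCLike.ofReal_ne_zero.2 hσ.ne'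
    rw [hc, Finset.smul_sum]
    refine Finset.sum_congr rfl fun i _ => ?_
    rw [smul_comm, hx1]
    simp only [RCLike.ofReal_inv, smul_smul, mul_inv_cancel₀ hσ', one_smul]
  refine (csInf_le (bddBelow_values N A y x _) ⟨t, htT, _, hmem', rfl⟩).trans ?_
  rw [map_smul]
  linarith

end ModulusEstimates


/-! ### Block vectors -/

section BlockVec

variable {𝕜 : Type*} [RCLike 𝕜] {X : Type u} [NormedAddCommGroup X] [NormedSpace 𝕜 X]
  {D : Type*} {ξ : Ordinal.{w}}

open Classical in
theorem blockVec_eq (x : List (Ordinal.{w} × D) → X) (t : List (Ordinal.{w} × D)) (i : ℕ) :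
    blockVec 𝕜 ξ x t i = ((nodes t).map fun s => if s ∈ dot (LamInf ξ i) D then
      (weightInf ξ (s.map Prod.fst) : 𝕜) • x s else 0).sum := by
  rw [blockVec, Finset.sum_filter, nodes_eq_map_range, List.map_map, ← sum_map_list_range]
  rfl

theorem blockVec_append_of_lt {n i : ℕ} {s : List (Ordinal.{w} × D)}
    (hs : s.map Prod.fst ∈ fullInf ξ n) (hi : i < n) (x : List (Ordinal.{w} × D) → X)
    (r : List (Ordinal.{w} × D)) : blockVec 𝕜 ξ x (s ++ r) i = blockVec 𝕜 ξ x s i := by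
  classical
  rw [blockVec_eq, blockVec_eq, nodes_append, List.map_append, List.sum_append]
  refine add_eq_left.2 (List.sum_eq_zero ?_)
  intro z hz
  simp only [List.map_map, List.mem_map, Function.comp_apply] at hz
  obtain ⟨q, hq, rfl⟩ := hz
  rw [if_neg]
  intro h
  refine not_mem_LamInf_of_fullInf_append hi hs (r := q.map Prod.fst) ?_ ?_
  · simpa using (mem_nodes.1 hq).1
  · simpa [dot] using h

theorem blockVec_append_shiftD {n : ℕ} {s t : List (Ordinal.{w} × D)}
    (hs : s.map Prod.fst ∈ fullInf ξ n) (ht : t.map Prod.fst ∈ Gam ξ)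
    (x : List (Ordinal.{w} × D) → X) :
    blockVec 𝕜 ξ x (s ++ shiftD (ω ^ ξ * (n : Ordinal.{w})) t) n =
      avg 𝕜 ξ (fun r => x (s ++ shiftD (ω ^ ξ * (n : Ordinal.{w})) r)) t := by
  classical
  rw [blockVec_eq, nodes_append, List.map_append, List.sum_append, avg, nodes_shiftD,
    List.map_map, List.map_map]
  have h0 : ((nodes s).map fun q => if q ∈ dot (LamInf ξ n) D then
      (weightInf ξ (q.map Prod.fst) : 𝕜) • x q else 0).sum = 0 := by
    refine List.sum_eq_zero fun z hz => ?_
    obtain ⟨q, hq, rfl⟩ := List.mem_map.1 hz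
    rw [if_neg]
    exact not_mem_LamInf_of_prefix_fullInf le_rfl hs ((mem_nodes.1 hq).2.map _)
  rw [h0, zero_add]
  congr 1
  refine List.map_congr_left fun q hq => ?_
  have hq' := map_fst_mem_of_mem_nodes (isDecTree_Gam ξ).1 ht hq
  simp only [Function.comp_apply]
  rw [if_pos, List.map_append, map_fst_shiftD,
    weightInf_append_shift n hq' fun a ha => fullInf_lt hs ha]
  change (s ++ shiftD _ q).map Prod.fst ∈ LamInf ξ n
  rw [List.map_append, map_fst_shiftD]
  exact append_mem_LamInf hs hq'

/-- Blocks beyond the first `n` see only vectors indexed strictly above `s`, so a collection may be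
replaced there without affecting the earlier blocks. -/
theorem blockVec_congr {n i : ℕ} {s t : List (Ordinal.{w} × D)}
    (hs : s.map Prod.fst ∈ fullInf ξ n) (hi : n ≤ i) (hst : s <+: t)
    {x y : List (Ordinal.{w} × D) → X} (h : ∀ q, s <+: q → q ≠ s → x q = y q) :
    blockVec 𝕜 ξ x t i = blockVec 𝕜 ξ y t i := by
  classical
  rw [blockVec_eq, blockVec_eq]
  congr 1
  refine List.map_congr_left fun q hq => ?_
  split_ifs with hqi
  · rcases List.prefix_or_prefix_of_prefix (mem_nodes.1 hq).2 hst with h1 | h1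
    · exact absurd hqi (not_mem_LamInf_of_prefix_fullInf hi hs (h1.map _))
    · rw [h q h1]
      rintro rfl
      exact not_mem_LamInf_of_prefix_fullInf hi hs List.prefix_rfl hqi
  · rfl

end BlockVec

/-! ### Sequence norms built by a binary operation -/

section SumNorm

variable {𝕜 : Type*} [RCLike 𝕜]

/-- The norms `E n` on `𝕜^n` arise by iterating the monotone homogeneous operation `op`. -/
structure IsSumNorm (E : (n : ℕ) → (Fin n → 𝕜) → ℝ) (op : ℝ → ℝ → ℝ) : Prop where
  zero : ∀ a, E 0 a = 0
  snoc : ∀ n (a : Fin (n + 1) → 𝕜),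
    E (n + 1) a = op (E n fun i => a i.castSucc) ‖a (Fin.last n)‖
  cont : ∀ n, Continuous (E n)
  mono : ∀ r r' s s', 0 ≤ r → r ≤ r' → 0 ≤ s → s ≤ s' → op r s ≤ op r' s'
  left_le : ∀ r s, 0 ≤ r → 0 ≤ s → r ≤ op r s
  right_le : ∀ r s, 0 ≤ r → 0 ≤ s → s ≤ op r s
  le_add : ∀ r s, 0 ≤ r → 0 ≤ s → op r s ≤ r + s
  hom : ∀ c r s, 0 ≤ c → 0 ≤ r → 0 ≤ s → op (c * r) (c * s) = c * op r s

variable {E : (n : ℕ) → (Fin n → 𝕜) → ℝ} {op : ℝ → ℝ → ℝ}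

theorem IsSumNorm.nonneg (h : IsSumNorm E op) : ∀ n a, 0 ≤ E n a := by
  intro n
  induction n with
  | zero => intro a; rw [h.zero]
  | succ n ih =>
    intro a
    rw [h.snoc]
    exact (ih _).trans (h.left_le _ _ (ih _) (norm_nonneg _))

theorem IsSumNorm.smul (h : IsSumNorm E op) (c : 𝕜) : ∀ n a, E n (c • a) = ‖c‖ * E n a := by
  intro n
  induction n with
  | zero => intro a; rw [h.zero, h.zero, mul_zero]
  | succ n ih =>
    intro a
    rw [h.snoc, h.snoc, ← h.hom _ _ _ (norm_nonneg c) (h.nonneg _ _) (norm_nonneg _), ← ih,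
      ← norm_smul]
    rfl

theorem IsSumNorm.norm_apply_le (h : IsSumNorm E op) : ∀ n (a : Fin n → 𝕜) i, ‖a i‖ ≤ E n a := by
  intro n
  induction n with
  | zero => intro a i; exact i.elim0
  | succ n ih =>
    intro a i
    rw [h.snoc]
    induction i using Fin.lastCases with
    | last => exact h.right_le _ _ (h.nonneg _ _) (norm_nonneg _)
    | cast i =>
      have := h.left_le (E n fun i => a i.castSucc) ‖a (Fin.last n)‖ (h.nonneg _ _) (norm_nonneg _)
      exact (ih (fun i => a i.castSucc) i).trans this

theorem IsSumNorm.norm_le (h : IsSumNorm E op) (n : ℕ) (a : Fin n → 𝕜) : ‖a‖ ≤ E n a :=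
  (pi_norm_le_iff_of_nonneg (h.nonneg n a)).2 (h.norm_apply_le n a)

variable {Y : Type v} [NormedAddCommGroup Y] [NormedSpace 𝕜 Y]

/-- A one-step estimate along a filter, valid for each fixed choice of scalars, improves to one
which is uniform over all choices of scalars. -/
theorem IsSumNorm.eventually_forall_le (h : IsSumNorm E op) {N : Seminorm 𝕜 Y} {β : Type*}
    {F : Filter β} {n : ℕ} {v : Fin n → Y} {g : β → Y} {C k k' M : ℝ} (hC : 0 ≤ C) (hk : C ≤ k)
    (hkk' : k < k') (hM : ∀ᶠ t in F, N (g t) ≤ M)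
    (hg : ∀ y (a : 𝕜) r, N y < r → ∀ᶠ t in F, N (y + a • g t) ≤ op r (C * ‖a‖))
    (hv : ∀ a : Fin n → 𝕜, N (∑ i, a i • v i) ≤ k * E n a) :
    ∀ᶠ t in F, ∀ a : Fin (n + 1) → 𝕜,
      N (∑ i : Fin n, a i.castSucc • v i + a (Fin.last n) • g t) ≤ k' * E (n + 1) a := by
  obtain ⟨k'', h1, h2⟩ := exists_between hkk'
  set ex : β → (Fin (n + 1) → 𝕜) → Y := fun t a =>
    ∑ i : Fin n, a i.castSucc • v i + a (Fin.last n) • g t with hex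
  have hex_add : ∀ t a b, ex t (a + b) = ex t a + ex t b := by
    intro t a b
    simp only [hex, Pi.add_apply, add_smul, Finset.sum_add_distrib]
    abel
  have hex_smul : ∀ t (c : 𝕜) a, ex t (c • a) = c • ex t a := by
    intro t c a
    simp only [hex, Pi.smul_apply, smul_eq_mul, mul_smul, Finset.smul_sum, smul_add]
  have hpt : ∀ a0 : Fin (n + 1) → 𝕜, ‖a0‖ = 1 → ∀ᶠ t in F, N (ex t a0) ≤ k'' * E (n + 1) a0 := by
    intro a0 ha0
    have hy := hv fun i => a0 i.castSucc
    have hnn := h.nonneg n fun i => a0 i.castSucc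
    have hE1 : 1 ≤ E (n + 1) a0 := ha0 ▸ h.norm_le _ a0
    -- If the earlier scalars have norm zero, passing from $k$ to $k''$ gains nothing; the needed
    -- slack comes instead from $k''-C$ times the last scalar, which is nonzero since `a0` lies on
    -- the unit sphere.
    rcases hnn.eq_or_lt with h0 | hpos
    · rw [← h0, mul_zero] at hy
      rw [h.snoc, ← h0] at hE1 ⊢
      have h3 : 1 ≤ ‖a0 (Fin.last n)‖ := by
        have := h.le_add 0 _ le_rfl (norm_nonneg (a0 (Fin.last n)))
        linarith
      have h4 : 0 < (k'' - C) * ‖a0 (Fin.last n)‖ := mul_pos (by linarith) (by linarith)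
      filter_upwards [hg _ (a0 (Fin.last n)) _ (hy.trans_lt h4)] with t ht
      refine ht.trans ((h.le_add _ _ h4.le (by positivity)).trans ?_)
      have := h.right_le 0 _ le_rfl (norm_nonneg (a0 (Fin.last n)))
      nlinarith
    · have h3 : N (∑ i : Fin n, a0 i.castSucc • v i) < k'' * E n fun i => a0 i.castSucc :=
        hy.trans_lt (mul_lt_mul_of_pos_right h1 hpos)
      have hk'' : 0 ≤ k'' := by linarith
      filter_upwards [hg _ (a0 (Fin.last n)) _ h3] with t ht
      rw [h.snoc, ← h.hom _ _ _ hk'' hnn (norm_nonneg _)]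
      exact ht.trans (h.mono _ _ _ _ (mul_nonneg hk'' hnn) le_rfl (by positivity)
        (mul_le_mul_of_nonneg_right (by linarith) (norm_nonneg _)))
  -- The bound `M` makes the extended sum Lipschitz in the scalars uniformly in `t`, so the gap
  -- between $k''$ and $k'$ carries the estimate from `a0` to a neighborhood. Compactness of the
  -- sphere then yields one member of `F` for all scalars, and homogeneity removes the
  -- normalization.
  have hprod : ∀ a0 ∈ Metric.sphere (0 : Fin (n + 1) → 𝕜) 1,
      {q : β × (Fin (n + 1) → 𝕜) | N (ex q.1 q.2) ≤ k' * E (n + 1) q.2} ∈ F ×ˢ 𝓝 a0 := by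
    intro a0 ha0
    rw [mem_sphere_zero_iff_norm] at ha0
    have hE1 : 1 ≤ E (n + 1) a0 := ha0 ▸ h.norm_le _ a0
    set ρ : (Fin (n + 1) → 𝕜) → ℝ := fun a =>
      ∑ i : Fin n, ‖(a - a0) i.castSucc‖ * N (v i) + ‖(a - a0) (Fin.last n)‖ * M with hρ
    have hρc : Continuous ρ := by fun_prop
    have hρ0 : ρ a0 = 0 := by simp [hρ]
    have hcont : Continuous fun a => k' * E (n + 1) a - ρ a :=
      (continuous_const.mul (h.cont (n + 1))).sub hρc
    have hnear : ∀ᶠ a in 𝓝 a0, k'' * E (n + 1) a0 < k' * E (n + 1) a - ρ a := by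
      refine hcont.continuousAt.eventually (lt_mem_nhds ?_)
      change _ < k' * E (n + 1) a0 - ρ a0
      rw [hρ0, sub_zero]
      exact mul_lt_mul_of_pos_right h2 (by linarith)
    have hkey := ((hpt a0 ha0).and hM).prod_mk hnear
    filter_upwards [hkey] with q hq
    obtain ⟨⟨hq1, hq2⟩, hq3⟩ := hq
    have hsplit : ex q.1 q.2 = ex q.1 a0 + ex q.1 (q.2 - a0) := by
      rw [← hex_add, add_sub_cancel]
    have hdiff : N (ex q.1 (q.2 - a0)) ≤ ρ q.2 := by
      refine (map_add_le_add N _ _).trans (add_le_add ?_ ?_)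
      · refine (Finset.le_sum_of_subadditive N (map_zero N).le (map_add_le_add N) _ _).trans (Finset.sum_le_sum fun i _ => ?_)
        rw [map_smul_eq_mul]
      · rw [map_smul_eq_mul]
        exact mul_le_mul_of_nonneg_left hq2 (norm_nonneg _)
    have h5 := map_add_le_add N (ex q.1 a0) (ex q.1 (q.2 - a0))
    rw [← hsplit] at h5
    change N (ex q.1 q.2) ≤ k' * E (n + 1) q.2
    linarith
  have hcomp := (isCompact_sphere (0 : Fin (n + 1) → 𝕜) 1).mem_prod_nhdsSet_of_forall hprod
  obtain ⟨U, hU, V, hV, hUV⟩ := mem_prod_iff.1 hcomp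
  filter_upwards [hU] with t ht a
  rcases eq_or_ne a 0 with rfl | ha
  · have : ex t 0 = 0 := by simp [hex]
    change N (ex t 0) ≤ _
    rw [this, map_zero]
    exact mul_nonneg (by linarith) (h.nonneg _ _)
  · have hna : 0 < ‖a‖ := norm_pos_iff.2 ha
    have hna' : ‖((‖a‖⁻¹ : ℝ) : 𝕜)‖ = ‖a‖⁻¹ := by
      rw [RCLike.norm_ofReal, abs_of_pos (inv_pos.2 hna)]
    have hsph : ((‖a‖⁻¹ : ℝ) : 𝕜) • a ∈ Metric.sphere (0 : Fin (n + 1) → 𝕜) 1 := by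
      rw [mem_sphere_zero_iff_norm, norm_smul, hna', inv_mul_cancel₀ hna.ne']
    have h6 := hUV (Set.mk_mem_prod ht (subset_of_mem_nhdsSet hV hsph))
    change N (ex t (((‖a‖⁻¹ : ℝ) : 𝕜) • a)) ≤ k' * E (n + 1) (((‖a‖⁻¹ : ℝ) : 𝕜) • a) at h6
    rw [hex_smul, map_smul_eq_mul, h.smul, hna'] at h6
    have h7 : ‖a‖⁻¹ * N (ex t a) ≤ ‖a‖⁻¹ * (k' * E (n + 1) a) := by linarith
    exact le_of_mul_le_mul_left h7 (inv_pos.2 hna)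

end SumNorm

/-! ### Step estimates yield upper tree estimates -/

section Step

variable {𝕜 : Type*} [RCLike 𝕜]
  {X : Type u} [NormedAddCommGroup X] [NormedSpace 𝕜 X]
  {Y : Type v} [NormedAddCommGroup Y] [NormedSpace 𝕜 Y]

/-- Eventually along the branches of a weakly null collection in the unit ball, adding `a` times
the average increases the norm by at most the operation `op`. -/
def StepEstimate (ξ : Ordinal.{w}) (A : X →L[𝕜] Y) (N : Seminorm 𝕜 Y) (op : ℝ → ℝ → ℝ) (C : ℝ) :
    Prop :=
  ∀ (D : Type u) [Preorder D] (x : List (Ordinal.{w} × D) → X),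
    IsWeaklyNull 𝕜 (Gam ξ) x → (∀ t ∈ dot (Gam ξ) D, ‖x t‖ ≤ 1) →
    ∀ y (a : 𝕜) r, N y < r →
      ∀ᶠ t in evFilter D ξ, N (y + a • A (avg 𝕜 ξ x t)) ≤ op r (C * ‖a‖)

/-- The inevitable set consists of the branches whose estimate holds with a constant depending on
the number of blocks. Each step loses an arbitrarily small amount, so these constants can stay below
$2C$; division by `c` returns from $N$ to the original norm. -/
theorem StepEstimate.upperTreeEstimates {ξ : Ordinal.{w}} {A : X →L[𝕜] Y} {N : Seminorm 𝕜 Y}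
    (hN : IsEquivNorm N) {E : (n : ℕ) → (Fin n → 𝕜) → ℝ} {op : ℝ → ℝ → ℝ} (hE : IsSumNorm E op)
    {C : ℝ} (hC : 0 < C) (h : StepEstimate ξ A N op C) : UpperTreeEstimates E ξ A := by
  obtain ⟨M, hM, hAM⟩ := hN.exists_bound A
  obtain ⟨c, _, hc, -, hNc⟩ := hN
  refine ⟨2 * C / c, by positivity, ?_⟩
  intro D _ _ _ x hx hx1
  -- Strictly increasing from $C$ and bounded by $2C$: strictness is the room required by
  -- `IsSumNorm.eventually_forall_le`.
  let K : ℕ → ℝ := fun n => C * (2 - 1 / (n + 1))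
  have hK : ∀ n, K n < K (n + 1) := by
    intro n
    refine mul_lt_mul_of_pos_left (sub_lt_sub_left ?_ 2) hC
    push_cast
    exact one_div_lt_one_div_of_lt (by positivity) (by linarith)
  have hCK : ∀ n, C ≤ K n := by
    intro n
    have : 1 / ((n : ℝ) + 1) ≤ 1 := by
      rw [div_le_one (by positivity)]; linarith [(Nat.cast_nonneg n : (0 : ℝ) ≤ n)]
    change C ≤ C * (2 - 1 / (n + 1))
    nlinarith
  have hK2 : ∀ n, K n ≤ 2 * C := by
    intro n
    have : 0 < 1 / ((n : ℝ) + 1) := by positivity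
    change C * (2 - 1 / (n + 1)) ≤ 2 * C
    nlinarith
  have hstep : ∀ n (s : List (Ordinal.{w} × D)), s.map Prod.fst ∈ fullInf ξ n →
      (∀ a : Fin n → 𝕜, N (A (∑ i, a i • blockVec 𝕜 ξ x s i)) ≤ K n * E n a) →
      ∀ᶠ r in evFilter D ξ, ∀ a : Fin (n + 1) → 𝕜, N (A (∑ i, a i •
        blockVec 𝕜 ξ x (s ++ shiftD (ω ^ ξ * (n : Ordinal.{w})) r) i)) ≤ K (n + 1) * E (n + 1) a := by
    intro n s hs hbound
    set x' : List (Ordinal.{w} × D) → X :=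
      fun r => x (s ++ shiftD (ω ^ ξ * (n : Ordinal.{w})) r) with hx'
    have hmem : ∀ t : List Ordinal.{w}, t ∈ Gam ξ →
        s.map Prod.fst ++ shift (ω ^ ξ * (n : Ordinal.{w})) t ∈ GamInf ξ :=
      fun t ht => Set.mem_iUnion.2 ⟨n, append_mem_LamInf hs ht⟩
    have hnull : IsWeaklyNull 𝕜 (Gam ξ) x' := by
      intro t ζ ht f
      have h1 : ∀ u, x' (t ++ [(ζ, u)]) = x (s ++ shiftD (ω ^ ξ * (n : Ordinal.{w})) t ++
          [(ω ^ ξ * (n : Ordinal.{w}) + ζ, u)]) := fun u => by simp [hx', shiftD]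
      simp only [h1]
      refine hx _ _ ?_ f
      have := hmem _ ht
      rwa [shift_append, ← List.append_assoc, ← map_fst_shiftD, ← List.map_append] at this
    have hle : ∀ t ∈ dot (Gam ξ) D, ‖x' t‖ ≤ 1 := by
      intro t ht
      refine hx1 _ ?_
      change (s ++ shiftD _ t).map Prod.fst ∈ GamInf ξ
      rw [List.map_append, map_fst_shiftD]
      exact hmem _ ht
    have hMev : ∀ᶠ t in evFilter D ξ, N (A (avg 𝕜 ξ x' t)) ≤ M := by
      filter_upwards [eventually_evFilter D ξ] with t ht
      refine (hAM _).trans (mul_le_of_le_one_right hM.le (norm_avg_le 𝕜 ht.2 fun q hq => ?_))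
      exact hle q (map_fst_mem_of_mem_nodes (isDecTree_Gam ξ).1 ht.1.1 hq)
    have := hE.eventually_forall_le (v := fun i : Fin n => A (blockVec 𝕜 ξ x s i)) hC.le (hCK n)
      (hK n) hMev (h D x' hnull hle) (fun a => by simpa using hbound a)
    filter_upwards [this, eventually_evFilter D ξ] with t ht ht' a
    convert ht a using 2
    rw [Fin.sum_univ_castSucc, map_add, map_sum, map_smul, Fin.val_last,
      blockVec_append_shiftD hs ht'.1.1]
    congr 1
    refine Finset.sum_congr rfl fun i _ => ?_
    rw [map_smul, Fin.val_castSucc, blockVec_append_of_lt hs i.2]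
  refine ⟨{t | ∃ n, t.map Prod.fst ∈ fullInf ξ (n + 1) ∧ ∀ a : Fin (n + 1) → 𝕜,
    N (A (∑ i, a i • blockVec 𝕜 ξ x t i)) ≤ K (n + 1) * E (n + 1) a}, ?_, ?_, ?_, ?_⟩
  · rintro t ⟨n, hn, ht⟩
    refine ⟨n, mem_maxSet_dot (fullInf_succ_subset ξ n hn), fun a => ?_⟩
    have h1 := (hNc (A (∑ i, a i • blockVec 𝕜 ξ x t i))).1
    have h2 := mul_le_mul_of_nonneg_right (hK2 (n + 1)) (hE.nonneg (n + 1) a)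
    rw [div_mul_eq_mul_div, le_div_iff₀ hc, mul_comm]
    exact h1.trans ((ht a).trans h2)
  · rintro t ⟨n, hn, -⟩
    exact Set.mem_iUnion.2 ⟨n, mem_maxSet_dot (fullInf_succ_subset ξ n hn)⟩
  · rw [isEventual_iff]
    have h0 := hstep 0 [] (by simp [fullInf_zero]) (fun a => by simp [hE.zero])
    filter_upwards [h0, eventually_evFilter D ξ] with t ht ht'
    have hσ : shiftD (ω ^ ξ * ((0 : ℕ) : Ordinal.{w})) t = t := by simp [shiftD]
    rw [List.nil_append, hσ] at ht
    have hmem : t.map Prod.fst ∈ fullInf ξ 1 := by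
      refine mem_fullInf_succ.2 ⟨[], by simp [fullInf_zero], _, ht'.1, ?_⟩
      rw [← map_fst_shiftD, hσ, List.nil_append]
    exact ⟨⟨0, hmem, ht⟩, mem_maxSet_dot (fullInf_succ_subset ξ 0 hmem)⟩
  · rintro n t ⟨⟨m, hm, hbound⟩, hmax⟩
    have hmn : m = n := LamInf_index_unique (fullInf_succ_subset ξ m hm).1 hmax.1
    subst hmn
    rw [isEventual_iff]
    filter_upwards [hstep (m + 1) t hm hbound, eventually_evFilter D ξ] with r hr hr'
    have hmem : (t ++ shiftD (ω ^ ξ * ((m + 1 : ℕ) : Ordinal.{w})) r).map Prod.fst ∈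
        fullInf ξ (m + 1 + 1) := by
      rw [List.map_append, map_fst_shiftD]
      exact mem_fullInf_succ.2 ⟨_, hm, _, hr'.1, rfl⟩
    exact ⟨mem_maxSet_dot hr'.1, ⟨m + 1, hmem, hr⟩, mem_maxSet_dot (fullInf_succ_subset ξ _ hmem)⟩

end Step


/-! ### The renorming -/

/-- Treats both clauses of inevitability alike: the empty sequence is an admissible start although
it does not belong to `B`. -/
theorem eventually_append_mem_of_isInevitable {D : Type*} [Preorder D] [Nonempty D]
    [IsDirectedOrder D] {ξ : Ordinal.{w}} {B : Set (List (Ordinal.{w} × D))} (hB : IsInevitable ξ B) {n : ℕ}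
    {s : List (Ordinal.{w} × D)} (hs : s.map Prod.fst ∈ fullInf ξ n) (h : n = 0 ∨ s ∈ B) :
    ∀ᶠ t in evFilter D ξ, s ++ shiftD (ω ^ ξ * (n : Ordinal.{w})) t ∈ B := by
  cases n with
  | zero =>
    have hs : s = [] := by simpa [fullInf_zero] using hs
    subst hs
    have h1 := (isEventual_iff ξ _).1 hB.2.1
    filter_upwards [h1] with t ht
    simpa [shiftD] using ht.1
  | succ n =>
    have hs' := mem_maxSet_dot (fullInf_succ_subset ξ n hs)
    have h1 := (isEventual_iff ξ _).1 (hB.2.2 n s ⟨h.resolve_left n.succ_ne_zero, hs'⟩)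
    filter_upwards [h1] with t ht
    exact ht.2.1

section Win

variable {𝕜 : Type*} [RCLike 𝕜]
  {X : Type u} [NormedAddCommGroup X] [NormedSpace 𝕜 X]
  {Y : Type v} [NormedAddCommGroup Y] [NormedSpace 𝕜 Y]

theorem UpperTreeEstimates.normal {𝓓 : Set (Set X)} (h𝓓 : IsWeakNhdsBasis 𝕜 𝓓)
    {E : (n : ℕ) → (Fin n → 𝕜) → ℝ} {ξ : Ordinal.{w}} {A : X →L[𝕜] Y}
    (h : UpperTreeEstimates E ξ A) : NormalUpperTreeEstimates 𝓓 E ξ A := by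
  obtain ⟨C, hC, h⟩ := h
  have := h𝓓.nonempty
  have := h𝓓.isDirectedOrder
  refine ⟨C, hC, fun x hx hx1 => h _ x (fun t ζ ht f => ?_) hx1⟩
  refine tendsto_weakNhds.1 (h𝓓.tendsto fun U => ?_) f
  refine hx t ζ (OrderDual.ofDual U) ?_
  change (t ++ [(ζ, U)]).map Prod.fst ∈ GamInf ξ
  simpa using ht

/-- The player who chooses normal collections and scalars can force the norm, starting at `y`, above
the level which starts at `r` and is raised by `op` according to the scalars chosen. -/
inductive Win (𝓓 : Set (Set X)) (ξ : Ordinal.{w}) (A : X →L[𝕜] Y) (op : ℝ → ℝ → ℝ) (C : ℝ) :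
    Y → ℝ → Prop
  | base {y : Y} {r : ℝ} : 0 ≤ r → r < ‖y‖ → Win 𝓓 ξ A op C y r
  | step {y : Y} {r : ℝ} (x : List (Ordinal.{w} × (↥𝓓)ᵒᵈ) → X) (a : 𝕜)
      (S : Set (List (Ordinal.{w} × (↥𝓓)ᵒᵈ))) : 0 ≤ r → IsNormal 𝓓 x →
      (∃ᶠ t in evFilter (↥𝓓)ᵒᵈ ξ, t ∈ S) →
      (∀ t ∈ S, Win 𝓓 ξ A op C (y + a • A (avg 𝕜 ξ x t)) (op r (C * ‖a‖))) →
      Win 𝓓 ξ A op C y r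

variable {𝓓 : Set (Set X)} {ξ : Ordinal.{w}} {A : X →L[𝕜] Y} {op : ℝ → ℝ → ℝ} {C : ℝ}
  {E : (n : ℕ) → (Fin n → 𝕜) → ℝ}

/-! ### Monotonicity, homogeneity and convexity of winning positions -/

theorem Win.nonneg {y : Y} {r : ℝ} (h : Win 𝓓 ξ A op C y r) : 0 ≤ r := by
  cases h <;> assumption

theorem Win.mono (hE : IsSumNorm E op) (hC : 0 ≤ C) {y : Y} {r : ℝ} (h : Win 𝓓 ξ A op C y r) :
    ∀ r', 0 ≤ r' → r' ≤ r → Win 𝓓 ξ A op C y r' := by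
  induction h with
  | base h0 h => exact fun r' h0' hr' => Win.base h0' (hr'.trans_lt h)
  | step x a S h0 hx hS _ ih =>
    intro r' h0' hr'
    have ha : 0 ≤ C * ‖a‖ := by positivity
    exact Win.step x a S h0' hx hS fun t ht => ih t ht _ (h0'.trans (hE.left_le _ _ h0' ha))
      (hE.mono _ _ _ _ h0' hr' ha le_rfl)

theorem Win.smul (hE : IsSumNorm E op) (hC : 0 ≤ C) {y : Y} {r : ℝ} (h : Win 𝓓 ξ A op C y r)
    {c : 𝕜} (hc : c ≠ 0) : Win 𝓓 ξ A op C (c • y) (‖c‖ * r) := by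
  induction h with
  | base h0 h =>
    refine Win.base (by positivity) ?_
    rw [norm_smul]
    exact mul_lt_mul_of_pos_left h (norm_pos_iff.2 hc)
  | step x a S h0 hx hS _ ih =>
    refine Win.step x (c * a) S (by positivity) hx hS fun t ht => ?_
    have h1 := ih t ht
    rw [← hE.hom _ _ _ (norm_nonneg c) h0 (by positivity), smul_add, smul_smul] at h1
    rwa [norm_mul, mul_left_comm]

/-- The same moves are played from both points, the position at $y$ remaining the same convex
combination of the two. At the end one of the norms exceeds the level by convexity; going back up,
cofinally many responses favor one fixed point, as "frequently" distributes over "or". -/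
theorem Win.or_of_combination {y : Y} {r : ℝ} (h : Win 𝓓 ξ A op C y r) {α β : ℝ} (hα : 0 ≤ α)
    (hβ : 0 ≤ β) (hαβ : α + β = 1) : ∀ y₁ y₂ : Y, y = (α : 𝕜) • y₁ + (β : 𝕜) • y₂ →
    Win 𝓓 ξ A op C y₁ r ∨ Win 𝓓 ξ A op C y₂ r := by
  induction h with
  | @base y r h0 h =>
    intro y₁ y₂ hy
    by_contra! hcon
    have h1 : ‖y₁‖ ≤ r := not_lt.1 fun hlt => hcon.1 (Win.base h0 hlt)
    have h2 : ‖y₂‖ ≤ r := not_lt.1 fun hlt => hcon.2 (Win.base h0 hlt)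
    have h3 : ‖y‖ ≤ α * ‖y₁‖ + β * ‖y₂‖ := by
      rw [hy]
      refine (norm_add_le _ _).trans_eq ?_
      rw [norm_smul, norm_smul, RCLike.norm_ofReal, RCLike.norm_ofReal, abs_of_nonneg hα,
        abs_of_nonneg hβ]
    have h4 := mul_le_mul_of_nonneg_left h1 hα
    have h5 := mul_le_mul_of_nonneg_left h2 hβ
    have h6 : α * r + β * r = r := by rw [← add_mul, hαβ, one_mul]
    linarith
  | @step y r x a S h0 hx hS _ ih =>
    intro y₁ y₂ hy
    have hone : (α : 𝕜) + (β : 𝕜) = 1 := by exact_mod_cast congrArg ((↑) : ℝ → 𝕜) hαβ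
    have h1 : ∃ᶠ t in evFilter (↥𝓓)ᵒᵈ ξ,
        Win 𝓓 ξ A op C (y₁ + a • A (avg 𝕜 ξ x t)) (op r (C * ‖a‖)) ∨
        Win 𝓓 ξ A op C (y₂ + a • A (avg 𝕜 ξ x t)) (op r (C * ‖a‖)) := by
      refine hS.mono fun t ht => ih t ht _ _ ?_
      rw [hy]
      calc (α : 𝕜) • y₁ + (β : 𝕜) • y₂ + a • A (avg 𝕜 ξ x t)
          = (α : 𝕜) • y₁ + (β : 𝕜) • y₂ + ((α : 𝕜) + (β : 𝕜)) • (a • A (avg 𝕜 ξ x t)) := by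
            rw [hone, one_smul]
        _ = _ := by rw [add_smul, smul_add, smul_add]; abel
    rcases frequently_or_distrib.1 h1 with h | h
    · exact Or.inl (Win.step x a _ h0 hx h fun t ht => ht)
    · exact Or.inr (Win.step x a _ h0 hx h fun t ht => ht)

/-- A normal collection continuing `s` by a first block taken from `x₀`, and then according to the
collections `Z t`, where `t` is that first block. -/
theorem exists_glued_collection (h𝓓 : IsWeakNhdsBasis 𝕜 𝓓) {n : ℕ}
    (s : List (Ordinal.{w} × (↥𝓓)ᵒᵈ)) {x₀ : List (Ordinal.{w} × (↥𝓓)ᵒᵈ) → X}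
    (hx₀ : IsNormal 𝓓 x₀)
    {Z : List (Ordinal.{w} × (↥𝓓)ᵒᵈ) → List (Ordinal.{w} × (↥𝓓)ᵒᵈ) → X}
    (hZ : ∀ t, IsNormal 𝓓 (Z t)) :
    ∃ x, IsNormal 𝓓 x ∧ ∀ t : List (Ordinal.{w} × (↥𝓓)ᵒᵈ), t.map Prod.fst ∈ maxSet (Gam ξ) →
      (∀ q ∈ nodes t, x (s ++ shiftD (ω ^ ξ * (n : Ordinal.{w})) q) = x₀ q) ∧
      ∀ q, s ++ shiftD (ω ^ ξ * (n : Ordinal.{w})) t <+: q →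
        q ≠ s ++ shiftD (ω ^ ξ * (n : Ordinal.{w})) t → x q = Z t q := by
  classical
  set σ := shiftD (D := (↥𝓓)ᵒᵈ) (ω ^ ξ * (n : Ordinal.{w})) with hσ
  have hσ_prefix : ∀ p q, s ++ σ p <+: s ++ σ q → p <+: q := fun p q h =>
    prefix_of_map_prefix_map (fun a b h => by
      simp only [Prod.mk.injEq, add_right_inj] at h
      exact Prod.ext h.1 h.2) ((List.prefix_append_right_inj s).1 h)
  let P : List (Ordinal.{w} × (↥𝓓)ᵒᵈ) → List (Ordinal.{w} × (↥𝓓)ᵒᵈ) → Prop := fun q t =>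
    t.map Prod.fst ∈ maxSet (Gam ξ) ∧ s ++ σ t <+: q ∧ q ≠ s ++ σ t
  let Q : List (Ordinal.{w} × (↥𝓓)ᵒᵈ) → List (Ordinal.{w} × (↥𝓓)ᵒᵈ) → Prop := fun q r =>
    r ≠ [] ∧ q = s ++ σ r
  have hP : ∀ q t t', P q t → P q t' → t = t' := by
    rintro q t t' ⟨ht, hp, -⟩ ⟨ht', hp', -⟩
    rcases List.prefix_or_prefix_of_prefix hp hp' with h | h
    · exact ((mem_maxSet_dot ht).2 t' ht'.1 (hσ_prefix _ _ h)).symm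
    · exact (mem_maxSet_dot ht').2 t ht.1 (hσ_prefix _ _ h)
  let x : List (Ordinal.{w} × (↥𝓓)ᵒᵈ) → X := fun q =>
    if h : ∃ t, P q t then Z h.choose q else if h : ∃ r, Q q r then x₀ h.choose else 0
  refine ⟨x, ⟨fun t ζ U => ?_, fun t => ?_⟩, fun t ht => ⟨fun q hq => ?_, fun q hq hne => ?_⟩⟩
  · by_cases h1 : ∃ r, P (t ++ [(ζ, U)]) r
    · simp only [x, dif_pos h1]
      exact (hZ _).1 t ζ U
    · by_cases h2 : ∃ r, Q (t ++ [(ζ, U)]) r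
      · simp only [x, dif_neg h1, dif_pos h2]
        obtain ⟨hr, hr'⟩ := h2.choose_spec
        generalize h2.choose = r at hr hr'
        obtain ⟨r, ⟨η, V⟩, rfl⟩ := (List.eq_nil_or_concat' r).resolve_left hr
        have h3 : σ (r ++ [(η, V)]) = σ r ++ [(ω ^ ξ * (n : Ordinal.{w}) + η, V)] := by
          simp [hσ, shiftD]
        rw [h3, ← List.append_assoc] at hr'
        have h4 := List.append_inj_right' hr' rfl
        simp only [List.cons.injEq, Prod.mk.injEq, and_true] at h4
        rw [h4.2]
        exact hx₀.1 r η V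
      · simp only [x, dif_neg h1, dif_neg h2]
        exact h𝓓.zero_mem U
  · simp only [x]
    split_ifs
    · exact (hZ _).2 _
    · exact hx₀.2 _
    · simp
  · obtain ⟨hq0, hqt⟩ := mem_nodes.1 hq
    have h1 : ¬∃ r, P (s ++ σ q) r := by
      rintro ⟨r, hr, hrq, hne⟩
      have hrq' := hσ_prefix _ _ hrq
      have h2 : t = r := (mem_maxSet_dot hr).2 t ht.1 (hrq'.trans hqt)
      subst h2
      rw [hqt.eq_of_length_le hrq'.length_le] at hne
      exact hne rfl
    have h2 : ∃ r, Q (s ++ σ q) r := ⟨q, hq0, rfl⟩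
    simp only [x, dif_neg h1, dif_pos h2]
    congr 1
    exact shiftD_injective _ (List.append_cancel_left h2.choose_spec.2).symm
  · have h1 : ∃ r, P q r := ⟨t, ht, hq, hne⟩
    simp only [x, dif_pos h1]
    rw [hP q _ t h1.choose_spec ⟨ht, hq, hne⟩]

/-! ### Realizing a winning strategy by a single collection -/

theorem isNormal_zero (h𝓓 : IsWeakNhdsBasis 𝕜 𝓓) :
    IsNormal 𝓓 (fun _ => 0 : List (Ordinal.{w} × (↥𝓓)ᵒᵈ) → X) :=
  ⟨fun _ _ U => h𝓓.zero_mem U, fun _ => by simp⟩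

/-- A winning position gives a normal collection such that every inevitable set contains a branch
along which the norm exceeds the prescribed level. -/
theorem Win.exists_collection (h𝓓 : IsWeakNhdsBasis 𝕜 𝓓) {y : Y} {r : ℝ}
    (h : Win 𝓓 ξ A op C y r) : ∀ (n : ℕ) (s : List (Ordinal.{w} × (↥𝓓)ᵒᵈ)),
    s.map Prod.fst ∈ fullInf ξ n → ∃ x, IsNormal 𝓓 x ∧ ∀ B, IsInevitable ξ B → (n = 0 ∨ s ∈ B) →
      ∃ (k : ℕ) (t : List (Ordinal.{w} × (↥𝓓)ᵒᵈ)), s <+: t ∧ t.map Prod.fst ∈ fullInf ξ (n + k) ∧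
        (n + k = 0 ∨ t ∈ B) ∧ ∃ a : ℕ → 𝕜,
        ((List.range' n k).map fun i => C * ‖a i‖).foldl op r <
          ‖y + ((List.range' n k).map fun i => a i • A (blockVec 𝕜 ξ x t i)).sum‖ := by
  have := h𝓓.nonempty
  have := h𝓓.isDirectedOrder
  induction h with
  | base h0 h =>
    intro n s hs
    exact ⟨fun _ => 0, isNormal_zero h𝓓, fun B _ hsB => ⟨0, s, List.prefix_rfl, hs, hsB, 0,
      by simpa using h⟩⟩
  | @step y r x₀ a₀ S h0 hx₀ hS _ ih =>
    intro n s hs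
    set σ := shiftD (D := (↥𝓓)ᵒᵈ) (ω ^ ξ * (n : Ordinal.{w})) with hσ
    have hmem : ∀ t : List (Ordinal.{w} × (↥𝓓)ᵒᵈ), t.map Prod.fst ∈ maxSet (Gam ξ) →
        (s ++ σ t).map Prod.fst ∈ fullInf ξ (n + 1) := by
      intro t ht
      rw [List.map_append, hσ, map_fst_shiftD]
      exact mem_fullInf_succ.2 ⟨_, hs, _, ht, rfl⟩
    -- The continuation after each first block is fixed before `B` is known, so one collection works
    -- against all inevitable sets. Where the strategy says nothing, the zero collection is used.
    have hZ : ∀ t : List (Ordinal.{w} × (↥𝓓)ᵒᵈ), ∃ z : List (Ordinal.{w} × (↥𝓓)ᵒᵈ) → X,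
        IsNormal 𝓓 z ∧ (t ∈ S → t.map Prod.fst ∈ maxSet (Gam ξ) →
        ∀ B, IsInevitable ξ B → (n + 1 = 0 ∨ s ++ σ t ∈ B) →
        ∃ (k : ℕ) (q : List (Ordinal.{w} × (↥𝓓)ᵒᵈ)), s ++ σ t <+: q ∧
          q.map Prod.fst ∈ fullInf ξ (n + 1 + k) ∧ (n + 1 + k = 0 ∨ q ∈ B) ∧ ∃ a : ℕ → 𝕜,
          ((List.range' (n + 1) k).map fun i => C * ‖a i‖).foldl op (op r (C * ‖a₀‖)) <
            ‖y + a₀ • A (avg 𝕜 ξ x₀ t) +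
              ((List.range' (n + 1) k).map fun i => a i • A (blockVec 𝕜 ξ z q i)).sum‖) := by
      intro t
      by_cases ht : t ∈ S ∧ t.map Prod.fst ∈ maxSet (Gam ξ)
      · obtain ⟨z, hz, h⟩ := ih t ht.1 (n + 1) (s ++ σ t) (hmem t ht.2)
        exact ⟨z, hz, fun _ _ => h⟩
      · exact ⟨fun _ => 0, isNormal_zero h𝓓, fun h1 h2 => absurd ⟨h1, h2⟩ ht⟩
    choose Z hZn hZ using hZ
    obtain ⟨x, hx, hxZ⟩ := exists_glued_collection (ξ := ξ) h𝓓 (n := n) s hx₀ hZn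
    refine ⟨x, hx, fun B hB hsB => ?_⟩
    obtain ⟨t, ⟨htS, htB⟩, ht⟩ := ((hS.and_eventually
      (eventually_append_mem_of_isInevitable hB hs hsB)).and_eventually
      (eventually_evFilter _ ξ)).exists
    obtain ⟨k, q, hq, hqk, hqB, a, ha⟩ := hZ t htS ht.1 B hB (Or.inr htB)
    have hidx : n + 1 + k = n + (k + 1) := by omega
    rw [hidx] at hqk hqB
    refine ⟨k + 1, q, (List.prefix_append _ _).trans hq, hqk, hqB, Function.update a n a₀, ?_⟩
    have hne : ∀ i ∈ List.range' (n + 1) k, Function.update a n a₀ i = a i := by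
      intro i hi
      rw [Function.update_of_ne]
      have := (List.mem_range'_1.1 hi).1
      omega
    have e1 : ((List.range' (n + 1) k).map fun i => C * ‖Function.update a n a₀ i‖) =
        (List.range' (n + 1) k).map fun i => C * ‖a i‖ :=
      List.map_congr_left fun i hi => by rw [hne i hi]
    have e2 : ((List.range' (n + 1) k).map fun i =>
          Function.update a n a₀ i • A (blockVec 𝕜 ξ x q i)) =
        (List.range' (n + 1) k).map fun i => a i • A (blockVec 𝕜 ξ (Z t) q i) :=
      List.map_congr_left fun i hi => by
        rw [hne i hi, blockVec_congr (hmem t ht.1) (List.mem_range'_1.1 hi).1 hq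
          fun p hp hp' => (hxZ t ht.1).2 p hp hp']
    have e3 : blockVec 𝕜 ξ x q n = avg 𝕜 ξ x₀ t := by
      obtain ⟨p, rfl⟩ := hq
      rw [blockVec_append_of_lt (hmem t ht.1) n.lt_succ_self, hσ,
        blockVec_append_shiftD hs ht.1.1, avg, avg]
      congr 1
      refine List.map_congr_left fun p hp => ?_
      rw [(hxZ t ht.1).1 p hp]
    rw [List.range'_succ, List.map_cons, List.map_cons, List.foldl_cons, List.sum_cons, e1, e2, e3,
      Function.update_self, ← add_assoc]
    exact ha

/-- The final level of the game dominates both its starting value and the sequence norm of the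
scalars played. -/
theorem IsSumNorm.le_foldl (hE : IsSumNorm E op) (hC : 0 ≤ C) (a : ℕ → 𝕜) {r : ℝ} (hr : 0 ≤ r)
    (n : ℕ) : r ≤ ((List.range n).map fun i => C * ‖a i‖).foldl op r ∧
      C * E n (fun i => a i) ≤ ((List.range n).map fun i => C * ‖a i‖).foldl op r := by
  induction n with
  | zero => simp [hE.zero, hr]
  | succ n ih =>
    rw [List.range_succ, List.map_append, List.foldl_append, hE.snoc]
    have h1 := hr.trans ih.1
    have h2 : 0 ≤ C * ‖a n‖ := by positivity
    refine ⟨ih.1.trans (hE.left_le _ _ h1 h2), ?_⟩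
    rw [← hE.hom _ _ _ hC (hE.nonneg _ _) (norm_nonneg _)]
    exact hE.mono _ _ _ _ (mul_nonneg hC (hE.nonneg _ _)) ih.2 h2 le_rfl

/-- The game is played with twice the constant of the tree estimates. A final level $L$ then
satisfies $L\ge2C\,E(a)$ and $L<\|y\|+C\,E(a)\le\|y\|+L/2$, whence $r\le L<2\|y\|$. -/
theorem NormalUpperTreeEstimates.exists_win_bound (h𝓓 : IsWeakNhdsBasis 𝕜 𝓓)
    (hE : IsSumNorm E op) (h : NormalUpperTreeEstimates 𝓓 E ξ A) :
    ∃ C > 0, ∀ y r, Win 𝓓 ξ A op C y r → r ≤ 2 * ‖y‖ := by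
  obtain ⟨C, hC, h⟩ := h
  refine ⟨2 * C, by positivity, fun y r hw => ?_⟩
  have hr := hw.nonneg
  obtain ⟨x, hx, hxB⟩ := hw.exists_collection h𝓓 0 [] (by simp [fullInf_zero])
  obtain ⟨B, hBg, hB⟩ := h x (fun t ζ U _ => hx.1 t ζ (OrderDual.toDual U)) fun t _ => hx.2 t
  obtain ⟨k, t, -, htk, htB, a, ha⟩ := hxB B hB (Or.inl rfl)
  rw [zero_add] at htk htB
  rw [← List.range_eq_range'] at ha
  obtain ⟨h1, h2⟩ := hE.le_foldl (C := 2 * C) (by positivity) a hr k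
  rw [sum_map_list_range] at ha
  have h3 : ‖∑ i ∈ Finset.range k, a i • A (blockVec 𝕜 ξ x t i)‖ ≤ C * E k fun i => a i := by
    cases k with
    | zero => simp [hE.zero]
    | succ k =>
      obtain ⟨n, hn, hgood⟩ := hBg (htB.resolve_left k.succ_ne_zero)
      have hkn := LamInf_index_unique (fullInf_succ_subset ξ k htk).1 hn.1
      subst hkn
      have := hgood fun i => a i
      rwa [map_sum, Finset.sum_congr rfl fun i _ => map_smul A _ _,
        Fin.sum_univ_eq_sum_range fun i => a i • A (blockVec 𝕜 ξ x t i)] at this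
  have h4 := norm_add_le y (∑ i ∈ Finset.range k, a i • A (blockVec 𝕜 ξ x t i))
  linarith

/-- If winning positions are bounded, the supremum of the winning levels is an equivalent norm with
a one-step estimate along normal collections. -/
theorem exists_equivNorm_of_win_bound (hE : IsSumNorm E op) (hC : 0 ≤ C)
    (hb : ∀ y r, Win 𝓓 ξ A op C y r → r ≤ 2 * ‖y‖) :
    ∃ N : Seminorm 𝕜 Y, IsEquivNorm N ∧ ∀ y (a : 𝕜) r x, N y < r → IsNormal 𝓓 x →
      ∀ᶠ t in evFilter (↥𝓓)ᵒᵈ ξ, N (y + a • A (avg 𝕜 ξ x t)) ≤ op r (C * ‖a‖) := by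
  -- The value $0$ is adjoined because there may be no winning level, as at $y=0$.
  let f : Y → ℝ := fun y => sSup {r | r = 0 ∨ Win 𝓓 ξ A op C y r}
  have hbdd : ∀ y, BddAbove {r | r = 0 ∨ Win 𝓓 ξ A op C y r} := by
    refine fun y => ⟨2 * ‖y‖, ?_⟩
    rintro r (rfl | hr)
    · positivity
    · exact hb y r hr
  have h0 : ∀ y, 0 ≤ f y := fun y => le_csSup (hbdd y) (Or.inl rfl)
  have hle : ∀ y r, 0 ≤ r → ¬Win 𝓓 ξ A op C y r → f y ≤ r := by
    intro y r hr hw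
    refine csSup_le ⟨0, Or.inl rfl⟩ ?_
    rintro r' (rfl | hr')
    · exact hr
    · by_contra! hlt
      exact hw (hr'.mono hE hC r hr hlt.le)
  have hnot : ∀ y r, f y < r → ¬Win 𝓓 ξ A op C y r := fun y r hlt hw =>
    absurd (le_csSup (hbdd y) (Or.inr hw)) (not_le.2 hlt)
  have hle2 : ∀ y, f y ≤ 2 * ‖y‖ := by
    intro y
    refine csSup_le ⟨0, Or.inl rfl⟩ ?_
    rintro r (rfl | hr)
    · positivity
    · exact hb y r hr
  have hge : ∀ y, ‖y‖ ≤ f y := by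
    intro y
    by_contra! hlt
    exact hnot y _ (left_lt_add_div_two.2 hlt) (Win.base (by linarith [h0 y, norm_nonneg y])
      (add_div_two_lt_right.2 hlt))
  have hadd : ∀ y₁ y₂, f (y₁ + y₂) ≤ f y₁ + f y₂ := by
    intro y₁ y₂
    refine le_of_forall_pos_le_add fun ε hε => ?_
    set r₁ := f y₁ + ε / 2 with hr₁
    set r₂ := f y₂ + ε / 2 with hr₂
    have hp₁ : 0 < r₁ := by have := h0 y₁; positivity
    have hp₂ : 0 < r₂ := by have := h0 y₂; positivity
    -- After normalization, losing at level $r_i$ from $y_i$ means losing at level $1$ from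
    -- $y_i/r_i$. The point $(y_1+y_2)/(r_1+r_2)$ is a convex combination of these two, so it is
    -- also losing at level $1$.
    have hn : ∀ y r, 0 < r → f y < r → ¬Win 𝓓 ξ A op C (((r⁻¹ : ℝ) : 𝕜) • y) 1 := by
      intro y r hr hlt hw
      have hr' : (r : 𝕜) ≠ 0 := RCLike.ofReal_ne_zero.2 hr.ne'
      have := hw.smul hE hC hr'
      rw [smul_smul, RCLike.norm_ofReal, abs_of_pos hr, mul_one, RCLike.ofReal_inv,
        mul_inv_cancel₀ hr', one_smul] at this
      exact hnot y r hlt this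
    have hsum : f (y₁ + y₂) ≤ r₁ + r₂ := by
      refine hle _ _ (by positivity) fun hw => ?_
      have hp : 0 < r₁ + r₂ := by positivity
      have hc : (((r₁ + r₂)⁻¹ : ℝ) : 𝕜) ≠ 0 := RCLike.ofReal_ne_zero.2 (inv_pos.2 hp).ne'
      have h1 := hw.smul hE hC hc
      rw [RCLike.norm_ofReal, abs_of_pos (inv_pos.2 hp), inv_mul_cancel₀ hp.ne'] at h1
      have h2 := h1.or_of_combination (α := r₁ / (r₁ + r₂)) (β := r₂ / (r₁ + r₂)) (by positivity)
        (by positivity) (by field_simp) (((r₁⁻¹ : ℝ) : 𝕜) • y₁) (((r₂⁻¹ : ℝ) : 𝕜) • y₂) (by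
          rw [smul_smul, smul_smul, ← RCLike.ofReal_mul, ← RCLike.ofReal_mul, smul_add]
          congr 3 <;> field_simp)
      rcases h2 with h2 | h2
      · exact hn y₁ r₁ hp₁ (by linarith) h2
      · exact hn y₂ r₂ hp₂ (by linarith) h2
    linarith
  have hzero : f 0 = 0 := le_antisymm (by simpa using hle2 0) (h0 0)
  have hsmul : ∀ (c : 𝕜) y, f (c • y) ≤ ‖c‖ * f y := by
    intro c y
    rcases eq_or_ne c 0 with rfl | hc
    · simp [hzero]
    refine csSup_le ⟨0, Or.inl rfl⟩ ?_
    have hcn : 0 < ‖c‖ := norm_pos_iff.2 hc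
    rintro r (rfl | hr)
    · have := h0 y
      positivity
    · have h1 := hr.smul hE hC (inv_ne_zero hc)
      rw [smul_smul, inv_mul_cancel₀ hc, one_smul, norm_inv] at h1
      have h2 : ‖c‖⁻¹ * r ≤ f y := le_csSup (hbdd y) (Or.inr h1)
      rwa [inv_mul_le_iff₀ hcn] at h2
  refine ⟨Seminorm.ofSMulLE f hzero hadd hsmul, ⟨1, 2, one_pos, two_pos, fun y => ⟨?_, hle2 y⟩⟩,
    fun y a r x hyr hx => ?_⟩
  · rw [one_mul]; exact hge y
  · have hr : 0 ≤ r := (h0 y).trans hyr.le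
    -- Otherwise the move $(x,a)$ would win from $y$ at a level above $f(y)$.
    have h1 : ¬∃ᶠ t in evFilter (↥𝓓)ᵒᵈ ξ,
        Win 𝓓 ξ A op C (y + a • A (avg 𝕜 ξ x t)) (op r (C * ‖a‖)) := fun hf =>
      hnot y r hyr (Win.step x a _ hr hx hf fun t ht => ht)
    rw [not_frequently] at h1
    filter_upwards [h1] with t ht
    exact hle _ _ (hr.trans (hE.left_le _ _ hr (by positivity))) ht

end Win


/-! ### The norms of `ℓ_p` and `c_0` -/

section SumNorm

variable {𝕜 : Type*} [RCLike 𝕜]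

theorem rpow_rpow_one_div {p r : ℝ} (hp : p ≠ 0) (hr : 0 ≤ r) : (r ^ p) ^ (1 / p) = r := by
  rw [one_div, Real.rpow_rpow_inv hr hp]

theorem rpow_one_div_rpow {p r : ℝ} (hp : p ≠ 0) (hr : 0 ≤ r) : (r ^ (1 / p)) ^ p = r := by
  rw [one_div, Real.rpow_inv_rpow hr hp]

theorem isSumNorm_ellpNorm {p : ℝ} (hp : 1 < p) :
    IsSumNorm (ellpNorm 𝕜 p) fun r s => (r ^ p + s ^ p) ^ (1 / p) where
  zero a := by
    simp [ellpNorm, Real.zero_rpow (by positivity : p⁻¹ ≠ 0)]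
  snoc n a := by
    rw [ellpNorm, ellpNorm, rpow_one_div_rpow (by positivity)
      (Finset.sum_nonneg fun i _ => by positivity), Fin.sum_univ_castSucc]
  cont n := by
    refine Continuous.rpow_const (continuous_finsetSum _ fun i _ => ?_)
      fun _ => Or.inr (by positivity)
    exact (continuous_apply i).norm.rpow_const fun _ => Or.inr (by positivity)
  mono r r' s s' hr hrr hs hss := by
    refine Real.rpow_le_rpow (by positivity) (add_le_add ?_ ?_) (by positivity)
    · exact Real.rpow_le_rpow hr hrr (by positivity)
    · exact Real.rpow_le_rpow hs hss (by positivity)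
  left_le r s hr hs := by
    calc r = (r ^ p) ^ (1 / p) := (rpow_rpow_one_div (by positivity) hr).symm
      _ ≤ _ := Real.rpow_le_rpow (by positivity) (le_add_of_nonneg_right (by positivity))
        (by positivity)
  right_le r s hr hs := by
    calc s = (s ^ p) ^ (1 / p) := (rpow_rpow_one_div (by positivity) hs).symm
      _ ≤ _ := Real.rpow_le_rpow (by positivity) (le_add_of_nonneg_left (by positivity))
        (by positivity)
  le_add r s hr hs := Real.rpow_add_rpow_le_add hr hs hp.le
  hom c r s hc hr hs := by
    rw [Real.mul_rpow hc hr, Real.mul_rpow hc hs, ← mul_add,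
      Real.mul_rpow (by positivity) (by positivity), rpow_rpow_one_div (by positivity) hc]

theorem isSumNorm_c0Norm : IsSumNorm (c0Norm 𝕜) max where
  zero a := by simp [c0Norm, Subsingleton.elim a 0]
  snoc n a := by
    refine le_antisymm ((pi_norm_le_iff_of_nonneg (by positivity)).2 fun i => ?_)
      (max_le ((pi_norm_le_iff_of_nonneg (norm_nonneg _)).2 fun i => ?_) (norm_le_pi_norm a _))
    · refine Fin.lastCases (le_max_right _ _) (fun i => ?_) i
      exact (norm_le_pi_norm (fun i : Fin n => a i.castSucc) i).trans (le_max_left _ _)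
    · exact norm_le_pi_norm a i.castSucc
  cont n := continuous_norm
  mono r r' s s' _ h _ h' := max_le_max h h'
  left_le r s _ _ := le_max_left r s
  right_le r s _ _ := le_max_right r s
  le_add r s hr hs := max_le (by linarith) (by linarith)
  hom c r s hc _ _ := (mul_max_of_nonneg r s hc).symm

end SumNorm

/-! ### Smoothness and one-step estimates -/

section Smooth

variable {𝕜 : Type*} [RCLike 𝕜]
  {X : Type u} [NormedAddCommGroup X] [NormedSpace 𝕜 X]
  {Y : Type v} [NormedAddCommGroup Y] [NormedSpace 𝕜 Y]
  {𝓓 : Set (Set X)} {ξ : Ordinal.{w}} {A : X →L[𝕜] Y} {N : Seminorm 𝕜 Y}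

/-! ### Positivity, monotonicity and rescaling of the modulus -/

theorem sInf_values_nonneg {Λ D : Type*} {T : Set (List Λ)} {x : List (Λ × D) → X}
    (h : ∀ t, x t = 0) {y : Y} (hy : N y = 1) :
    0 ≤ sInf {q : ℝ | ∃ t ∈ dot T D, ∃ z ∈ branchHull 𝕜 x t, q = N (y + A z) - 1} := by
  refine Real.sInf_nonneg ?_
  rintro _ ⟨t, -, z, ⟨c, -, -, rfl⟩, rfl⟩
  simp [h, hy]

theorem exists_apply_eq_one (hN : IsEquivNorm N) (hA : A ≠ 0) : ∃ y, N y = 1 := by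
  obtain ⟨x, hx⟩ : ∃ x, A x ≠ 0 := by
    by_contra! h
    exact hA (ContinuousLinearMap.ext h)
  obtain ⟨c, C, hc, hC, h⟩ := hN
  have hpos : 0 < N (A x) := lt_of_lt_of_le (by positivity) (h (A x)).1
  refine ⟨(((N (A x))⁻¹ : ℝ) : 𝕜) • A x, ?_⟩
  rw [seminorm_real_smul N (inv_nonneg.2 hpos.le), inv_mul_cancel₀ hpos.ne']

theorem modulus_nonneg (hN : IsEquivNorm N) {σ : ℝ} (hσ : 0 < σ) : 0 ≤ modulus ξ A N σ := by
  rcases eq_or_ne A 0 with hA | hA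
  · rw [modulus, if_pos (Or.inl hA)]
  obtain ⟨y, hy⟩ := exists_apply_eq_one hN hA
  refine (sInf_values_nonneg (T := decTree (ω ^ ξ)) (D := PUnit.{u + 1}) (A := A)
    (x := fun _ => (0 : X)) (fun _ => rfl) hy).trans ?_
  exact le_modulus hN hA hσ hy.le (isTree_decTree _) (hasOrder_decTree _)
    (fun t ζ _ f => by simp) fun t _ => by simpa using hσ.le

theorem modulus_mono (hN : IsEquivNorm N) {σ τ : ℝ} (hσ : 0 < σ) (h : σ ≤ τ) :
    modulus ξ A N σ ≤ modulus ξ A N τ := by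
  have hτ := hσ.trans_le h
  have h0 := modulus_nonneg (ξ := ξ) (A := A) hN hτ
  rw [modulus]
  split_ifs with h1
  · exact h0
  · refine Real.sSup_le ?_ h0
    rintro _ ⟨y, Λ, T, D, _, _, _, x, hy, hT, hTo, hx, hxσ, rfl⟩
    exact le_modulus hN (fun hA => h1 (Or.inl hA)) hτ hy hT hTo hx fun t ht => (hxσ t ht).trans h

/-- Rescaled form of `eventually_le_modulus`. -/
theorem eventually_le_mul_modulus (h𝓓 : IsWeakNhdsBasis 𝕜 𝓓) (hN : IsEquivNorm N) (hA : A ≠ 0)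
    {ρ δ : ℝ} (hρ : 0 < ρ) (hδ : 0 < δ) {y : Y} (hy : N y ≤ ρ) {a : 𝕜} (ha : a ≠ 0) {D : Type*}
    [Preorder D] {x : List (Ordinal.{w} × D) → X} (hx : IsWeaklyNull 𝕜 (Gam ξ) x)
    (hx1 : ∀ t ∈ dot (Gam ξ) D, ‖x t‖ ≤ 1) :
    ∀ᶠ t in evFilter D ξ,
      N (y + a • A (avg 𝕜 ξ x t)) ≤ ρ * (1 + modulus ξ A N (‖a‖ / ρ) + δ) := by
  have hna : 0 < ‖a‖ := norm_pos_iff.2 ha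
  have hna' : (‖a‖ : 𝕜) ≠ 0 := RCLike.ofReal_ne_zero.2 hna.ne'
  have hρ' : (ρ : 𝕜) ≠ 0 := RCLike.ofReal_ne_zero.2 hρ.ne'
  set c : 𝕜 := a / (‖a‖ : 𝕜) with hc
  have hc1 : ‖c‖ = 1 := by
    rw [hc, norm_div, RCLike.norm_ofReal, abs_norm, div_self hna.ne']
  have hy' : N (((ρ⁻¹ : ℝ) : 𝕜) • y) ≤ 1 := by
    rw [seminorm_real_smul N (inv_nonneg.2 hρ.le)]
    exact (inv_mul_le_one₀ hρ).2 hy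
  have hx' : IsWeaklyNull 𝕜 (Gam ξ) fun t => c • x t := by
    intro t ζ ht f
    simpa using (hx t ζ ht f).const_mul c
  filter_upwards [eventually_le_modulus h𝓓 hN hA (div_pos hna hρ) hδ hy' hx' fun t ht => by
    rw [norm_smul, hc1, one_mul]; exact hx1 t ht] with t ht
  have h1 : y + a • A (avg 𝕜 ξ x t) = (ρ : 𝕜) • (((ρ⁻¹ : ℝ) : 𝕜) • y +
      ((‖a‖ / ρ : ℝ) : 𝕜) • A (avg 𝕜 ξ (fun t => c • x t) t)) := by
    rw [avg_smul, map_smul, smul_add, smul_smul, smul_smul, smul_smul, hc]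
    congr 2
    · rw [RCLike.ofReal_inv, mul_inv_cancel₀ hρ', one_smul]
    · rw [RCLike.ofReal_div]
      field_simp
  rw [h1, seminorm_real_smul N hρ.le]
  exact mul_le_mul_of_nonneg_left ht hρ.le

/-! ### One-step estimates from smoothness and flatness -/

theorem stepEstimate_of_ne_zero {op : ℝ → ℝ → ℝ} {C : ℝ} (hC : 0 ≤ C)
    (hop : ∀ r s, 0 ≤ r → 0 ≤ s → r ≤ op r s)
    (h : A ≠ 0 → ∀ (D : Type u) [Preorder D] (x : List (Ordinal.{w} × D) → X),
      IsWeaklyNull 𝕜 (Gam ξ) x → (∀ t ∈ dot (Gam ξ) D, ‖x t‖ ≤ 1) →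
      ∀ y (a : 𝕜) r, a ≠ 0 → N y < r →
        ∀ᶠ t in evFilter D ξ, N (y + a • A (avg 𝕜 ξ x t)) ≤ op r (C * ‖a‖)) :
    StepEstimate ξ A N op C := by
  intro D _ x hx hx1 y a r hr
  by_cases h0 : A = 0 ∨ a = 0
  · refine Eventually.of_forall fun t => ?_
    have h1 : a • A (avg 𝕜 ξ x t) = 0 := by
      rcases h0 with h0 | h0 <;> simp [h0]
    rw [h1, add_zero]
    exact hr.le.trans (hop _ _ ((apply_nonneg N y).trans hr.le) (by positivity))
  · rw [not_or] at h0
    exact h h0.1 D x hx hx1 y a r h0.2 hr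

/-- Convexity of $t^p$ on the segment from $1$ to $1+K$, with parameter $q=s^p\le1$, gives
$(1+Kq)^p\le1-q+q(1+K)^p$. The strict inequality later absorbs the error $\delta$. -/
theorem one_add_mul_rpow_lt {p K M s : ℝ} (hp : 1 < p) (hK : 0 < K) (hM : 0 < M) (hs : 0 < s)
    (hs1 : s ≤ 1) : 1 + K * s ^ p < (1 + ((1 + K + M) * s) ^ p) ^ (1 / p) := by
  have hp0 : 0 < p := by linarith
  set q := s ^ p with hq
  have hq0 : 0 < q := Real.rpow_pos_of_pos hs p
  have hq1 : q ≤ 1 := Real.rpow_le_one hs.le hs1 hp0.le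
  have h1 := (convexOn_rpow hp.le).2 (Set.mem_Ici.2 zero_le_one)
    (Set.mem_Ici.2 (by positivity : 0 ≤ 1 + K)) (sub_nonneg.2 hq1) hq0.le (sub_add_cancel 1 q)
  simp only [smul_eq_mul, Real.one_rpow, mul_one] at h1
  have h2 : (1 + K) ^ p < (1 + K + M) ^ p :=
    Real.rpow_lt_rpow (by positivity) (by linarith) hp0
  have h3 : 1 - q + q * (1 + K) = 1 + K * q := by ring
  rw [h3] at h1
  rw [Real.mul_rpow (by positivity) hs.le, ← hq, one_div,
    Real.lt_rpow_inv_iff_of_pos (by positivity) (by positivity) hp0]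
  nlinarith

/-- Bernoulli: $(r+s)^p=r^p(1+s/r)^p\ge r^p+r^p\,p\,s/r\ge r^p+s$, the last step because $r,p\ge1$.
-/
theorem rpow_add_rpow_one_div_le {p r s : ℝ} (hp : 1 ≤ p) (hr : 1 ≤ r) (hs : 0 ≤ s) :
    (r ^ p + s) ^ (1 / p) ≤ r + s := by
  have hr0 : 0 < r := by linarith
  have h1 := one_add_mul_self_le_rpow_one_add (s := s / r) (by linarith [div_nonneg hs hr0.le]) hp
  have h2 := Real.self_le_rpow_of_one_le hr hp
  have h3 : r + s = r * (1 + s / r) := by field_simp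
  rw [one_div, Real.rpow_inv_le_iff_of_pos (by positivity) (by positivity) (by linarith), h3,
    Real.mul_rpow hr0.le (by positivity)]
  have h4 : s ≤ r ^ p * (p * (s / r)) := by
    calc s = r * (1 * (s / r)) := by field_simp
      _ ≤ r ^ p * (p * (s / r)) := by gcongr
  nlinarith [mul_le_mul_of_nonneg_left h1 (Real.rpow_nonneg hr0.le p)]

/-- The constant $1+K+M$ serves two regimes. For $|a|\le r$ the modulus bound $K\sigma^p$ at
$\sigma=|a|/r\le1$ is used; for $|a|>r$ the triangle inequality already gives $r+M|a|\le(1+M)|a|$.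
-/
theorem stepEstimate_of_isAUSmooth (h𝓓 : IsWeakNhdsBasis 𝕜 𝓓) (hN : IsEquivNorm N) {p : ℝ}
    (hp : 1 < p) (h : IsAUSmooth ξ p A N) :
    ∃ C > 0, StepEstimate ξ A N (fun r s => (r ^ p + s ^ p) ^ (1 / p)) C := by
  obtain ⟨M, hM, hAM⟩ := hN.exists_bound A
  obtain ⟨K', hK'⟩ := h
  set K := max K' 1 with hKd
  have hK : 0 < K := lt_max_of_lt_right one_pos
  have hmod : ∀ σ, 0 < σ → modulus ξ A N σ ≤ K * σ ^ p := by
    intro σ hσ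
    have := (hK' ⟨σ, hσ, rfl⟩).trans (le_max_left K' 1)
    rwa [div_le_iff₀ (Real.rpow_pos_of_pos hσ p)] at this
  have hop := isSumNorm_ellpNorm (𝕜 := 𝕜) hp
  refine ⟨1 + K + M, by positivity, stepEstimate_of_ne_zero (by positivity) hop.left_le ?_⟩
  intro hA D _ x hx hx1 y a r ha hr
  have hr0 : 0 < r := (apply_nonneg N y).trans_lt hr
  have hna : 0 < ‖a‖ := norm_pos_iff.2 ha
  rcases le_or_gt (‖a‖) r with har | har
  · set s := ‖a‖ / r with hs
    have hs0 : 0 < s := by positivity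
    have hlt := one_add_mul_rpow_lt hp hK hM hs0 ((div_le_one hr0).2 har)
    filter_upwards [eventually_le_mul_modulus h𝓓 hN hA hr0 (sub_pos.2 hlt) hr.le ha hx hx1]
      with t ht
    have h1 := hop.hom r 1 ((1 + K + M) * s) hr0.le zero_le_one (by positivity)
    have h2 : r * ((1 + K + M) * s) = (1 + K + M) * ‖a‖ := by
      rw [hs]; field_simp
    simp only [h2, mul_one, Real.one_rpow] at h1
    refine ht.trans ?_
    rw [h1]
    exact mul_le_mul_of_nonneg_left (by linarith [hmod s hs0]) hr0.le
  · filter_upwards [eventually_evFilter D ξ] with t ht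
    refine le_trans ?_ (hop.right_le r _ hr0.le (by positivity))
    have h1 : ‖avg 𝕜 ξ x t‖ ≤ 1 := norm_avg_le 𝕜 ht.2 fun s hs =>
      hx1 s (map_fst_mem_of_mem_nodes (isDecTree_Gam ξ).1 ht.1.1 hs)
    have h2 := map_add_le_add N y (a • A (avg 𝕜 ξ x t))
    have h3 : N (A (avg 𝕜 ξ x t)) ≤ M := (hAM _).trans (mul_le_of_le_one_right hM.le h1)
    rw [map_smul_eq_mul] at h2
    nlinarith [mul_le_mul_of_nonneg_left h3 hna.le, mul_pos hK hna]

theorem stepEstimate_of_isAUFlat (h𝓓 : IsWeakNhdsBasis 𝕜 𝓓) (hN : IsEquivNorm N)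
    (h : IsAUFlat ξ A N) : ∃ C > 0, StepEstimate ξ A N max C := by
  obtain ⟨σ, hσ, hmod⟩ := h
  refine ⟨2 / σ, by positivity, stepEstimate_of_ne_zero (by positivity)
    (fun r s _ _ => le_max_left r s) ?_⟩
  intro hA D _ x hx hx1 y a r ha hr
  have hna : 0 < ‖a‖ := norm_pos_iff.2 ha
  obtain ⟨ρ, hρ, hρr⟩ := exists_between hr
  have hρ0 : 0 < ρ := (apply_nonneg N y).trans_lt hρ
  rcases le_or_gt ρ (‖a‖ / σ) with har | har
  -- For large `a` the ball containing $y$ is enlarged to radius $|a|/\sigma$, so that the modulus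
  -- is taken exactly at $\sigma$, where it vanishes; $\delta=1$ produces the constant $2/\sigma$.
  · filter_upwards [eventually_le_mul_modulus h𝓓 hN hA (div_pos hna hσ) one_pos
      (hρ.le.trans har) ha hx hx1] with t ht
    rw [div_div_cancel₀ hna.ne', hmod] at ht
    refine le_max_of_le_right (ht.trans (le_of_eq ?_))
    ring
  -- For small `a` the modulus vanishes by monotonicity, and the gap between $\rho$ and $r$ absorbs
  -- $\delta$.
  · have h1 : modulus ξ A N (‖a‖ / ρ) ≤ 0 := by
      rw [← hmod]
      refine modulus_mono hN (div_pos hna hρ0) ?_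
      rw [div_lt_iff₀ hσ] at har
      rw [div_le_iff₀ hρ0, mul_comm]
      exact har.le
    filter_upwards [eventually_le_mul_modulus h𝓓 hN hA hρ0
      (sub_pos.2 ((one_lt_div hρ0).2 hρr)) hρ.le ha hx hx1] with t ht
    refine le_max_of_le_left (ht.trans ?_)
    calc ρ * (1 + modulus ξ A N (‖a‖ / ρ) + (r / ρ - 1)) ≤ ρ * (r / ρ) :=
          mul_le_mul_of_nonneg_left (by linarith) hρ0.le
      _ = r := mul_div_cancel₀ r hρ0.ne'

theorem upperTreeEstimates_of_isAUSmoothable (h𝓓 : IsWeakNhdsBasis 𝕜 𝓓) {p : ℝ} (hp : 1 < p)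
    (h : IsAUSmoothable ξ p A) : UpperTreeEstimates (ellpNorm 𝕜 p) ξ A := by
  obtain ⟨N, hN, h⟩ := h
  obtain ⟨C, hC, h⟩ := stepEstimate_of_isAUSmooth h𝓓 hN hp h
  exact h.upperTreeEstimates hN (isSumNorm_ellpNorm hp) hC

theorem upperTreeEstimates_of_isAUFlattenable (h𝓓 : IsWeakNhdsBasis 𝕜 𝓓)
    (h : IsAUFlattenable ξ A) : UpperTreeEstimates (c0Norm 𝕜) ξ A := by
  obtain ⟨N, hN, h⟩ := h
  obtain ⟨C, hC, h⟩ := stepEstimate_of_isAUFlat h𝓓 hN h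
  exact h.upperTreeEstimates hN isSumNorm_c0Norm hC

/-- Reduces both renormings to a scalar inequality for `op`. The value $r>1$ enters because the
one-step estimate needs $N(y)<r$ strictly, while $y$ ranges over the closed unit ball. -/
theorem NormalUpperTreeEstimates.exists_equivNorm (h𝓓 : IsWeakNhdsBasis 𝕜 𝓓)
    {E : (n : ℕ) → (Fin n → 𝕜) → ℝ} {op : ℝ → ℝ → ℝ} (hE : IsSumNorm E op)
    (h : NormalUpperTreeEstimates 𝓓 E ξ A) :
    ∃ N : Seminorm 𝕜 Y, IsEquivNorm N ∧ ∃ C > 0, ∀ σ > 0, ∀ b ≥ 0,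
      (∀ b' > b, ∃ r > 1, op r (C * σ) ≤ 1 + b') → modulus ξ A N σ ≤ b := by
  have := h𝓓.nonempty
  have := h𝓓.isDirectedOrder
  obtain ⟨C, hC, hb⟩ := h.exists_win_bound h𝓓 hE
  obtain ⟨N, hN, h⟩ := exists_equivNorm_of_win_bound hE hC.le hb
  refine ⟨N, hN, C, hC, fun σ hσ b hb hop => modulus_le h𝓓 hσ hb fun y hy x hx b' hb' => ?_⟩
  obtain ⟨r, hr, hrb⟩ := hop b' hb'
  refine ((h y (σ : 𝕜) r x (hy.trans_lt hr) hx).mono fun t ht => ?_).frequently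
  rw [RCLike.norm_ofReal, abs_of_pos hσ] at ht
  exact ht.trans hrb

theorem NormalUpperTreeEstimates.isAUSmoothable (h𝓓 : IsWeakNhdsBasis 𝕜 𝓓) {p : ℝ} (hp : 1 < p)
    (h : NormalUpperTreeEstimates 𝓓 (ellpNorm 𝕜 p) ξ A) : IsAUSmoothable ξ p A := by
  obtain ⟨N, hN, C, hC, h⟩ := h.exists_equivNorm h𝓓 (isSumNorm_ellpNorm hp)
  have hp0 : 0 < p := by linarith
  refine ⟨N, hN, C ^ p, ?_⟩
  rintro _ ⟨σ, hσ, rfl⟩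
  rw [div_le_iff₀ (Real.rpow_pos_of_pos hσ p), ← Real.mul_rpow hC.le hσ.le]
  set s := (C * σ) ^ p with hs
  have hs0 : 0 < s := Real.rpow_pos_of_pos (by positivity) p
  -- The excess of $b'$ over $s=(C\sigma)^p$ pays for $r>1$, since $(r^p+s)^{1/p}\le r+s$.
  refine h σ hσ s hs0.le fun b' hb' => ⟨1 + (b' - s), by linarith, ?_⟩
  have h1 := rpow_add_rpow_one_div_le hp.le (show 1 ≤ 1 + (b' - s) by linarith) hs0.le
  linarith

theorem NormalUpperTreeEstimates.isAUFlattenable (h𝓓 : IsWeakNhdsBasis 𝕜 𝓓)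
    (h : NormalUpperTreeEstimates 𝓓 (c0Norm 𝕜) ξ A) : IsAUFlattenable ξ A := by
  obtain ⟨N, hN, C, hC, h⟩ := h.exists_equivNorm h𝓓 isSumNorm_c0Norm
  have hσ : 0 < 1 / C := by positivity
  refine ⟨N, hN, 1 / C, hσ, le_antisymm ?_ (modulus_nonneg hN hσ)⟩
  refine h _ hσ 0 le_rfl fun b' hb' => ⟨1 + b', by linarith, max_le le_rfl ?_⟩
  rw [mul_one_div_cancel hC.ne']
  linarith

end Smooth

end

end XiSmooth

theorem theorem4p1 {𝕜 : Type*} [RCLike 𝕜]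
    {X : Type u} [NormedAddCommGroup X] [NormedSpace 𝕜 X] [CompleteSpace X]
    {Y : Type v} [NormedAddCommGroup Y] [NormedSpace 𝕜 Y] [CompleteSpace Y]
    (A : X →L[𝕜] Y) (ξ : Ordinal.{w})
    (𝓓 : Set (Set X)) (h𝓓 : XiSmooth.IsWeakNhdsBasis 𝕜 𝓓) :
    (∀ p : ℝ, 1 < p →
      (XiSmooth.IsAUSmoothable ξ p A ↔
        XiSmooth.UpperTreeEstimates (XiSmooth.ellpNorm 𝕜 p) ξ A) ∧
      (XiSmooth.IsAUSmoothable ξ p A ↔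
        XiSmooth.NormalUpperTreeEstimates 𝓓 (XiSmooth.ellpNorm 𝕜 p) ξ A)) ∧
    ((XiSmooth.IsAUFlattenable ξ A ↔
        XiSmooth.UpperTreeEstimates (XiSmooth.c0Norm 𝕜) ξ A) ∧
      (XiSmooth.IsAUFlattenable ξ A ↔
        XiSmooth.NormalUpperTreeEstimates 𝓓 (XiSmooth.c0Norm 𝕜) ξ A)) := by
  refine ⟨fun p hp => ⟨⟨fun h => ?_, fun h => ?_⟩, ⟨fun h => ?_, fun h => ?_⟩⟩,
    ⟨fun h => ?_, fun h => ?_⟩, ⟨fun h => ?_, fun h => ?_⟩⟩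
  · exact XiSmooth.upperTreeEstimates_of_isAUSmoothable h𝓓 hp h
  · exact (h.normal h𝓓).isAUSmoothable h𝓓 hp
  · exact (XiSmooth.upperTreeEstimates_of_isAUSmoothable h𝓓 hp h).normal h𝓓
  · exact h.isAUSmoothable h𝓓 hp
  · exact XiSmooth.upperTreeEstimates_of_isAUFlattenable h𝓓 h
  · exact (h.normal h𝓓).isAUFlattenable h𝓓
  · exact (XiSmooth.upperTreeEstimates_of_isAUFlattenable h𝓓 h).normal h𝓓
  · exact h.isAUFlattenable h𝓓
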